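/- For complex $a,q$ with $|q|<1$ and $n\ge 0$ put $(a;q)_n=\prod_{j=0}^{n-1}(1-aq^j)$, and let $$S(q)=\sum_{n=0}^{\infty}\frac{(-q;q^2)_n\,q^{n^2}}{(q^2;q^2)_n},\qquad T(q)=\sum_{n=0}^{\infty}\frac{(-q;q^2)_n\,q^{n(n+2)}}{(q^2;q^2)_n}$$ be the Ramanujan–Göllnitz–Gordon functions. For each positive integer $k$, define sequences of coefficients by the power series expansions $$\sum_{n\ge0}\rho_{1,k}(n)q^n=\frac{S^k(q)}{T^k(q)},\qquad \sum_{n\ge0}\rho_{2,k}(n)q^n=\frac{T(q)S(q^k)}{S(q)T(q^k)},\qquad \sum_{n\ge0}\rho_{3,k}(n)q^n=\frac{S(q)S(q^k)}{T(q)T(q^k)},$$ $$\sum_{n\ge0}\rho_{4}(n)q^n=\frac{T(q^2)S(q^4)}{S(q^2)T(q^4)},\qquad \sum_{n\ge0}\rho_{5,k}(n)q^n=\frac{S^k(-q)T^k(q)S^k(q^4)}{S^k(q)T^k(-q)T^k(q^4)},$$ $$\sum_{n\ge0}\rho_{6}(n)q^n=\frac{S(-q)T(q^2)S(q^3)}{T(-q)S(q^2)T(q^3)},\qquad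 \sum_{n\ge0}\rho_{7}(n)q^n=\frac{T(-q)T(q^2)S(q^3)}{S(-q)S(q^2)T(q^3)},$$ $$\sum_{n\ge0}\rho_{8}(n)q^n=\frac{S(q)S(-q^3)S(q^6)}{T(q)T(-q^3)T(q^6)},\qquad \sum_{n\ge0}\rho_{9}(n)q^n=\frac{S(q)T(-q^3)S(q^6)}{T(q)S(-q^3)T(q^6)},$$ and for each of these sequences $\rho$ let $\rho'$ denote the sequence of coefficients of the reciprocal series, $\sum_{n\ge0}\rho'(n)q^n=\bigl(\sum_{n\ge0}\rho(n)q^n\bigr)^{-1}$. Then, for every integer $n\ge0$, (i) $\rho_{1,1}(2n+1)=\rho_{1,1}'(2n)$; (ii) $\rho_{1,1}(4n+2)=-\rho_{1,1}'(4n+1)$; (iii) $\rho_{1,2}(2n+3)=-\rho_{1,2}'(2n+1)$; (iv) $\rho_{1,2}(8n+4)=\rho_{1,2}'(8n+2)$; (v) $\rho_{1,2}(8n+6)=\rho_{1,2}'(8n+4)$; (vi) $\rho_{1,4}(4n+6)=-\rho_{1,4}'(4n+2)$; (vii) $\rho_{2,3}(4n+5)=-\rho_{2,3}'(4n+3)$;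 (viii) $\rho_{2,5}(4n+6)=-\rho_{2,5}'(4n+2)$; (ix) $\rho_{2,7}(4n+7)=-\rho_{2,7}'(4n+1)$; (x) $\rho_{2,9}(4n+10)=-\rho_{2,9}'(4n+2)$; (xi) $\rho_{3,3}(4n+6)=-\rho_{3,3}'(4n+2)$; (xii) $\rho_{3,5}(4n+7)=-\rho_{3,5}'(4n+1)$; (xiii) $\rho_{3,9}(4n+11)=-\rho_{3,9}'(4n+1)$; (xiv) $\rho_{4}(4n+2)=-\rho_{4}'(4n)$; (xv) $\rho_{5,1}(4n+6)=-\rho_{5,1}'(4n+2)$; (xvi) $\rho_{5,1}(4n+7)=\rho_{5,1}'(4n+3)$; (xvii) $\rho_{5,1}(8n+4)=-\rho_{5,1}'(8n)$; (xviii) $\rho_{5,1}(8n+5)=\rho_{5,1}'(8n+1)$; (xix) $\rho_{5,2}(8n+12)=-\rho_{5,2}'(8n+4)$; (xx) $\rho_{6}(4n+5)=-\rho_{6}'(4n+3)$; (xxi) $\rho_{7}(8n+8)=-\rho_{7}'(8n+8)$; (xxii) $\rho_{8}(8n+13)=-\rho_{8}'(8n+3)$; (xxiii) $\rho_{9}(4n+6)=-\rho_{9}'(4n+2)$.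 -/

import Mathlib

open PowerSeries

noncomputable section

namespace GollnitzGordon

/-- The finite `q`-shifted factorial `(a; q)_n = ∏_{j < n} (1 - a q ^ j)`, for formal power series
`a` and `q`. -/
def qPoch (a q : ℂ⟦X⟧) (n : ℕ) : ℂ⟦X⟧ :=
  ∏ j ∈ Finset.range n, (1 - a * q ^ j)

/-- The sum `∑_{n ≥ 0} u n` of a sequence of formal power series such that `X ^ n` divides `u n`:
the coefficient of `X ^ m` only involves the terms with `n ≤ m`. See `hasSum_seriesSum`. -/
def seriesSum (u : ℕ → ℂ⟦X⟧) : ℂ⟦X⟧ :=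
  PowerSeries.mk fun m => ∑ n ∈ Finset.range (m + 1), coeff m (u n)

/-- The `n`-th term `(-q; q²)_n q ^ (n²) / (q²; q²)_n` of the series of `S`. -/
def termS (q : ℂ⟦X⟧) (n : ℕ) : ℂ⟦X⟧ :=
  qPoch (-q) (q ^ 2) n * q ^ (n ^ 2) * (qPoch (q ^ 2) (q ^ 2) n)⁻¹

/-- The `n`-th term `(-q; q²)_n q ^ (n (n + 2)) / (q²; q²)_n` of the series of `T`. -/
def termT (q : ℂ⟦X⟧) (n : ℕ) : ℂ⟦X⟧ :=
  qPoch (-q) (q ^ 2) n * q ^ (n * (n + 2)) * (qPoch (q ^ 2) (q ^ 2) n)⁻¹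

/-- The Ramanujan–Göllnitz–Gordon function
`S(q) = ∑_{n ≥ 0} (-q; q²)_n q ^ (n²) / (q²; q²)_n`, for a formal power series `q` without constant
term (for instance `X`, `-X` or `X ^ k` with `k ≥ 1`). -/
def S (q : ℂ⟦X⟧) : ℂ⟦X⟧ := seriesSum (termS q)

/-- The Ramanujan–Göllnitz–Gordon function
`T(q) = ∑_{n ≥ 0} (-q; q²)_n q ^ (n (n + 2)) / (q²; q²)_n`, for a formal power series `q` without
constant term. -/
def T (q : ℂ⟦X⟧) : ℂ⟦X⟧ := seriesSum (termT q)

/-! ### The definitions make sense: the sums converge and all denominators are invertible -/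

open PowerSeries.WithPiTopology in
theorem hasSum_seriesSum {u : ℕ → ℂ⟦X⟧} (hu : ∀ n, X ^ n ∣ u n) : HasSum u (seriesSum u) := by
  rw [PowerSeries.WithPiTopology.hasSum_iff_hasSum_coeff]
  intro m
  rw [seriesSum, coeff_mk]
  apply hasSum_sum_of_ne_finset_zero
  intro n hn
  rw [Finset.mem_range, not_lt] at hn
  exact X_pow_dvd_iff.1 (hu n) m (by omega)

theorem X_pow_dvd_termS {q : ℂ⟦X⟧} (hq : constantCoeff q = 0) (n : ℕ) : X ^ n ∣ termS q n := by
  have h : X ^ n ∣ q ^ (n ^ 2) :=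
    (pow_dvd_pow_of_dvd (X_dvd_iff.2 hq) n).trans (pow_dvd_pow q (Nat.le_self_pow (by norm_num) n))
  exact Dvd.dvd.mul_right (Dvd.dvd.mul_left h _) _

theorem X_pow_dvd_termT {q : ℂ⟦X⟧} (hq : constantCoeff q = 0) (n : ℕ) : X ^ n ∣ termT q n := by
  have h : X ^ n ∣ q ^ (n * (n + 2)) :=
    (pow_dvd_pow_of_dvd (X_dvd_iff.2 hq) n).trans (pow_dvd_pow q (by nlinarith))
  exact Dvd.dvd.mul_right (Dvd.dvd.mul_left h _) _

open PowerSeries.WithPiTopology in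
theorem hasSum_S {q : ℂ⟦X⟧} (hq : constantCoeff q = 0) : HasSum (termS q) (S q) :=
  hasSum_seriesSum (X_pow_dvd_termS hq)

open PowerSeries.WithPiTopology in
theorem hasSum_T {q : ℂ⟦X⟧} (hq : constantCoeff q = 0) : HasSum (termT q) (T q) :=
  hasSum_seriesSum (X_pow_dvd_termT hq)

theorem constantCoeff_qPoch {a : ℂ⟦X⟧} (ha : constantCoeff a = 0) (q : ℂ⟦X⟧) (n : ℕ) :
    constantCoeff (qPoch a q n) = 1 := by
  simp [qPoch, map_prod, ha]

theorem constantCoeff_S (q : ℂ⟦X⟧) : constantCoeff (S q) = 1 := by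
  rw [← coeff_zero_eq_constantCoeff_apply]
  simp [S, seriesSum, termS, qPoch]

theorem constantCoeff_T (q : ℂ⟦X⟧) : constantCoeff (T q) = 1 := by
  rw [← coeff_zero_eq_constantCoeff_apply]
  simp [T, seriesSum, termT, qPoch]

/-! ### The quotients -/

/-- `S(q)^k / T(q)^k` -/
def quot1 (k : ℕ) : ℂ⟦X⟧ := S X ^ k * (T X ^ k)⁻¹

/-- `T(q) S(q^k) / (S(q) T(q^k))` -/
def quot2 (k : ℕ) : ℂ⟦X⟧ := T X * S (X ^ k) * (S X * T (X ^ k))⁻¹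

/-- `S(q) S(q^k) / (T(q) T(q^k))` -/
def quot3 (k : ℕ) : ℂ⟦X⟧ := S X * S (X ^ k) * (T X * T (X ^ k))⁻¹

/-- `T(q²) S(q⁴) / (S(q²) T(q⁴))` -/
def quot4 : ℂ⟦X⟧ := T (X ^ 2) * S (X ^ 4) * (S (X ^ 2) * T (X ^ 4))⁻¹

/-- `S(-q)^k T(q)^k S(q⁴)^k / (S(q)^k T(-q)^k T(q⁴)^k)` -/
def quot5 (k : ℕ) : ℂ⟦X⟧ :=
  S (-X) ^ k * T X ^ k * S (X ^ 4) ^ k * (S X ^ k * T (-X) ^ k * T (X ^ 4) ^ k)⁻¹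

/-- `S(-q) T(q²) S(q³) / (T(-q) S(q²) T(q³))` -/
def quot6 : ℂ⟦X⟧ := S (-X) * T (X ^ 2) * S (X ^ 3) * (T (-X) * S (X ^ 2) * T (X ^ 3))⁻¹

/-- `T(-q) T(q²) S(q³) / (S(-q) S(q²) T(q³))` -/
def quot7 : ℂ⟦X⟧ := T (-X) * T (X ^ 2) * S (X ^ 3) * (S (-X) * S (X ^ 2) * T (X ^ 3))⁻¹

/-- `S(q) S(-q³) S(q⁶) / (T(q) T(-q³) T(q⁶))` -/
def quot8 : ℂ⟦X⟧ := S X * S (-X ^ 3) * S (X ^ 6) * (T X * T (-X ^ 3) * T (X ^ 6))⁻¹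

/-- `S(q) T(-q³) S(q⁶) / (T(q) S(-q³) T(q⁶))` -/
def quot9 : ℂ⟦X⟧ := S X * T (-X ^ 3) * S (X ^ 6) * (T X * S (-X ^ 3) * T (X ^ 6))⁻¹

/-! ### The coefficient sequences `ρ` of the quotients and `ρ'` of their reciprocals -/

def rho1 (k n : ℕ) : ℂ := coeff n (quot1 k)
def rho1' (k n : ℕ) : ℂ := coeff n (quot1 k)⁻¹
def rho2 (k n : ℕ) : ℂ := coeff n (quot2 k)
def rho2' (k n : ℕ) : ℂ := coeff n (quot2 k)⁻¹
def rho3 (k n : ℕ) : ℂ := coeff n (quot3 k)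
def rho3' (k n : ℕ) : ℂ := coeff n (quot3 k)⁻¹
def rho4 (n : ℕ) : ℂ := coeff n quot4
def rho4' (n : ℕ) : ℂ := coeff n quot4⁻¹
def rho5 (k n : ℕ) : ℂ := coeff n (quot5 k)
def rho5' (k n : ℕ) : ℂ := coeff n (quot5 k)⁻¹
def rho6 (n : ℕ) : ℂ := coeff n quot6
def rho6' (n : ℕ) : ℂ := coeff n quot6⁻¹
def rho7 (n : ℕ) : ℂ := coeff n quot7
def rho7' (n : ℕ) : ℂ := coeff n quot7⁻¹
def rho8 (n : ℕ) : ℂ := coeff n quot8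
def rho8' (n : ℕ) : ℂ := coeff n quot8⁻¹
def rho9 (n : ℕ) : ℂ := coeff n quot9
def rho9' (n : ℕ) : ℂ := coeff n quot9⁻¹

end GollnitzGordon

end

/-! Write R(q) = S(q)/T(q). Every quotient in the theorem is a product of values R(±X^k) and their
inverses, so each claim compares such a product P with its reciprocal. It says that P ± X^a P⁻¹ has
no terms in a certain residue class of exponents, up to at most one monomial z X^j. That monomial is
the reason why some of the index ranges start late.

The analytic input is R(q) = A/B, with A = ∑ (-q)^(4n²+n) and B = ∑ (-q)^(4n²+3n) over all integers
n (`S_mul_theta`). It is proved without product formulas. S and T are the first two terms of a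
solution of a three-term recurrence, and A, B are the first two terms of another one, whose later
terms are Selberg's series. The Casoratian of two solutions is X-adically infinitely divisible,
hence zero.

Ramanujan's φ and ψ give A² ∓ qB² and AB in closed form, and division yields ψ(q⁴)(R - q/R) = φ(q²)
and ψ(q⁴)(R + q/R) = φ(q) (`psi_mul_ratio_sub`, `psi_mul_ratio_add`). So both R and q/R are half
sums or half differences of φ(q) and φ(q²), divided by ψ(q⁴).

After clearing denominators, which are series in X^m and therefore preserve residue classes modulo m
(`Vanish.of_mul_eq`), each claim is a statement about which residue classes occur in a polynomial in
theta functions. The dissections `phi_split`, `phi_sq`, `psi_sq` settle most of them. Where 3 or 7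
is involved, a theta product from the dissection can be a monomial times the cleared denominator,
and this produces the exceptional monomial. That rests on `psi_mul_psi_cube` and
`phi_mul_phi_seven`, which come from the lattices of x² + 3y² and of the norm form of ℚ(√-7). The
two claims modulo 8 about `quot7` and `quot8` need in addition the 2-dissections of ψ(q)³/ψ(q³) and
ψ(q³)³/ψ(q), which follow from cubic modular equations. -/

namespace GollnitzGordon

/-! ### Formal sums of powers q^e(i) over an index set -/

section ThetaSums

open scoped PowerSeries.WithPiTopology

/-- An exponent function with nonnegative values and finite sublevel sets. -/
structure Admissible {ι : Type*} (e : ι → ℤ) : Prop where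
  nonneg : ∀ i, 0 ≤ e i
  finite : ∀ N : ℤ, {i | e i ≤ N}.Finite

/-- The sum of `q ^ e i` over the index type. -/
noncomputable def powSum {ι : Type*} (q : ℂ⟦X⟧) (e : ι → ℤ) : ℂ⟦X⟧ := ∑' i, q ^ (e i).toNat

variable {ι κ : Type*} {q : ℂ⟦X⟧}

theorem Admissible.comp {e : ι → ℤ} (he : Admissible e) {f : κ → ι} (hf : f.Injective) :
    Admissible fun k => e (f k) :=
  ⟨fun k => he.nonneg (f k), fun N => Set.Finite.preimage (f := f) hf.injOn (he.finite N)⟩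

theorem Admissible.add {e : ι → ℤ} {e' : κ → ℤ} (he : Admissible e) (he' : Admissible e') :
    Admissible fun p : ι × κ => e p.1 + e' p.2 := by
  refine ⟨fun p => add_nonneg (he.nonneg _) (he'.nonneg _), fun N => ?_⟩
  refine ((he.finite N).prod (he'.finite N)).subset fun p hp => ?_
  have h1 := he.nonneg p.1
  have h2 := he'.nonneg p.2
  simp only [Set.mem_ofPred_eq] at hp
  exact ⟨by simp only [Set.mem_ofPred_eq]; omega, by simp only [Set.mem_ofPred_eq]; omega⟩

theorem Admissible.congr {e e' : ι → ℤ} (he : Admissible e) (h : ∀ i, e i = e' i) :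
    Admissible e' := by
  have : e = e' := funext h
  exact this ▸ he

theorem summable_pow_toNat (hq : constantCoeff q = 0) {e : ι → ℤ} (he : Admissible e) :
    Summable fun i => q ^ (e i).toNat := by
  rw [PowerSeries.WithPiTopology.summable_iff_summable_coeff]
  intro m
  refine summable_of_hasFiniteSupport ((he.finite m).subset fun i hi => ?_)
  by_contra h
  refine hi (X_pow_dvd_iff.1 (pow_dvd_pow_of_dvd (X_dvd_iff.2 hq) (e i).toNat) m ?_)
  simp only [Set.mem_ofPred_eq] at h
  omega

theorem powSum_congr {e e' : ι → ℤ} (h : ∀ i, e i = e' i) : powSum q e = powSum q e' := by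
  rw [funext h]

theorem powSum_equiv (σ : κ ≃ ι) (e : ι → ℤ) : powSum q e = powSum q fun k => e (σ k) :=
  (σ.tsum_eq fun i => q ^ (e i).toNat).symm

/-- The engine of all dissections: when two injections partition the index set, the sum splits and
each half is reindexed. For theta series the injections parametrise cosets of a sublattice. -/
theorem powSum_split (hq : constantCoeff q = 0) {e : ι → ℤ} (he : Admissible e) {f g : κ → ι}
    (hf : f.Injective) (hg : g.Injective) (hd : ∀ x y, f x ≠ g y)
    (hc : ∀ i, (∃ x, f x = i) ∨ ∃ y, g y = i) :
    powSum q e = powSum q (fun k => e (f k)) + powSum q (fun k => e (g k)) := by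
  have hcompl : IsCompl (Set.range f) (Set.range g) := by
    refine ⟨Set.disjoint_left.2 ?_, codisjoint_iff.2 (Set.eq_univ_of_forall fun i => ?_)⟩
    · rintro _ ⟨x, rfl⟩ ⟨y, hy⟩
      exact hd x y hy.symm
    · rcases hc i with h | h
      · exact Or.inl h
      · exact Or.inr h
  have hf' := hf.hasSum_range_iff (f := fun i => q ^ (e i).toNat) (a := powSum q fun k => e (f k))
  have hg' := hg.hasSum_range_iff (f := fun i => q ^ (e i).toNat) (a := powSum q fun k => e (g k))
  have h1 := hf'.2 (summable_pow_toNat hq (he.comp hf)).hasSum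
  have h2 := hg'.2 (summable_pow_toNat hq (he.comp hg)).hasSum
  have h3 := HasSum.add_isCompl (f := fun i => q ^ (e i).toNat) hcompl h1 h2
  exact h3.tsum_eq

theorem powSum_mul (hq : constantCoeff q = 0) {e : ι → ℤ} {e' : κ → ℤ} (he : Admissible e)
    (he' : Admissible e') :
    powSum q e * powSum q e' = powSum q fun p : ι × κ => e p.1 + e' p.2 := by
  have h : (fun p : ι × κ => q ^ (e p.1 + e' p.2).toNat)
      = fun p : ι × κ => q ^ (e p.1).toNat * q ^ (e' p.2).toNat := by
    funext p
    rw [Int.toNat_add (he.nonneg _) (he'.nonneg _), pow_add]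
  have hs := summable_pow_toNat hq (he.add he')
  rw [h] at hs
  have : T3Space ℂ⟦X⟧ := inferInstance
  rw [powSum, powSum, powSum, h,
    (summable_pow_toNat hq he).tsum_mul_tsum (summable_pow_toNat hq he') hs]

theorem powSum_add_const {e : ι → ℤ} (he : Admissible e) (hq : constantCoeff q = 0) (c : ℕ) :
    powSum q (fun i => e i + c) = q ^ c * powSum q e := by
  rw [powSum, powSum, ← (summable_pow_toNat hq he).tsum_mul_left]
  refine tsum_congr fun i => ?_
  rw [Int.toNat_add (he.nonneg _) (by positivity), Int.toNat_natCast, pow_add, mul_comm]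

theorem powSum_pow (k : ℕ) (e : ι → ℤ) : powSum (q ^ k) e = powSum q fun i => k * e i := by
  refine tsum_congr fun i => ?_
  rw [← pow_mul]
  congr 1
  rcases le_total 0 (e i) with h | h
  · rw [Int.toNat_mul (by positivity) h, Int.toNat_natCast]
  · rw [Int.toNat_of_nonpos h, mul_zero,
      Int.toNat_of_nonpos (mul_nonpos_of_nonneg_of_nonpos (by positivity) h)]

theorem hasSum_coeff_powSum (hq : constantCoeff q = 0) {e : ι → ℤ} (he : Admissible e) (m : ℕ) :
    HasSum (fun i => coeff m (q ^ (e i).toNat)) (coeff m (powSum q e)) :=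
  (PowerSeries.WithPiTopology.hasSum_iff_hasSum_coeff ℂ).1 (summable_pow_toNat hq he).hasSum m

theorem hasSum_powSum (hq : constantCoeff q = 0) {e : ι → ℤ} (he : Admissible e) :
    HasSum (fun i => q ^ (e i).toNat) (powSum q e) :=
  (summable_pow_toNat hq he).hasSum

end ThetaSums

/-! ### One-dimensional theta series -/

/-- The exponent is at least a(|n|² - |n|), which is nonnegative on integers and grows. The boundary
case |b| = a is allowed; there the exponent 0 is attained twice. -/
theorem admissible_quadratic {a b : ℤ} (ha : 1 ≤ a) (hb : |b| ≤ a) :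
    Admissible fun n : ℤ => a * n ^ 2 + b * n := by
  have key : ∀ n : ℤ, a * (|n| ^ 2 - |n|) ≤ a * n ^ 2 + b * n := by
    intro n
    have h1 : -(a * |n|) ≤ b * n := by
      have := neg_abs_le (b * n)
      rw [abs_mul] at this
      nlinarith [abs_nonneg n]
    rw [← sq_abs n]
    linarith
  have hsq : ∀ n : ℤ, 0 ≤ |n| ^ 2 - |n| := by
    intro n
    rcases (abs_nonneg n).eq_or_lt with h | h
    · simp [← h]
    · nlinarith
  refine ⟨fun n => (mul_nonneg (by omega) (hsq n)).trans (key n), fun N => ?_⟩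
  refine (Set.finite_Icc (-(N + 1)) (N + 1)).subset fun n hn => ?_
  simp only [Set.mem_ofPred_eq] at hn
  have h1 := key n
  have h2 := hsq n
  have h3 : |n| ≤ N + 1 := by
    rcases lt_or_ge |n| 2 with h | h
    · have : 0 ≤ a * (|n| ^ 2 - |n|) := mul_nonneg (by omega) h2
      omega
    · nlinarith
  exact abs_le.1 h3

/-- The theta series `∑_{n ∈ ℤ} q ^ (a n² + b n)`. -/
noncomputable def theta (a b : ℤ) (q : ℂ⟦X⟧) : ℂ⟦X⟧ := powSum q fun n : ℤ => a * n ^ 2 + b * n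

section Theta

variable {q : ℂ⟦X⟧} {a b c d : ℤ}

theorem theta_neg (a b : ℤ) (q : ℂ⟦X⟧) : theta a (-b) q = theta a b q := by
  rw [theta, powSum_equiv (Equiv.neg ℤ), theta]
  exact powSum_congr fun n => by simp

theorem theta_pow (a b : ℤ) (q : ℂ⟦X⟧) (k : ℕ) :
    theta a b (q ^ k) = theta (k * a) (k * b) q := by
  rw [theta, powSum_pow, theta]
  exact powSum_congr fun n => by ring

/-- Separates even and odd n. The sign condition on b keeps the linear coefficient 4a + 2b of the
odd half within the admissible range; by `theta_neg` it costs nothing. -/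
theorem theta_split (hq : constantCoeff q = 0) (ha : 1 ≤ a) (hb : |b| ≤ a) (hb0 : b ≤ 0) :
    theta a b q = theta (4 * a) (2 * b) q + q ^ (a + b).toNat * theta (4 * a) (4 * a
      + 2 * b) q := by
  have hb' := abs_le.1 hb
  rw [theta, powSum_split (κ := ℤ) hq (admissible_quadratic ha hb) (f := fun n => 2 * n)
    (g := fun n => 2 * n + 1)
    (fun x y h => by simp only at h; omega) (fun x y h => by simp only at h; omega)
    (fun x y h => by omega) (fun i => ?_)]
  · congr 1
    · exact powSum_congr fun n => by ring
    · rw [theta, ← powSum_add_const (admissible_quadratic (by omega)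
        (abs_le.2 ⟨by omega, by omega⟩)) hq]
      exact powSum_congr fun n => by rw [Int.toNat_of_nonneg (by omega)]; ring
  · rcases Int.even_or_odd' i with ⟨k, h | h⟩
    · exact .inl ⟨k, h.symm⟩
    · exact .inr ⟨k, h.symm⟩

theorem theta_self (hq : constantCoeff q = 0) (ha : 1 ≤ a) :
    theta a a q = 2 * theta (4 * a) (2 * a) q := by
  have ha' : |a| ≤ a := (abs_of_pos (by omega)).le
  rw [← theta_neg, theta_split hq ha (by rwa [abs_neg]) (by omega), mul_neg, theta_neg,
    show 4 * a + -(2 * a) = 2 * a by ring]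
  simp only [add_neg_cancel, Int.toNat_zero, pow_zero]
  ring

theorem powSum_eq_theta_mul (hq : constantCoeff q = 0) (ha : 1 ≤ a) (hb : |b| ≤ a) (hc : 1 ≤ c)
    (hd : |d| ≤ c) (k : ℕ) {e : ℤ × ℤ → ℤ}
    (he : ∀ u v, e (u, v) = a * u ^ 2 + b * u + (c * v ^ 2 + d * v) + k) :
    powSum q e = q ^ k * (theta a b q * theta c d q) := by
  rw [theta, theta, powSum_mul hq (admissible_quadratic ha hb) (admissible_quadratic hc hd),
    ← powSum_add_const ((admissible_quadratic ha hb).add (admissible_quadratic hc hd)) hq]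
  exact powSum_congr fun p => he p.1 p.2

theorem theta_mul_theta (hq : constantCoeff q = 0) (ha : 1 ≤ a) (hb : |b| ≤ a) (hc : 1 ≤ c)
    (hd : |d| ≤ c) : theta a b q * theta c d q
      = powSum q fun p : ℤ × ℤ => a * p.1 ^ 2 + b * p.1 + (c * p.2 ^ 2 + d * p.2) :=
  powSum_mul hq (admissible_quadratic ha hb) (admissible_quadratic hc hd)

/-- Rotation of the square lattice by 45 degrees. -/
theorem theta_mul_theta_rotate (hq : constantCoeff q = 0) (ha : 1 ≤ a) (hb : |b| ≤ a)
    (hd : |d| ≤ a) (h1 : b + d ≤ 0) (h2 : b ≤ d) :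
    theta a b q * theta a d q = theta (2 * a) (b + d) q * theta (2 * a) (b - d) q
      + q ^ (a + b).toNat * (theta (2 * a) (2 * a + b + d) q * theta (2 * a) (2 * a + b
      - d) q) := by
  have hb' := abs_le.1 hb
  have hd' := abs_le.1 hd
  rw [theta_mul_theta hq ha hb ha hd, powSum_split (κ := ℤ × ℤ) hq
    ((admissible_quadratic ha hb).add (admissible_quadratic ha hd))
    -- The two injections cover the pairs with equal and with opposite parity; on each the form a(x²
    -- + y²) becomes 2a(u² + v²) plus linear terms.
    (f := fun p => (p.1 + p.2, p.1 - p.2)) (g := fun p => (p.1 + p.2 + 1, p.1 - p.2))]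
  · congr 1
    · rw [← one_mul (_ * _), ← pow_zero q]
      refine powSum_eq_theta_mul hq (by omega) (abs_le.2 ⟨by omega, by omega⟩) (by omega)
        (abs_le.2 ⟨by omega, by omega⟩) 0 fun u v => ?_
      push_cast
      ring
    · refine powSum_eq_theta_mul hq (by omega) (abs_le.2 ⟨by omega, by omega⟩) (by omega)
        (abs_le.2 ⟨by omega, by omega⟩) _ fun u v => ?_
      rw [Int.toNat_of_nonneg (by omega)]
      ring
  · rintro ⟨x, y⟩ ⟨x', y'⟩ h
    simp only [Prod.mk.injEq] at h ⊢
    omega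
  · rintro ⟨x, y⟩ ⟨x', y'⟩ h
    simp only [Prod.mk.injEq] at h ⊢
    omega
  · rintro ⟨x, y⟩ ⟨x', y'⟩ h
    simp only [Prod.mk.injEq] at h
    omega
  · rintro ⟨x, y⟩
    rcases Int.even_or_odd' (x - y) with ⟨k, h | h⟩
    · exact .inl ⟨(y + k, k), by simp only [Prod.mk.injEq]; omega⟩
    · exact .inr ⟨(y + k, k), by simp only [Prod.mk.injEq]; omega⟩

theorem constantCoeff_theta (hq : constantCoeff q = 0) (ha : 1 ≤ a) (hb : |b| < a) :
    constantCoeff (theta a b q) = 1 := by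
  have hb' := abs_lt.1 hb
  have h := hasSum_coeff_powSum hq (admissible_quadratic ha hb.le) 0
  rw [theta, ← coeff_zero_eq_constantCoeff_apply]
  refine h.unique ?_
  convert hasSum_ite_eq (0 : ℤ) (1 : ℂ) using 2 with n
  split_ifs with hn
  · simp [hn]
  · rw [coeff_zero_eq_constantCoeff_apply, map_pow, hq, zero_pow]
    have : 0 < a * n ^ 2 + b * n := by
      have h0 : 0 < |n| := abs_pos.2 hn
      have h1 := neg_abs_le (b * n)
      rw [abs_mul] at h1
      rw [← sq_abs n]
      nlinarith [mul_pos h0 (sub_pos.2 hb), mul_nonneg (mul_nonneg (by omega : 0 ≤ a) h0.le)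
        (by omega : 0 ≤ |n| - 1)]
    omega

end Theta

/-- Ramanujan's theta function `φ(q) = ∑_{n ∈ ℤ} q ^ (n²)`. -/
noncomputable def phi (q : ℂ⟦X⟧) : ℂ⟦X⟧ := theta 1 0 q

/-- Ramanujan's theta function `ψ(q) = ∑_{n ∈ ℤ} q ^ (2 n² + n)`. -/
noncomputable def psi (q : ℂ⟦X⟧) : ℂ⟦X⟧ := theta 2 1 q

/-! ### Ramanujan's identities for φ and ψ -/

section Identities

variable {q : ℂ⟦X⟧}

theorem constantCoeff_pow_eq_zero (hq : constantCoeff q = 0) {k : ℕ} (hk : k ≠ 0) :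
    constantCoeff (q ^ k) = 0 := by
  rw [map_pow, hq, zero_pow hk]

theorem constantCoeff_neg_eq_zero (hq : constantCoeff q = 0) : constantCoeff (-q) = 0 := by
  rw [map_neg, hq, neg_zero]

theorem constantCoeff_phi (hq : constantCoeff q = 0) : constantCoeff (phi q) = 1 :=
  constantCoeff_theta hq (by norm_num) (by norm_num)

theorem constantCoeff_psi (hq : constantCoeff q = 0) : constantCoeff (psi q) = 1 :=
  constantCoeff_theta hq (by norm_num) (by norm_num)

theorem phi_pow (q : ℂ⟦X⟧) (k : ℕ) : phi (q ^ k) = theta k 0 q := by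
  rw [phi, theta_pow, mul_one, mul_zero]

theorem psi_pow (q : ℂ⟦X⟧) (k : ℕ) : psi (q ^ k) = theta (2 * k) k q := by
  rw [psi, theta_pow, mul_one, mul_comm (k : ℤ)]

theorem theta_self_eq_psi (hq : constantCoeff q = 0) (k : ℕ) (hk : k ≠ 0) :
    theta k k q = 2 * psi (q ^ (2 * k)) := by
  rw [theta_self hq (by omega), psi_pow]
  congr 2
  push_cast
  ring

theorem phi_split (hq : constantCoeff q = 0) :
    phi q = phi (q ^ 4) + 2 * q * psi (q ^ 8) := by
  have h := theta_self_eq_psi hq 4 (by norm_num)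
  rw [phi, theta_split hq (by norm_num) (by norm_num) (by norm_num), phi_pow]
  norm_num at h ⊢
  rw [h]
  ring

theorem phi_sq (hq : constantCoeff q = 0) :
    phi q ^ 2 = phi (q ^ 2) ^ 2 + 4 * q * psi (q ^ 4) ^ 2 := by
  have h := theta_self_eq_psi hq 2 (by norm_num)
  rw [sq, phi, theta_mul_theta_rotate hq (by norm_num) (by norm_num) (by norm_num) (by norm_num)
    (by norm_num), phi_pow]
  norm_num at h ⊢
  rw [h]
  ring

/-- Rotating the lattice leaves ψ(q²) as a common factor, and the cofactor is the 2-dissection of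
φ(q). -/
theorem psi_sq (hq : constantCoeff q = 0) : psi q ^ 2 = phi q * psi (q ^ 2) := by
  have h := theta_self_eq_psi hq 4 (by norm_num)
  rw [phi_split hq, sq, psi, ← theta_neg, theta_mul_theta_rotate hq (by norm_num) (by norm_num)
    (by norm_num) (by norm_num) (by norm_num), phi_pow, psi_pow q 2]
  norm_num [theta_neg] at h ⊢
  rw [h]
  ring

/-- Several theta identities are algebraic consequences of known ones only after squaring; the
constant term then selects the sign. -/
theorem eq_of_sq_eq_sq {f g : ℂ⟦X⟧} (hf : constantCoeff f = 1) (hg : constantCoeff g = 1)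
    (h : f ^ 2 = g ^ 2) : f = g := by
  rcases sq_eq_sq_iff_eq_or_eq_neg.1 h with h | h
  · exact h
  · rw [h, map_neg, hg] at hf
    norm_num at hf

theorem phi_mul_phi_neg (hq : constantCoeff q = 0) : phi q * phi (-q) = phi (-q ^ 2) ^ 2 := by
  have h1 := phi_split hq
  have h2 := phi_split (constantCoeff_neg_eq_zero hq)
  have h3 := phi_sq (constantCoeff_neg_eq_zero (constantCoeff_pow_eq_zero hq two_ne_zero))
  have e1 : (-q) ^ 4 = q ^ 4 := by ring
  have e2 : (-q) ^ 8 = q ^ 8 := by ring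
  have e3 : (-q ^ 2) ^ 2 = q ^ 4 := by ring
  have e4 : (-q ^ 2) ^ 4 = q ^ 8 := by ring
  rw [e1, e2] at h2
  rw [e3, e4] at h3
  rw [h1, h2, h3]
  ring

/-- The theta series with exponents `4 n² - n` and `4 n² + 3 n`. -/
theorem theta_four_sq_add (hq : constantCoeff q = 0) :
    theta 4 1 q ^ 2 + q * theta 4 3 q ^ 2 = psi q * phi (q ^ 2) := by
  have h := theta_self_eq_psi hq 8 (by norm_num)
  have hs := phi_split (constantCoeff_pow_eq_zero hq two_ne_zero)
  have hp : psi q = theta 8 2 q + q * theta 8 6 q := by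
    rw [psi, ← theta_neg, theta_split hq (by norm_num) (by norm_num) (by norm_num)]
    norm_num [theta_neg]
  have h1 := theta_mul_theta_rotate (a := 4) (b := -1) (d := -1) hq (by norm_num) (by norm_num)
    (by norm_num) (by norm_num) (by norm_num)
  have h3 := theta_mul_theta_rotate (a := 4) (b := -3) (d := -3) hq (by norm_num) (by norm_num)
    (by norm_num) (by norm_num) (by norm_num)
  simp only [← pow_mul] at hs
  rw [phi_pow q (2 * 4)] at hs
  norm_num [theta_neg] at h h1 h3 hs
  have e3 : (3 : ℤ).toNat = 3 := rfl
  rw [e3] at h1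
  rw [hp, hs, sq, sq, h1, h3, h]
  ring

theorem theta_four_mul (hq : constantCoeff q = 0) :
    theta 4 1 q * theta 4 3 q = psi (q ^ 4) * psi q := by
  have hp : psi q = theta 8 2 q + q * theta 8 6 q := by
    rw [psi, ← theta_neg, theta_split hq (by norm_num) (by norm_num) (by norm_num)]
    norm_num [theta_neg]
  have h1 := theta_mul_theta_rotate (a := 4) (b := -3) (d := -1) hq (by norm_num) (by norm_num)
    (by norm_num) (by norm_num) (by norm_num)
  norm_num [theta_neg] at h1
  rw [hp, psi_pow, mul_comm, h1]
  norm_num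
  ring

/-- With A, B the two theta series, (A² - qB²)² = (A² + qB²)² - 4q(AB)², and `phi_sq` at -q turns
the right side into ψ(q)² φ(-q)². -/
theorem theta_four_sq_sub (hq : constantCoeff q = 0) :
    theta 4 1 q ^ 2 - q * theta 4 3 q ^ 2 = psi q * phi (-q) := by
  have hn := constantCoeff_neg_eq_zero hq
  have h1 := theta_four_sq_add hq
  have h2 := theta_four_mul hq
  have h3 := phi_sq hn
  have e1 : (-q) ^ 2 = q ^ 2 := by ring
  have e2 : (-q) ^ 4 = q ^ 4 := by ring
  rw [e1, e2] at h3
  refine eq_of_sq_eq_sq ?_ ?_ ?_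
  · simp [hq, constantCoeff_theta (a := 4) (b := 1) hq (by norm_num) (by norm_num)]
  · simp [constantCoeff_psi hq, constantCoeff_phi hn]
  · linear_combination (theta 4 1 q ^ 2 + q * theta 4 3 q ^ 2 + psi q * phi (q ^ 2)) * h1
      - 4 * q * (theta 4 1 q * theta 4 3 q + psi (q ^ 4) * psi q) * h2 - psi q ^ 2 * h3

/-! ### Two-dimensional lattices: identities of degree 3 and 7 -/

theorem powSum_split_snd (hq : constantCoeff q = 0) {e : ℤ × ℤ → ℤ} (he : Admissible e) :
    powSum q e = powSum q (fun p : ℤ × ℤ => e (p.1, 2 * p.2))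
      + powSum q fun p : ℤ × ℤ => e (p.1, 2 * p.2 + 1) := by
  refine powSum_split hq he (f := fun p : ℤ × ℤ => (p.1, 2 * p.2))
    (g := fun p => (p.1, 2 * p.2 + 1)) ?_ ?_ ?_ ?_
  · rintro ⟨x, y⟩ ⟨x', y'⟩ h
    simp only [Prod.mk.injEq] at h ⊢
    omega
  · rintro ⟨x, y⟩ ⟨x', y'⟩ h
    simp only [Prod.mk.injEq] at h ⊢
    omega
  · rintro ⟨x, y⟩ ⟨x', y'⟩ h
    simp only [Prod.mk.injEq] at h
    omega
  · rintro ⟨x, y⟩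
    rcases Int.even_or_odd' y with ⟨k, h | h⟩
    · exact .inl ⟨(x, k), Prod.ext rfl h.symm⟩
    · exact .inr ⟨(x, k), Prod.ext rfl h.symm⟩

theorem powSum_swap (e : ℤ × ℤ → ℤ) : powSum q e = powSum q fun p : ℤ × ℤ => e (p.2, p.1) :=
  powSum_equiv (Equiv.prodComm ℤ ℤ) e

theorem powSum_split_fst (hq : constantCoeff q = 0) {e : ℤ × ℤ → ℤ} (he : Admissible e) :
    powSum q e = powSum q (fun p : ℤ × ℤ => e (2 * p.1, p.2))
      + powSum q fun p : ℤ × ℤ => e (2 * p.1 + 1, p.2) := by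
  have h := powSum_split_snd hq (he.comp (Equiv.prodComm ℤ ℤ).injective)
  rw [← powSum_equiv] at h
  rw [h, powSum_swap fun p => e (2 * p.1, p.2), powSum_swap fun p => e (2 * p.1 + 1, p.2)]
  rfl

theorem powSum_shear (c : ℤ) (e : ℤ × ℤ → ℤ) :
    powSum q e = powSum q fun p : ℤ × ℤ => e (p.1 + c * p.2, p.2) :=
  powSum_equiv
    { toFun := fun p : ℤ × ℤ => (p.1 + c * p.2, p.2)
      invFun := fun p => (p.1 - c * p.2, p.2)
      left_inv := fun p => by ext <;> simp
      right_inv := fun p => by ext <;> simp } e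

theorem phi_eq_split (hq : constantCoeff q = 0) : phi q = theta 4 0 q + q * theta 4 4 q := by
  rw [phi, theta_split hq (by norm_num) (by norm_num) (by norm_num)]
  norm_num

/-- With a = 4x + 1 and b = 4y + 1, the exponent e satisfies 8e + 4 = a² + 3b². The map (a, b) ↦ ((a
+ 3b)/2, (a - b)/2) preserves this form. Splitting by the parity of x - y, and then once more, gives
four cosets on which the new coordinates are free and the exponent is diagonal. -/
theorem psi_mul_psi_cube (hq : constantCoeff q = 0) :
    psi q * psi (q ^ 3)
      = psi (q ^ 4) * phi (q ^ 6) + q * phi (q ^ 2) * psi (q ^ 12) := by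
  have hadm := (admissible_quadratic (a := 2) (b := 1) (by norm_num) (by norm_num)).add
    (admissible_quadratic (a := 6) (b := 3) (by norm_num) (by norm_num))
  have h6 : phi (q ^ 6) = theta 24 0 q + q ^ 6 * theta 24 24 q := by
    rw [phi_eq_split (constantCoeff_pow_eq_zero hq (by norm_num)), theta_pow, theta_pow]
    norm_num
  have h2 : phi (q ^ 2) = theta 8 0 q + q ^ 2 * theta 8 8 q := by
    rw [phi_eq_split (constantCoeff_pow_eq_zero hq two_ne_zero), theta_pow, theta_pow]
    norm_num
  have hl : psi q * psi (q ^ 3)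
      = powSum q fun p : ℤ × ℤ => 2 * p.1 ^ 2 + 1 * p.1 + (6 * p.2 ^ 2 + 3 * p.2) := by
    rw [psi_pow, psi]
    exact theta_mul_theta hq (by norm_num) (by norm_num) (by norm_num) (by norm_num)
  have inj0 : Function.Injective fun p : ℤ × ℤ => (p.2 + 2 * p.1, p.2) := by
    rintro ⟨x, y⟩ ⟨x', y'⟩ h
    simp only [Prod.mk.injEq] at h ⊢
    omega
  have inj1 : Function.Injective fun p : ℤ × ℤ => (p.2 + 2 * p.1 + 1, p.2) := by
    rintro ⟨x, y⟩ ⟨x', y'⟩ h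
    simp only [Prod.mk.injEq] at h ⊢
    omega
  -- Each parametrisation is the isometry solved for (x, y); its signs are chosen so that all linear
  -- coefficients come out nonnegative and the shifts are 0, 6, 1 and 3.
  rw [hl, powSum_split hq hadm inj0 inj1, powSum_split (κ := ℤ × ℤ) hq (hadm.comp inj0)
    (f := fun p => (2 * p.2, p.1 - p.2)) (g := fun p => (2 * p.2 + 1, -1 - p.2 - p.1)),
    powSum_split (κ := ℤ × ℤ) hq (hadm.comp inj1)
    (f := fun p => (-1 - 2 * p.2, p.2 + p.1)) (g := fun p => (2 * p.2, p.1 - p.2)),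
    powSum_eq_theta_mul (a := 8) (b := 4) (c := 24) (d := 0) hq (by norm_num) (by norm_num)
      (by norm_num) (by norm_num) 0 (fun u v => by push_cast; ring),
    powSum_eq_theta_mul (a := 8) (b := 4) (c := 24) (d := 24) hq (by norm_num) (by norm_num)
      (by norm_num) (by norm_num) 6 (fun u v => by push_cast; ring),
    powSum_eq_theta_mul (a := 8) (b := 0) (c := 24) (d := 12) hq (by norm_num) (by norm_num)
      (by norm_num) (by norm_num) 1 (fun u v => by push_cast; ring),
    powSum_eq_theta_mul (a := 8) (b := 8) (c := 24) (d := 12) hq (by norm_num) (by norm_num)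
      (by norm_num) (by norm_num) 3 (fun u v => by push_cast; ring), h6, h2, psi_pow, psi_pow]
  · norm_num
    ring
  · rintro ⟨x, y⟩ ⟨x', y'⟩ h
    simp only [Prod.mk.injEq] at h ⊢
    omega
  · rintro ⟨x, y⟩ ⟨x', y'⟩ h
    simp only [Prod.mk.injEq] at h ⊢
    omega
  · rintro ⟨x, y⟩ ⟨x', y'⟩ h
    simp only [Prod.mk.injEq] at h
    omega
  · rintro ⟨x, y⟩
    rcases Int.even_or_odd' x with ⟨k, h | h⟩
    · exact .inr ⟨(y + k, k), by simp only [Prod.mk.injEq]; omega⟩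
    · exact .inl ⟨(y + k + 1, -1 - k), by simp only [Prod.mk.injEq]; omega⟩
  · rintro ⟨x, y⟩ ⟨x', y'⟩ h
    simp only [Prod.mk.injEq] at h ⊢
    omega
  · rintro ⟨x, y⟩ ⟨x', y'⟩ h
    simp only [Prod.mk.injEq] at h ⊢
    omega
  · rintro ⟨x, y⟩ ⟨x', y'⟩ h
    simp only [Prod.mk.injEq] at h
    omega
  · rintro ⟨x, y⟩
    rcases Int.even_or_odd' x with ⟨k, h | h⟩
    · exact .inl ⟨(y + k, k), by simp only [Prod.mk.injEq]; omega⟩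
    · exact .inr ⟨(-1 - k - y, k), by simp only [Prod.mk.injEq]; omega⟩
  · rintro ⟨x, y⟩ ⟨x', y'⟩ h
    simp only [Prod.mk.injEq] at h
    omega
  · rintro ⟨x, y⟩
    rcases Int.even_or_odd' (x - y) with ⟨k, h | h⟩
    · exact .inl ⟨(k, y), Prod.ext (by dsimp only; omega) rfl⟩
    · exact .inr ⟨(k, y), Prod.ext (by dsimp only; omega) rfl⟩

/-- The norm form `a² + a b + 2 b²` of the ring of integers of `ℚ(√-7)`. -/
def normForm (p : ℤ × ℤ) : ℤ := p.1 ^ 2 + p.1 * p.2 + 2 * p.2 ^ 2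

/-- Completing the square in either variable bounds both coordinates. -/
theorem admissible_normForm : Admissible normForm := by
  have h1 : ∀ p, 4 * normForm p = (2 * p.1 + p.2) ^ 2 + 7 * p.2 ^ 2 := fun p => by
    rw [normForm]; ring
  have h2 : ∀ p, 8 * normForm p = (4 * p.2 + p.1) ^ 2 + 7 * p.1 ^ 2 := fun p => by
    rw [normForm]; ring
  have hle : ∀ x : ℤ, |x| ≤ x ^ 2 := fun x => by
    rw [← sq_abs]
    rcases (abs_nonneg x).eq_or_lt with h | h
    · simp [← h]
    · nlinarith
  refine ⟨fun p => by nlinarith [h1 p, sq_nonneg (2 * p.1 + p.2), sq_nonneg p.2], fun N => ?_⟩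
  refine ((Set.finite_Icc (-(2 * N)) (2 * N)).prod (Set.finite_Icc (-(2 * N)) (2 * N))).subset
    fun p hp => ?_
  simp only [Set.mem_ofPred_eq] at hp
  have := h1 p
  have := h2 p
  have := hle p.1
  have := hle p.2
  exact ⟨abs_le.1 (by nlinarith [sq_nonneg (4 * p.2 + p.1)]),
    abs_le.1 (by nlinarith [sq_nonneg (2 * p.1 + p.2)])⟩

/-- Once the parity of the second coordinate is fixed, a shear diagonalises the form to u² + 7v², up
to linear terms. -/
theorem powSum_normForm (hq : constantCoeff q = 0) :
    powSum q normForm = phi q * phi (q ^ 7) + 4 * q ^ 2 * psi (q ^ 2) * psi (q ^ 14) := by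
  have h1 := theta_self_eq_psi hq 1 (by norm_num)
  have h7 := theta_self_eq_psi hq 7 (by norm_num)
  norm_num at h1 h7
  rw [powSum_split_snd hq admissible_normForm,
    powSum_shear (-1) fun p : ℤ × ℤ => normForm (p.1, 2 * p.2),
    powSum_shear (-1) fun p : ℤ × ℤ => normForm (p.1, 2 * p.2 + 1),
    powSum_eq_theta_mul (a := 1) (b := 0) (c := 7) (d := 0) hq (by norm_num) (by norm_num)
      (by norm_num) (by norm_num) 0 (fun u v => by rw [normForm]; push_cast; ring),
    powSum_eq_theta_mul (a := 1) (b := 1) (c := 7) (d := 7) hq (by norm_num) (by norm_num)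
      (by norm_num) (by norm_num) 2 (fun u v => by rw [normForm]; push_cast; ring), h1, h7, phi_pow,
    phi]
  norm_num
  ring

/-- Elements with even first coordinate are the multiples of a prime of norm 2, so they contribute
the same series at q². The remaining ones split into two cosets, each giving q ψ(q) ψ(q⁷). -/
theorem powSum_normForm_sub (hq : constantCoeff q = 0) :
    powSum q normForm = powSum (q ^ 2) normForm + 2 * q * psi q * psi (q ^ 7) := by
  have inj : Function.Injective fun p : ℤ × ℤ => (2 * p.1 + 1, p.2) := by
    rintro ⟨x, y⟩ ⟨x', y'⟩ h
    simp only [Prod.mk.injEq] at h ⊢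
    omega
  have he : (powSum q fun p : ℤ × ℤ => normForm (2 * p.1, p.2)) = powSum (q ^ 2) normForm := by
    rw [powSum_swap, powSum_pow]
    exact powSum_congr fun p => by simp only [normForm]; push_cast; ring
  rw [powSum_split_fst hq admissible_normForm, he,
    powSum_split (κ := ℤ × ℤ) hq (admissible_normForm.comp inj)
      (f := fun p => (2 * p.2, p.1 - p.2)) (g := fun p => (-2 * p.2 - 1, p.2 - p.1)),
    powSum_eq_theta_mul (a := 2) (b := 1) (c := 14) (d := 7) hq (by norm_num) (by norm_num)
      (by norm_num) (by norm_num) 1 (fun u v => by rw [normForm]; push_cast; ring),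
    powSum_eq_theta_mul (a := 2) (b := 1) (c := 14) (d := 7) hq (by norm_num) (by norm_num)
      (by norm_num) (by norm_num) 1 (fun u v => by rw [normForm]; push_cast; ring), psi_pow, psi]
  · norm_num
    ring
  · rintro ⟨x, y⟩ ⟨x', y'⟩ h
    simp only [Prod.mk.injEq] at h ⊢
    omega
  · rintro ⟨x, y⟩ ⟨x', y'⟩ h
    simp only [Prod.mk.injEq] at h ⊢
    omega
  · rintro ⟨x, y⟩ ⟨x', y'⟩ h
    simp only [Prod.mk.injEq] at h
    omega
  · rintro ⟨x, y⟩
    rcases Int.even_or_odd' x with ⟨k, h | h⟩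
    · exact .inl ⟨(y + k, k), by simp only [Prod.mk.injEq]; omega⟩
    · exact .inr ⟨(-1 - k - y, -1 - k), by simp only [Prod.mk.injEq]; omega⟩

/-- Eliminates the series of the norm form between its diagonal evaluations at q and at q². -/
theorem phi_mul_phi_seven (hq : constantCoeff q = 0) :
    phi q * phi (q ^ 7) + 4 * q ^ 2 * psi (q ^ 2) * psi (q ^ 14)
      = phi (q ^ 2) * phi (q ^ 14) + 4 * q ^ 4 * psi (q ^ 4) * psi (q ^ 28)
        + 2 * q * psi q * psi (q ^ 7) := by
  have h1 := powSum_normForm hq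
  have h2 := powSum_normForm (constantCoeff_pow_eq_zero hq two_ne_zero)
  simp only [← pow_mul] at h2
  norm_num at h2
  rw [← h1, ← h2, powSum_normForm_sub hq]

end Identities

/-- Lets `norm_num` see that numerals are nonzero power series, for cancelling factors such as 2, 4
or 16. -/
instance charZero_complexPowerSeries : CharZero ℂ⟦X⟧ :=
  charZero_of_injective_ringHom (PowerSeries.C_injective (R := ℂ))

/-! ### Cubic modular equations and the dissections of ψ(q)³/ψ(q³) and ψ(q³)³/ψ(q) -/

section CubicModularEquations

variable {q : ℂ⟦X⟧}

theorem phi_neg_split (hq : constantCoeff q = 0) :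
    phi (-q) = phi (q ^ 4) - 2 * q * psi (q ^ 8) := by
  rw [phi_split (constantCoeff_neg_eq_zero hq), Even.neg_pow (by decide), Even.neg_pow (by decide)]
  ring

theorem phi_neg_sq (hq : constantCoeff q = 0) :
    phi (-q) ^ 2 = phi (q ^ 2) ^ 2 - 4 * q * psi (q ^ 4) ^ 2 := by
  rw [phi_sq (constantCoeff_neg_eq_zero hq), Even.neg_pow (by decide), Even.neg_pow (by decide)]
  ring

theorem psi_neg_sq (hq : constantCoeff q = 0) : psi (-q) ^ 2 = phi (-q) * psi (q ^ 2) := by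
  rw [psi_sq (constantCoeff_neg_eq_zero hq), Even.neg_pow (by decide)]

theorem psi_neg_mul_psi_neg_cube (hq : constantCoeff q = 0) :
    psi (-q) * psi (-q ^ 3)
      = psi (q ^ 4) * phi (q ^ 6) - q * phi (q ^ 2) * psi (q ^ 12) := by
  have h := psi_mul_psi_cube (constantCoeff_neg_eq_zero hq)
  rw [Odd.neg_pow (by decide), Even.neg_pow (by decide), Even.neg_pow (by decide),
    Even.neg_pow (by decide), Even.neg_pow (by decide)] at h
  rw [h]
  ring

/-- Jacobi's quartic identity: φ(q)⁴ - φ(-q)⁴ is a difference of squares whose factors `phi_sq`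
evaluates. -/
theorem phi_pow_four (hq : constantCoeff q = 0) :
    phi q ^ 4 = phi (-q) ^ 4 + 16 * q * psi (q ^ 2) ^ 4 := by
  have h1 := phi_sq hq
  have h2 := phi_neg_sq hq
  have h3 := psi_sq (constantCoeff_pow_eq_zero hq two_ne_zero)
  rw [← pow_mul] at h3
  linear_combination (phi q ^ 2 + phi (q ^ 2) ^ 2 + 4 * q * psi (q ^ 4) ^ 2) * h1
    - (phi (-q) ^ 2 + phi (q ^ 2) ^ 2 - 4 * q * psi (q ^ 4) ^ 2) * h2
    - 16 * q * (psi (q ^ 2) ^ 2 + phi (q ^ 2) * psi (q ^ 4)) * h3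

/-- The modular equation of degree 3. The difference of the two φ-products is twice the odd part of
φ(q)φ(q³), which is 2q times the right side of `psi_mul_psi_cube` at q². -/
theorem phi_mul_phi_cube (hq : constantCoeff q = 0) :
    phi q * phi (q ^ 3)
      = phi (-q) * phi (-q ^ 3) + 4 * q * psi (q ^ 2) * psi (q ^ 6) := by
  have hq3 := constantCoeff_pow_eq_zero hq three_ne_zero
  have h := psi_mul_psi_cube (constantCoeff_pow_eq_zero hq two_ne_zero)
  rw [phi_split hq, phi_neg_split hq, phi_split hq3, phi_neg_split hq3]
  simp only [← pow_mul] at h ⊢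
  norm_num at h ⊢
  linear_combination -4 * q * h

theorem constantCoeff_phi_pow (hq : constantCoeff q = 0) {k : ℕ} (hk : k ≠ 0) :
    constantCoeff (phi (q ^ k)) = 1 := constantCoeff_phi (constantCoeff_pow_eq_zero hq hk)

theorem constantCoeff_psi_pow (hq : constantCoeff q = 0) {k : ℕ} (hk : k ≠ 0) :
    constantCoeff (psi (q ^ k)) = 1 := constantCoeff_psi (constantCoeff_pow_eq_zero hq hk)

theorem constantCoeff_phi_neg_pow (hq : constantCoeff q = 0) {k : ℕ} (hk : k ≠ 0) :
    constantCoeff (phi (-q ^ k)) = 1 :=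
  constantCoeff_phi (constantCoeff_neg_eq_zero (constantCoeff_pow_eq_zero hq hk))

theorem constantCoeff_psi_neg_pow (hq : constantCoeff q = 0) {k : ℕ} (hk : k ≠ 0) :
    constantCoeff (psi (-q ^ k)) = 1 :=
  constantCoeff_psi (constantCoeff_neg_eq_zero (constantCoeff_pow_eq_zero hq hk))

theorem ne_zero_of_constantCoeff {f : ℂ⟦X⟧} (hf : constantCoeff f = 1) : f ≠ 0 := by
  rintro rfl
  simp at hf

/-- Multiply Jacobi's quartic identity at q and at q³ and compare with the fourth power of
`phi_mul_phi_cube`. After dividing by 16q, both sides of the comparison complete to squares. -/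
theorem cubic_modular_sum (hq : constantCoeff q = 0) (hq0 : q ≠ 0) :
    q * phi (-q) ^ 2 * psi (q ^ 6) ^ 2 + psi (q ^ 2) ^ 2 * phi (-q ^ 3) ^ 2
      = phi q * phi (q ^ 3) * (psi (-q) * psi (-q ^ 3)) := by
  have hq3 := constantCoeff_pow_eq_zero hq three_ne_zero
  have hn := constantCoeff_neg_eq_zero hq
  have h1 := phi_pow_four hq
  have h2 := phi_pow_four hq3
  have h3 := phi_mul_phi_cube hq
  have h4 := psi_neg_sq hq
  have h5 := psi_neg_sq hq3
  simp only [← pow_mul] at h2 h5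
  norm_num at h2 h5
  refine eq_of_sq_eq_sq ?_ ?_ ?_
  · simp [hq, constantCoeff_psi_pow hq, constantCoeff_phi_neg_pow hq]
  · simp [constantCoeff_phi hq, constantCoeff_psi hn, constantCoeff_phi_pow hq,
      constantCoeff_psi_neg_pow hq]
  · have key : (phi (-q) ^ 4 + 16 * q * psi (q ^ 2) ^ 4)
        * (phi (-q ^ 3) ^ 4 + 16 * q ^ 3 * psi (q ^ 6) ^ 4)
        = (phi (-q) * phi (-q ^ 3) + 4 * q * psi (q ^ 2) * psi (q ^ 6)) ^ 4 := by
      rw [← h1, ← h2, ← h3]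
      ring
    have h16 : (16 : ℂ⟦X⟧) * q ≠ 0 := mul_ne_zero (by norm_num) hq0
    refine mul_left_cancel₀ h16 ?_
    rw [mul_pow, mul_pow (psi (-q)), h4, h5, h3]
    linear_combination key

theorem phi_mul_phi_sub_psi_mul_psi (hq : constantCoeff q = 0) :
    phi (q ^ 2) * phi (q ^ 6) - 4 * q ^ 2 * psi (q ^ 4) * psi (q ^ 12)
      = phi (-q ^ 2) * phi (-q ^ 6) := by
  have hq2 := constantCoeff_pow_eq_zero hq two_ne_zero
  have hq3 := constantCoeff_pow_eq_zero hq three_ne_zero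
  have hq6 := constantCoeff_pow_eq_zero hq (k := 6) (by norm_num)
  have a1 := phi_sq hq
  have a2 := phi_neg_sq hq
  have a3 := phi_sq hq3
  have a4 := phi_neg_sq hq3
  have h3 := phi_mul_phi_cube hq
  have b1 := psi_sq hq2
  have b2 := psi_sq hq6
  have c1 := phi_mul_phi_neg hq
  have c2 := phi_mul_phi_neg hq3
  simp only [← pow_mul] at a3 a4 b1 b2 c2
  norm_num at a3 a4 b1 b2 c2
  refine eq_of_sq_eq_sq ?_ ?_ ?_
  · simp [hq, constantCoeff_phi_pow hq]
  · simp [constantCoeff_phi_neg_pow hq]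
  · refine mul_left_cancel₀ (two_ne_zero (α := ℂ⟦X⟧)) ?_
    have e1 : 2 * (phi (q ^ 2) * phi (q ^ 6) - 4 * q ^ 2 * psi (q ^ 4) * psi (q ^ 12)) ^ 2
        = phi q ^ 2 * phi (q ^ 3) ^ 2 + phi (-q) ^ 2 * phi (-q ^ 3) ^ 2
          - 16 * q ^ 2 * psi (q ^ 2) ^ 2 * psi (q ^ 6) ^ 2 := by
      rw [a1, a2, a3, a4, b1, b2]
      ring
    rw [e1, mul_pow, ← c1, ← c2]
    linear_combination (phi q * phi (q ^ 3) - phi (-q) * phi (-q ^ 3)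
      + 4 * q * psi (q ^ 2) * psi (q ^ 6)) * h3

/-- With q² for q this evaluates the even part of φ(q)φ(-q³)ψ(q)ψ(q³) in closed form. -/
theorem cubic_multiplier_even (hq : constantCoeff q = 0) (hq0 : q ≠ 0) :
    phi q * psi (q ^ 2) * phi (-q ^ 3) ^ 2
        - 2 * q * (psi (-q) * psi (-q ^ 3)) * phi q * psi (q ^ 6)
      = phi (-q ^ 2) * phi (-q ^ 6) * phi (q ^ 3) * psi (q ^ 2) := by
  have hq3 := constantCoeff_pow_eq_zero hq three_ne_zero
  have h2 := phi_pow_four hq3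
  have h3 := phi_mul_phi_cube hq
  have h4 := psi_neg_sq hq
  have h5 := psi_neg_sq hq3
  have h6 := cubic_modular_sum hq hq0
  have c1 := phi_mul_phi_neg hq
  have c2 := phi_mul_phi_neg hq3
  simp only [← pow_mul] at h2 h5 c2
  norm_num at h2 h5 c2
  refine eq_of_sq_eq_sq ?_ ?_ ?_
  · simp [hq, constantCoeff_psi_pow hq, constantCoeff_phi_neg_pow hq, constantCoeff_phi hq]
  · simp [constantCoeff_phi_pow hq, constantCoeff_psi_pow hq, constantCoeff_phi_neg_pow hq]
  -- The extra factor φ(q³) completes a fourth power on the right, to which Jacobi's identity at q³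
  -- applies.
  · refine mul_left_cancel₀
      (ne_zero_of_constantCoeff (constantCoeff_phi_pow hq three_ne_zero)) ?_
    linear_combination
      4 * q ^ 2 * phi q ^ 2 * phi (q ^ 3) * psi (q ^ 6) ^ 2
          * (psi (-q ^ 3) ^ 2 * h4 + phi (-q) * psi (q ^ 2) * h5)
        + (phi q * psi (q ^ 2) ^ 2 * phi (-q ^ 3) ^ 4
          + 4 * q ^ 2 * phi q * phi (-q) * psi (q ^ 2) * phi (-q ^ 3) * psi (q ^ 6) ^ 3) * h3
        + 4 * q * phi q * psi (q ^ 2) * phi (-q ^ 3) ^ 2 * psi (q ^ 6) * h6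
        + phi (q ^ 3) ^ 3 * psi (q ^ 2) ^ 2 * (phi (-q ^ 6) ^ 2 * c1 + phi q * phi (-q) * c2)
        - phi q * phi (-q) * psi (q ^ 2) ^ 2 * phi (-q ^ 3) * h2

/-- With q² for q this evaluates the odd part of φ(q³)φ(-q)ψ(q)ψ(q³). Here the auxiliary factor is
φ(q), to which Jacobi's identity at q applies. -/
theorem cubic_multiplier_odd (hq : constantCoeff q = 0) (hq0 : q ≠ 0) :
    2 * (psi (-q) * psi (-q ^ 3)) * phi (q ^ 3) * psi (q ^ 2)
        - phi (q ^ 3) * psi (q ^ 6) * phi (-q) ^ 2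
      = phi (-q ^ 2) * phi (-q ^ 6) * phi q * psi (q ^ 6) := by
  have hq3 := constantCoeff_pow_eq_zero hq three_ne_zero
  have hn := constantCoeff_neg_eq_zero hq
  have h1 := phi_pow_four hq
  have h3 := phi_mul_phi_cube hq
  have h4 := psi_neg_sq hq
  have h5 := psi_neg_sq hq3
  have h6 := cubic_modular_sum hq hq0
  have c1 := phi_mul_phi_neg hq
  have c2 := phi_mul_phi_neg hq3
  simp only [← pow_mul] at h5 c2
  norm_num at h5 c2
  refine eq_of_sq_eq_sq ?_ ?_ ?_
  · simp [constantCoeff_psi_pow hq, constantCoeff_phi_pow hq, constantCoeff_phi hn,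
      constantCoeff_psi hn, constantCoeff_psi_neg_pow hq, map_ofNat]
    norm_num
  · simp [constantCoeff_phi hq, constantCoeff_psi_pow hq, constantCoeff_phi_neg_pow hq]
  · refine mul_left_cancel₀ (ne_zero_of_constantCoeff (constantCoeff_phi hq)) ?_
    linear_combination
      4 * phi q * phi (q ^ 3) ^ 2 * psi (q ^ 2) ^ 2
          * (psi (-q ^ 3) ^ 2 * h4 + phi (-q) * psi (q ^ 2) * h5)
        + (4 * phi (q ^ 3) * psi (q ^ 2) ^ 3 * phi (-q) * phi (-q ^ 3) * psi (q ^ 6)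
          + phi (q ^ 3) * psi (q ^ 6) ^ 2 * phi (-q) ^ 4) * h3
        + 4 * phi (q ^ 3) * psi (q ^ 2) * psi (q ^ 6) * phi (-q) ^ 2 * h6
        + phi q ^ 3 * psi (q ^ 6) ^ 2 * (phi (-q ^ 6) ^ 2 * c1 + phi q * phi (-q) * c2)
        - psi (q ^ 6) ^ 2 * phi (-q) * phi (q ^ 3) * phi (-q ^ 3) * h1

/-- The even part of `ψ(q)³ / ψ(q³)` is `ψ(q²)³ / ψ(q⁶)`. -/
theorem psi_cube_div_dissection (hq : constantCoeff q = 0) (hq0 : q ≠ 0) :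
    phi q ^ 2 * psi (q ^ 6) * (psi (q ^ 2) ^ 2 * phi (-q ^ 6) ^ 2)
      = psi q * psi (q ^ 2) * psi (q ^ 3) * (psi (q ^ 2) ^ 2 * phi (-q ^ 6) ^ 2
        + q * (phi (-q ^ 4) * phi (-q ^ 12) * phi (q ^ 2) * psi (q ^ 12)
          + 2 * (psi (-q ^ 2) * psi (-q ^ 6)) * phi (q ^ 6) * psi (q ^ 4))) := by
  have hq2 := constantCoeff_pow_eq_zero hq two_ne_zero
  have hq3 := constantCoeff_pow_eq_zero hq three_ne_zero
  have a1 := psi_sq hq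
  have a3 := psi_sq hq3
  have a2 := psi_sq hq2
  have c2 := phi_mul_phi_neg hq3
  have b := psi_mul_psi_cube hq
  have d1 := phi_split hq
  have d2 := phi_neg_split hq3
  have e := psi_neg_mul_psi_neg_cube hq2
  have f := phi_mul_phi_sub_psi_mul_psi hq2
  have g := cubic_multiplier_even hq2 (pow_ne_zero 2 hq0)
  simp only [← pow_mul] at a2 a3 c2 d2 e f g
  norm_num at a2 a3 c2 d2 e f g
  -- By `psi_sq` and `phi_mul_phi_neg` it is enough to split this product by parity. Its odd part is
  -- read off from the dissections of the factors; its even part collapses by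
  -- `cubic_multiplier_even`.
  have hN : phi q * phi (-q ^ 3) * (psi q * psi (q ^ 3)) = psi (q ^ 2) ^ 2 * phi (-q ^ 6) ^ 2
        + q * (phi (-q ^ 4) * phi (-q ^ 12) * phi (q ^ 2) * psi (q ^ 12)
          + 2 * (psi (-q ^ 2) * psi (-q ^ 6)) * phi (q ^ 6) * psi (q ^ 4)) := by
    rw [a2, b, d1, d2]
    rw [e] at g ⊢
    rw [← f] at g ⊢
    linear_combination -g
  rw [← hN]
  linear_combination (-phi q ^ 2 * psi (q ^ 6) * psi (q ^ 2) ^ 2) * c2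
    - psi (q ^ 2) * phi q * phi (-q ^ 3) * (psi (q ^ 3) ^ 2 * a1 + phi q * psi (q ^ 2) * a3)

/-- The odd part of `ψ(q³)³ / ψ(q)` is `-q ψ(q⁶)³ / ψ(q²)`. -/
theorem psi_cube_pow_div_dissection (hq : constantCoeff q = 0) (hq0 : q ≠ 0) :
    phi (q ^ 3) ^ 2 * psi (q ^ 2) * (psi (q ^ 6) ^ 2 * phi (-q ^ 2) ^ 2)
      = psi q * psi (q ^ 3) * psi (q ^ 6) * (phi (-q ^ 4) * phi (-q ^ 12) * phi (q ^ 6)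
        * psi (q ^ 4)
        - 2 * q ^ 2 * (psi (-q ^ 2) * psi (-q ^ 6)) * phi (q ^ 2) * psi (q ^ 12)
        - q * (psi (q ^ 6) ^ 2 * phi (-q ^ 2) ^ 2)) := by
  have hq2 := constantCoeff_pow_eq_zero hq two_ne_zero
  have hq3 := constantCoeff_pow_eq_zero hq three_ne_zero
  have hq6 := constantCoeff_pow_eq_zero hq (k := 6) (by norm_num)
  have a1 := psi_sq hq
  have a3 := psi_sq hq3
  have a6 := psi_sq hq6
  have c1 := phi_mul_phi_neg hq
  have b := psi_mul_psi_cube hq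
  have d1 := phi_neg_split hq
  have d2 := phi_split hq3
  have e := psi_neg_mul_psi_neg_cube hq2
  have f := phi_mul_phi_sub_psi_mul_psi hq2
  have g := cubic_multiplier_odd hq2 (pow_ne_zero 2 hq0)
  simp only [← pow_mul] at a6 a3 d2 e f g
  norm_num at a6 a3 d2 e f g
  -- The same scheme with the roles of q and q³ exchanged in the φ-factors; now the odd part
  -- collapses.
  have hN : phi (q ^ 3) * phi (-q) * (psi q * psi (q ^ 3))
      = phi (-q ^ 4) * phi (-q ^ 12) * phi (q ^ 6) * psi (q ^ 4)
        - 2 * q ^ 2 * (psi (-q ^ 2) * psi (-q ^ 6)) * phi (q ^ 2) * psi (q ^ 12)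
        - q * (psi (q ^ 6) ^ 2 * phi (-q ^ 2) ^ 2) := by
    rw [a6, b, d1, d2]
    rw [e] at g ⊢
    rw [← f] at g ⊢
    linear_combination -q * g
  rw [← hN]
  linear_combination (-phi (q ^ 3) ^ 2 * psi (q ^ 2) * psi (q ^ 6) ^ 2) * c1
    - psi (q ^ 6) * phi (q ^ 3) * phi (-q) * (psi (q ^ 3) ^ 2 * a1 + phi q * psi (q ^ 2) * a3)

end CubicModularEquations

/-! ### The Göllnitz–Gordon recurrence and the theta quotient for S/T -/

section Casoratian

variable {q : ℂ⟦X⟧}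

theorem eq_zero_of_X_pow_dvd {f : ℂ⟦X⟧} (h : ∀ N, X ^ N ∣ f) : f = 0 := by
  ext m
  rw [X_pow_dvd_iff.1 (h (m + 1)) m (Nat.lt_succ_self m), map_zero]

/-- Two solutions of the Göllnitz–Gordon recurrence are proportional. -/
theorem casoratian_eq_zero (hq : constantCoeff q = 0) {F G : ℕ → ℂ⟦X⟧}
    (hF : ∀ k, F k = (1 + q ^ (2 * k + 1)) * F (k + 1) + q ^ (2 * k + 2) * F (k + 2))
    (hG : ∀ k, G k = (1 + q ^ (2 * k + 1)) * G (k + 1) + q ^ (2 * k + 2) * G (k + 2)) :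
    F 0 * G 1 = F 1 * G 0 := by
  -- The Casoratian at k is -q^(2k+2) times the one at k + 1, so iteration makes it divisible by
  -- every power of X.
  have hW : ∀ k, F k * G (k + 1) - F (k + 1) * G k
      = -q ^ (2 * k + 2) * (F (k + 1) * G (k + 2) - F (k + 2) * G (k + 1)) := by
    intro k
    linear_combination G (k + 1) * hF k - F (k + 1) * hG k
  have hdvd : ∀ N k, X ^ N ∣ F k * G (k + 1) - F (k + 1) * G k := by
    intro N
    induction N with
    | zero => simp
    | succ N ih =>
      intro k
      rw [hW k, pow_succ']
      refine mul_dvd_mul ?_ (ih (k + 1))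
      rw [dvd_neg]
      exact dvd_pow (X_dvd_iff.2 hq) (by omega)
  exact sub_eq_zero.1 (eq_zero_of_X_pow_dvd fun N => hdvd N 0)

theorem X_pow_dvd_of_le (hq : constantCoeff q = 0) {n m : ℕ} (h : n ≤ m) : X ^ n ∣ q ^ m :=
  (pow_dvd_pow X h).trans (pow_dvd_pow_of_dvd (X_dvd_iff.2 hq) m)

open PowerSeries.WithPiTopology in
theorem hasSum_telescope {g : ℕ → ℂ⟦X⟧} (hg : ∀ n, X ^ n ∣ g n) :
    HasSum (fun n => g (n + 1) - g n) (-g 0) := by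
  have h := hasSum_seriesSum hg
  have h1 := (hasSum_nat_add_iff' 1).2 h
  simpa using h1.sub h

theorem inv_eq_mul_inv {f g a : ℂ⟦X⟧} (hf : constantCoeff f ≠ 0) (hg : constantCoeff g ≠ 0)
    (h : g = f * a) : f⁻¹ = a * g⁻¹ := by
  have h1 := PowerSeries.inv_mul_cancel f hf
  have h2 := PowerSeries.mul_inv_cancel g hg
  calc f⁻¹ = f⁻¹ * (g * g⁻¹) := by rw [h2, mul_one]
    _ = f⁻¹ * f * (a * g⁻¹) := by rw [h]; ring
    _ = a * g⁻¹ := by rw [h1, one_mul]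

/-- The summand of the `k`-th shift of the series `S`. -/
noncomputable def shiftTerm (q : ℂ⟦X⟧) (k n : ℕ) : ℂ⟦X⟧ :=
  qPoch (-q) (q ^ 2) n * q ^ (n ^ 2 + 2 * k * n) * (qPoch (q ^ 2) (q ^ 2) n)⁻¹

theorem X_pow_dvd_shiftTerm (hq : constantCoeff q = 0) (k n : ℕ) : X ^ n ∣ shiftTerm q k n := by
  have h : n ≤ n ^ 2 + 2 * k * n := (Nat.le_self_pow two_ne_zero n).trans (Nat.le_add_right _ _)
  exact Dvd.dvd.mul_right (Dvd.dvd.mul_left (X_pow_dvd_of_le hq h) _) _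

-- The difference of the two sides telescopes termwise, with -(1 - q^(2n)) times the summand as
-- certificate; this vanishes at n = 0. The values k = 0 and k = 1 are S and T.
open PowerSeries.WithPiTopology in
theorem seriesSum_shiftTerm (hq : constantCoeff q = 0) (k : ℕ) :
    seriesSum (shiftTerm q k) = (1 + q ^ (2 * k + 1)) * seriesSum (shiftTerm q (k + 1))
      + q ^ (2 * k + 2) * seriesSum (shiftTerm q (k + 2)) := by
  have h0 := hasSum_seriesSum (X_pow_dvd_shiftTerm hq k)
  have h1 := hasSum_seriesSum (X_pow_dvd_shiftTerm hq (k + 1))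
  have h2 := hasSum_seriesSum (X_pow_dvd_shiftTerm hq (k + 2))
  have ht := hasSum_telescope (g := fun n => -((1 - q ^ (2 * n)) * shiftTerm q k n))
    fun n => (dvd_neg).2 ((X_pow_dvd_shiftTerm hq k n).mul_left _)
  have h3 := (h0.sub ((h1.mul_left (1 + q ^ (2 * k + 1))).add
    (h2.mul_left (q ^ (2 * k + 2)))))
  have he : ∀ n, -((1 - q ^ (2 * (n + 1))) * shiftTerm q k (n + 1))
      - -((1 - q ^ (2 * n)) * shiftTerm q k n)
      = shiftTerm q k n - ((1 + q ^ (2 * k + 1)) * shiftTerm q (k + 1) n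
        + q ^ (2 * k + 2) * shiftTerm q (k + 2) n) := by
    intro n
    have hc : ∀ n, constantCoeff (qPoch (q ^ 2) (q ^ 2) n) ≠ 0 := fun n => by
      rw [constantCoeff_qPoch (constantCoeff_pow_eq_zero hq two_ne_zero)]
      exact one_ne_zero
    have hi := inv_eq_mul_inv (hc n) (hc (n + 1)) (Finset.prod_range_succ _ _)
    have hp : qPoch (-q) (q ^ 2) (n + 1) = qPoch (-q) (q ^ 2) n * (1 - -q * (q ^ 2) ^ n) :=
      Finset.prod_range_succ _ _
    simp only [shiftTerm]
    rw [hi, hp]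
    ring
  simp only [he] at ht
  have h := h3.unique ht
  simp only [mul_zero, pow_zero, sub_self, zero_mul, neg_zero] at h
  exact sub_eq_zero.1 h

/-- The numerator product `∏_{j < k} (1 - q ^ (2 n + 2 + 2 j))`. -/
noncomputable def evenProd (q : ℂ⟦X⟧) (n k : ℕ) : ℂ⟦X⟧ :=
  ∏ j ∈ Finset.range k, (1 - q ^ (2 * n + 2 + 2 * j))

/-- The denominator product `∏_{j < k} (1 + q ^ (2 n + 1 + 2 j))`. -/
noncomputable def oddProd (q : ℂ⟦X⟧) (n k : ℕ) : ℂ⟦X⟧ :=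
  ∏ j ∈ Finset.range k, (1 + q ^ (2 * n + 1 + 2 * j))

theorem evenProd_succ (q : ℂ⟦X⟧) (n k : ℕ) :
    evenProd q n (k + 1) = evenProd q n k * (1 - q ^ (2 * n + 2 + 2 * k)) :=
  Finset.prod_range_succ _ _

theorem evenProd_succ' (q : ℂ⟦X⟧) (n k : ℕ) :
    evenProd q n (k + 1) = evenProd q (n + 1) k * (1 - q ^ (2 * n + 2)) := by
  rw [evenProd, Finset.prod_range_succ', evenProd]
  congr 1
  exact Finset.prod_congr rfl fun j _ => by ring

theorem oddProd_succ (q : ℂ⟦X⟧) (n k : ℕ) :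
    oddProd q n (k + 1) = oddProd q n k * (1 + q ^ (2 * n + 1 + 2 * k)) :=
  Finset.prod_range_succ _ _

theorem oddProd_succ' (q : ℂ⟦X⟧) (n k : ℕ) :
    oddProd q n (k + 1) = oddProd q (n + 1) k * (1 + q ^ (2 * n + 1)) := by
  rw [oddProd, Finset.prod_range_succ', oddProd]
  congr 1
  exact Finset.prod_congr rfl fun j _ => by ring

theorem constantCoeff_oddProd (hq : constantCoeff q = 0) (n k : ℕ) :
    constantCoeff (oddProd q n k) ≠ 0 := by
  rw [oddProd, map_prod, Finset.prod_eq_one]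
  · exact one_ne_zero
  · intro j _
    rw [map_add, map_one, map_pow, hq, zero_pow (by omega), add_zero]

theorem inv_oddProd (hq : constantCoeff q = 0) (n k : ℕ) :
    (oddProd q n k)⁻¹ = (1 + q ^ (2 * n + 1 + 2 * k)) * (oddProd q n (k + 1))⁻¹ :=
  inv_eq_mul_inv (constantCoeff_oddProd hq n k) (constantCoeff_oddProd hq n (k + 1))
    (oddProd_succ q n k)

theorem inv_oddProd' (hq : constantCoeff q = 0) (n k : ℕ) :
    (oddProd q (n + 1) k)⁻¹ = (1 + q ^ (2 * n + 1)) * (oddProd q n (k + 1))⁻¹ :=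
  inv_eq_mul_inv (constantCoeff_oddProd hq (n + 1) k) (constantCoeff_oddProd hq n (k + 1))
    (oddProd_succ' q n k)

/-- The summand of Selberg's solution of the Göllnitz–Gordon recurrence, at index `k + 1`. -/
noncomputable def selbergTerm (q : ℂ⟦X⟧) (k n : ℕ) : ℂ⟦X⟧ :=
  (-1) ^ n * q ^ (4 * n ^ 2 + 3 * n + 4 * n * k) * (1 - q ^ (4 * n + 2 * k + 2)) * evenProd q n k
    * (oddProd q n (k + 1))⁻¹

/-- The certificate for the recurrence of `selbergTerm`. -/
noncomputable def selbergCert (q : ℂ⟦X⟧) (k n : ℕ) : ℂ⟦X⟧ :=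
  (-1) ^ n * q ^ (4 * n ^ 2 + 3 * n + 4 * n * k) * evenProd q n k * (oddProd q n (k + 2))⁻¹
    * (1 - q ^ (2 * n))
    * (-1 - (1 + q ^ (2 * k + 3)) * q ^ (2 * n) + q ^ (2 * k + 2) * q ^ (4 * n))

theorem le_selberg_exponent (k n : ℕ) : n ≤ 4 * n ^ 2 + 3 * n + 4 * n * k := by
  have := Nat.zero_le (4 * n * k)
  have := Nat.zero_le (4 * n ^ 2)
  omega

theorem X_pow_dvd_selbergTerm (hq : constantCoeff q = 0) (k n : ℕ) :
    X ^ n ∣ selbergTerm q k n :=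
  (((Dvd.dvd.mul_left (X_pow_dvd_of_le hq (le_selberg_exponent k n)) _).mul_right _).mul_right
    _).mul_right _

theorem X_pow_dvd_selbergCert (hq : constantCoeff q = 0) (k n : ℕ) :
    X ^ n ∣ selbergCert q k n :=
  ((((Dvd.dvd.mul_left (X_pow_dvd_of_le hq (le_selberg_exponent k n)) _).mul_right _).mul_right
    _).mul_right _).mul_right _

/-- Over the common denominator `oddProd q n (k + 3)` this is a polynomial identity. The factor 1 -
q^(2n+2) of the shifted certificate is what moves `evenProd` from n + 1 back to n. -/
theorem selbergCert_sub (hq : constantCoeff q = 0) (k n : ℕ) :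
    selbergCert q k (n + 1) - selbergCert q k n
      = selbergTerm q k n - ((1 + q ^ (2 * k + 3)) * selbergTerm q (k + 1) n
        + q ^ (2 * k + 4) * selbergTerm q (k + 2) n) := by
  have h1 := inv_oddProd hq n (k + 1)
  have h2 := inv_oddProd hq n (k + 2)
  have h3 := inv_oddProd' hq n (k + 2)
  have e1 := evenProd_succ q n k
  have e2 := evenProd_succ q n (k + 1)
  have e3 := evenProd_succ' q n k
  have e4 : selbergCert q k (n + 1) = -((-1) ^ n * q ^ (4 * (n + 1) ^ 2 + 3 * (n + 1)
      + 4 * (n + 1) * k)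
    * (evenProd q n k * (1 - q ^ (2 * n + 2 + 2 * k))) *
      ((1 + q ^ (2 * n + 1)) * (oddProd q n (k + 3))⁻¹)
    * (-1 - (1 + q ^ (2 * k + 3)) * q ^ (2 * n + 2) + q ^ (2 * k + 2) * q ^ (4 * n + 4))) := by
    rw [← h3, ← e1, e3, selbergCert]
    ring
  rw [e4]
  simp only [selbergCert, selbergTerm]
  rw [e2, e1, h1, h2]
  ring

open PowerSeries.WithPiTopology in
theorem seriesSum_selbergTerm (hq : constantCoeff q = 0) (k : ℕ) :
    seriesSum (selbergTerm q k) = (1 + q ^ (2 * k + 3)) * seriesSum (selbergTerm q (k + 1))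
      + q ^ (2 * k + 4) * seriesSum (selbergTerm q (k + 2)) := by
  have h0 := hasSum_seriesSum (X_pow_dvd_selbergTerm hq k)
  have h1 := hasSum_seriesSum (X_pow_dvd_selbergTerm hq (k + 1))
  have h2 := hasSum_seriesSum (X_pow_dvd_selbergTerm hq (k + 2))
  have ht := hasSum_telescope (X_pow_dvd_selbergCert hq k)
  have h3 := (h0.sub ((h1.mul_left (1 + q ^ (2 * k + 3))).add
    (h2.mul_left (q ^ (2 * k + 4)))))
  simp only [selbergCert_sub hq k] at ht
  have h := h3.unique ht
  have hz : selbergCert q k 0 = 0 := by simp [selbergCert]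
  rw [hz, neg_zero] at h
  exact sub_eq_zero.1 h

-- Pairs the indices n and -n; the index 0 is then counted twice, hence the added 1.
open PowerSeries.WithPiTopology in
theorem hasSum_theta_four_one (hq : constantCoeff q = 0) :
    HasSum (fun n : ℕ => (-1) ^ n * q ^ (4 * n ^ 2 - n) * (1 + q ^ (2 * n)))
      (theta 4 1 (-q) + 1) := by
  have hn := constantCoeff_neg_eq_zero hq
  have h := (hasSum_powSum hn
    (admissible_quadratic (a := 4) (b := 1) (by norm_num) (by norm_num))).nat_add_neg
  have he : ∀ n : ℕ, (-q) ^ (4 * (n : ℤ) ^ 2 + 1 * n).toNat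
      + (-q) ^ (4 * (-n : ℤ) ^ 2 + 1 * -n).toNat
      = (-1) ^ n * q ^ (4 * n ^ 2 - n) * (1 + q ^ (2 * n)) := by
    intro n
    have hle : n ≤ 4 * n ^ 2 := (Nat.le_self_pow two_ne_zero n).trans (by omega)
    obtain ⟨m, hm⟩ := Nat.exists_eq_add_of_le hle
    have e1 : (4 * (n : ℤ) ^ 2 + 1 * n).toNat = m + 2 * n := by
      zify at hm
      rw [hm]
      omega
    have e2 : (4 * (-n : ℤ) ^ 2 + 1 * -n).toNat = m := by
      zify at hm
      rw [neg_sq, hm]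
      omega
    have e3 : (-1 : ℂ⟦X⟧) ^ m = (-1) ^ n := by
      refine neg_one_pow_congr ?_
      have : Even (n + m) := hm ▸ ⟨2 * n ^ 2, by ring⟩
      rw [Nat.even_add] at this
      exact this.symm
    rw [e1, e2, show 4 * n ^ 2 - n = m by omega, neg_pow q, neg_pow q m, pow_add, pow_mul,
      neg_one_sq,
      one_pow, e3]
    ring
  simp only [he] at h
  simpa [theta] using h

-- Pairs the indices n and -(n + 1), which have exponents of opposite parity.
open PowerSeries.WithPiTopology in
theorem hasSum_theta_four_three (hq : constantCoeff q = 0) :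
    HasSum (fun n : ℕ => (-1) ^ n * q ^ (4 * n ^ 2 + 3 * n) * (1 - q ^ (2 * n + 1)))
      (theta 4 3 (-q)) := by
  have hn := constantCoeff_neg_eq_zero hq
  have h := (hasSum_powSum hn
    (admissible_quadratic (a := 4) (b := 3) (by norm_num) (by norm_num))).nat_add_neg_add_one
  have he : ∀ n : ℕ, (-q) ^ (4 * (n : ℤ) ^ 2 + 3 * n).toNat
      + (-q) ^ (4 * (-(n + 1) : ℤ) ^ 2 + 3 * -(n + 1)).toNat
      = (-1) ^ n * q ^ (4 * n ^ 2 + 3 * n) * (1 - q ^ (2 * n + 1)) := by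
    intro n
    have e1 : (4 * (n : ℤ) ^ 2 + 3 * n).toNat = 4 * n ^ 2 + 3 * n := by
      rw [show 4 * (n : ℤ) ^ 2 + 3 * n = ((4 * n ^ 2 + 3 * n : ℕ) : ℤ) by push_cast; ring,
        Int.toNat_natCast]
    have e2 : (4 * (-(n + 1) : ℤ) ^ 2 + 3 * -(n + 1)).toNat
        = (4 * n ^ 2 + 3 * n) + (2 * n + 1) := by
      rw [show 4 * (-(n + 1) : ℤ) ^ 2 + 3 * -(n + 1)
        = (((4 * n ^ 2 + 3 * n) + (2 * n + 1) : ℕ) : ℤ) by push_cast; ring, Int.toNat_natCast]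
    have e3 : (-1 : ℂ⟦X⟧) ^ (4 * n ^ 2 + 3 * n) = (-1) ^ n := by
      rw [show 4 * n ^ 2 + 3 * n = 2 * (2 * n ^ 2 + n) + n by ring, pow_add, pow_mul, neg_one_sq,
        one_pow, one_mul]
    rw [e1, e2, pow_add (-q) (4 * n ^ 2 + 3 * n), neg_pow q (4 * n ^ 2 + 3 * n),
      neg_pow q (2 * n + 1), e3, pow_succ (-1), pow_mul (-1), neg_one_sq,
      one_pow]
    ring
  simp only [he] at h
  exact h

-- At k = 0 the denominator 1 + q^(2n+1) divides 1 - q^(4n+2), leaving the paired theta series.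
open PowerSeries.WithPiTopology in
theorem seriesSum_selbergTerm_zero (hq : constantCoeff q = 0) :
    seriesSum (selbergTerm q 0) = theta 4 3 (-q) := by
  refine (hasSum_seriesSum (X_pow_dvd_selbergTerm hq 0)).unique ?_
  have he : selbergTerm q 0
      = fun n : ℕ => (-1) ^ n * q ^ (4 * n ^ 2 + 3 * n) * (1 - q ^ (2 * n + 1)) := by
    funext n
    have h := PowerSeries.mul_inv_cancel _ (constantCoeff_oddProd hq n 1)
    have h1 : oddProd q n 1 = 1 + q ^ (2 * n + 1) := by simp [oddProd]
    have h2 : (1 - q ^ (4 * n + 2 * 0 + 2)) = (1 - q ^ (2 * n + 1)) * oddProd q n 1 := by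
      rw [h1]
      ring
    rw [selbergTerm, h2, evenProd, Finset.prod_range_zero]
    linear_combination (-1) ^ n * q ^ (4 * n ^ 2 + 3 * n) * (1 - q ^ (2 * n + 1)) * h
  rw [he]
  exact hasSum_theta_four_three hq

/-- The certificate for the initial case of the recurrence. -/
noncomputable def thetaCert (q : ℂ⟦X⟧) (n : ℕ) : ℂ⟦X⟧ :=
  (-1) ^ n * q ^ (4 * n ^ 2 - n) * (oddProd q n 1)⁻¹
    * (-1 - (1 + q) * q ^ (2 * n) + q ^ (4 * n))

-- The initial step of the recurrence, where the zeroth term is a theta series instead of a Selberg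
-- series. The boundary value -1 of the certificate cancels the double count at n = 0.
open PowerSeries.WithPiTopology in
theorem theta_four_one_recurrence (hq : constantCoeff q = 0) :
    theta 4 1 (-q) = (1 + q) * seriesSum (selbergTerm q 0)
      + q ^ 2 * seriesSum (selbergTerm q 1) := by
  have h0 := hasSum_theta_four_one hq
  have h1 := hasSum_seriesSum (X_pow_dvd_selbergTerm hq 0)
  have h2 := hasSum_seriesSum (X_pow_dvd_selbergTerm hq 1)
  have hle : ∀ n : ℕ, n ≤ 4 * n ^ 2 - n := fun n => by
    have := Nat.le_self_pow two_ne_zero n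
    omega
  have ht := hasSum_telescope (g := thetaCert q) fun n =>
    ((Dvd.dvd.mul_left (X_pow_dvd_of_le hq (hle n)) _).mul_right _).mul_right _
  have h3 := h0.sub ((h1.mul_left (1 + q)).add (h2.mul_left (q ^ 2)))
  have he : ∀ n, thetaCert q (n + 1) - thetaCert q n
      = (-1) ^ n * q ^ (4 * n ^ 2 - n) * (1 + q ^ (2 * n))
        - ((1 + q) * selbergTerm q 0 n + q ^ 2 * selbergTerm q 1 n) := by
    intro n
    obtain ⟨m, hm⟩ := Nat.exists_eq_add_of_le ((hle n).trans (Nat.sub_le _ _))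
    have hm1 : 4 * n ^ 2 - n = m := by omega
    have hm2 : 4 * (n + 1) ^ 2 - (n + 1) = m + (8 * n + 3) := by
      have : 4 * (n + 1) ^ 2 = 4 * n ^ 2 + 8 * n + 4 := by ring
      omega
    have i1 := inv_oddProd hq n 1
    have i2 := inv_oddProd' hq n 1
    have o1 : oddProd q n 2 = (1 + q ^ (2 * n + 1)) * (1 + q ^ (2 * n + 3)) := by
      simp [oddProd, Finset.prod_range_succ]
    have p1 : evenProd q n 1 = 1 - q ^ (2 * n + 2) := by simp [evenProd]
    have p0 : evenProd q n 0 = 1 := by simp [evenProd]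
    have i3 : (1 + q ^ (2 * n + 1)) * (1 + q ^ (2 * n + 3)) * (oddProd q n 2)⁻¹ = 1 := by
      rw [← o1]
      exact PowerSeries.mul_inv_cancel _ (constantCoeff_oddProd hq n 2)
    simp only [thetaCert, selbergTerm, hm1, hm2]
    norm_num at i1 i2 ⊢
    rw [i1, i2, p1, p0, hm]
    linear_combination (-1) ^ n * q ^ m * (1 + q ^ (2 * n)) * i3
  simp only [he] at ht
  have h := h3.unique ht
  have hz : thetaCert q 0 = -1 := by
    have i := PowerSeries.mul_inv_cancel _ (constantCoeff_oddProd hq 0 1)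
    have o : oddProd q 0 1 = 1 + q := by simp [oddProd]
    rw [o] at i
    simp only [thetaCert, o]
    norm_num
    linear_combination -i
  rw [hz] at h
  linear_combination h

/-- A form of the Göllnitz–Gordon identities: the quotient of `S` and `T` as one of theta series. -/
theorem S_mul_theta (hq : constantCoeff q = 0) :
    S q * theta 4 3 (-q) = T q * theta 4 1 (-q) := by
  have h := casoratian_eq_zero hq (F := fun k => seriesSum (shiftTerm q k))
    -- Selberg's series are indexed from 1, so the theta series is put in front as the term of index
    -- 0.
    (G := fun k => Nat.casesOn k (theta 4 1 (-q)) fun k => seriesSum (selbergTerm q k))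
    (seriesSum_shiftTerm hq) ?_
  · have hS : seriesSum (shiftTerm q 0) = S q := by
      rw [S]
      congr 1
      funext n
      simp [shiftTerm, termS]
    have hT : seriesSum (shiftTerm q 1) = T q := by
      rw [T]
      congr 1
      funext n
      rw [shiftTerm, termT, show n ^ 2 + 2 * 1 * n = n * (n + 2) by ring]
    simp only [hS, hT] at h
    rw [← seriesSum_selbergTerm_zero hq]
    exact h
  · rintro (_ | k)
    · simpa using theta_four_one_recurrence hq
    · exact seriesSum_selbergTerm hq k

end Casoratian

/-! ### Dissections -/

/-- The power series in `X ^ m`. -/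
def multiplesSubring (m : ℕ) : Subring ℂ⟦X⟧ where
  carrier := {f | ∀ n, ¬ m ∣ n → coeff n f = 0}
  mul_mem' := by
    intro f g hf hg n hn
    rw [coeff_mul]
    refine Finset.sum_eq_zero fun p hp => ?_
    rw [Finset.HasAntidiagonal.mem_antidiagonal] at hp
    by_cases h1 : m ∣ p.1
    · rw [hg p.2 fun h2 => hn (hp ▸ dvd_add h1 h2), mul_zero]
    · rw [hf p.1 h1, zero_mul]
  one_mem' := by
    intro n hn
    rw [coeff_one, if_neg]
    rintro rfl
    exact hn (dvd_zero m)
  add_mem' := by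
    intro f g hf hg n hn
    rw [map_add, hf n hn, hg n hn, add_zero]
  zero_mem' := fun n _ => map_zero _
  neg_mem' := by
    intro f hf n hn
    rw [map_neg, hf n hn, neg_zero]

theorem X_pow_mem {m k : ℕ} (h : m ∣ k) : (X : ℂ⟦X⟧) ^ k ∈ multiplesSubring m := by
  intro n hn
  rw [coeff_X_pow, if_neg]
  rintro rfl
  exact hn h

theorem inv_mem_multiplesSubring {m : ℕ} {f : ℂ⟦X⟧} (hf : f ∈ multiplesSubring m) :
    f⁻¹ ∈ multiplesSubring m := by
  intro n
  induction n using Nat.strong_induction_on with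
  | _ n ih =>
    intro hn
    rw [coeff_inv, if_neg (by rintro rfl; exact hn (dvd_zero m)), Finset.sum_eq_zero, mul_zero]
    intro p hp
    rw [Finset.HasAntidiagonal.mem_antidiagonal] at hp
    split_ifs with h
    · by_cases h1 : m ∣ p.1
      · rw [ih p.2 h fun h2 => hn (hp ▸ dvd_add h1 h2), mul_zero]
      · rw [hf p.1 h1, zero_mul]
    · rfl

theorem theta_mem_multiplesSubring {m : ℕ} {q : ℂ⟦X⟧} (hq : constantCoeff q = 0)
    (hm : q ∈ multiplesSubring m) {a b : ℤ} (ha : 1 ≤ a) (hb : |b| ≤ a) :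
    theta a b q ∈ multiplesSubring m := by
  intro n hn
  have h := hasSum_coeff_powSum hq (admissible_quadratic ha hb) n
  have hz : (fun i : ℤ => coeff n (q ^ (a * i ^ 2 + b * i).toNat)) = fun _ => 0 :=
    funext fun i => pow_mem hm _ n hn
  rw [hz] at h
  exact h.unique hasSum_zero

/-- All coefficients of `f` at indices congruent to `r` modulo `m` vanish. -/
def Vanish (m r : ℕ) (f : ℂ⟦X⟧) : Prop := ∀ n, n ≡ r [MOD m] → coeff n f = 0

section Vanish

variable {m r d k : ℕ} {f g c : ℂ⟦X⟧}

theorem Vanish.add (hf : Vanish m r f) (hg : Vanish m r g) : Vanish m r (f + g) := by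
  intro n hn
  rw [map_add, hf n hn, hg n hn, add_zero]

/-- The modulus d may be a proper divisor of m: often parity alone excludes the class. -/
theorem vanish_X_pow_mul (hc : c ∈ multiplesSubring d) (hd : d ∣ m) (hk : ¬ r ≡ k [MOD d]) :
    Vanish m r (X ^ k * c) := by
  intro n hn
  rw [coeff_X_pow_mul']
  split_ifs with h
  · refine hc _ fun h2 => hk ?_
    exact (hn.of_dvd hd).symm.trans ((Nat.modEq_iff_dvd' h).2 h2).symm
  · rfl

theorem vanish_of_mem (hc : c ∈ multiplesSubring d) (hd : d ∣ m) (hk : ¬ d ∣ r) :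
    Vanish m r c := by
  have h := vanish_X_pow_mul (k := 0) hc hd fun h => hk ((Nat.modEq_zero_iff_dvd).1 h)
  rwa [pow_zero, one_mul] at h

theorem Vanish.mul (hf : Vanish m r f) (hc : c ∈ multiplesSubring m) : Vanish m r (c * f) := by
  intro n hn
  rw [coeff_mul]
  refine Finset.sum_eq_zero fun p hp => ?_
  rw [Finset.HasAntidiagonal.mem_antidiagonal] at hp
  by_cases h1 : m ∣ p.1
  · rw [hf p.2, mul_zero]
    have h2 : p.1 + p.2 ≡ 0 + p.2 [MOD m] :=
      Nat.ModEq.add_right _ ((Nat.modEq_zero_iff_dvd).2 h1)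
    rw [zero_add, hp] at h2
    exact h2.symm.trans hn
  · rw [hc p.1 h1, zero_mul]

/-- A unit that is a series in X^m acts within each residue class modulo m, and so does its inverse.
Theta denominators can therefore be cleared first. -/
theorem Vanish.of_mul_eq (h : c * f = g) (hc : c ∈ multiplesSubring m)
    (h0 : constantCoeff c ≠ 0) (hg : Vanish m r g) : Vanish m r f := by
  have h1 := hg.mul (inv_mem_multiplesSubring hc)
  rwa [← h, ← mul_assoc, PowerSeries.inv_mul_cancel c h0, one_mul] at h1

theorem Vanish.of_mul_X_pow_mul_eq (h : c * (X ^ k * f) = g) (hc : c ∈ multiplesSubring m)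
    (h0 : constantCoeff c ≠ 0) (hg : Vanish m (r + k) g) : Vanish m r f := by
  intro n hn
  have h1 := Vanish.of_mul_eq h hc h0 hg (n + k) (hn.add_right k)
  rwa [coeff_X_pow_mul] at h1

theorem Vanish.of_dvd (hf : Vanish d r f) (h : d ∣ m) : Vanish m r f :=
  fun n hn => hf n (hn.of_dvd h)

/-- The monomial z X^j is the single possible exception in the residue class. When there is none, it
is used with z = 0 and j = 0. -/
theorem coeff_eq_neg_of_vanish {h h' : ℂ⟦X⟧} {a N j : ℕ} {z : ℂ}
    (hv : Vanish m r (h + X ^ a * h' - C z * X ^ j)) (hN : N + a ≡ r [MOD m]) (hj : N + a ≠ j) :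
    coeff (N + a) h = -coeff N h' := by
  have e := hv (N + a) hN
  rw [map_sub, map_add, coeff_X_pow_mul, coeff_C_mul_X_pow, if_neg hj, sub_zero] at e
  exact eq_neg_of_add_eq_zero_left e

theorem coeff_eq_of_vanish {h h' : ℂ⟦X⟧} {a N : ℕ}
    (hv : Vanish m r (h - X ^ a * h')) (hN : N + a ≡ r [MOD m]) :
    coeff (N + a) h = coeff N h' := by
  have e := hv (N + a) hN
  rw [map_sub, coeff_X_pow_mul] at e
  exact sub_eq_zero.1 e

end Vanish

/-! ### The quotient of `S` and `T` -/

/-- The quotient `S(q) / T(q)`. -/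
noncomputable def ratio (q : ℂ⟦X⟧) : ℂ⟦X⟧ := S q * (T q)⁻¹

/-- The quotient `T(q) / S(q)`. -/
noncomputable def ratioInv (q : ℂ⟦X⟧) : ℂ⟦X⟧ := T q * (S q)⁻¹

section Ratio

variable {q : ℂ⟦X⟧}

theorem constantCoeff_S_ne_zero (q : ℂ⟦X⟧) : constantCoeff (S q) ≠ 0 := by
  rw [constantCoeff_S]
  exact one_ne_zero

theorem constantCoeff_T_ne_zero (q : ℂ⟦X⟧) : constantCoeff (T q) ≠ 0 := by
  rw [constantCoeff_T]
  exact one_ne_zero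

theorem ratio_mul_T (q : ℂ⟦X⟧) : ratio q * T q = S q := by
  rw [ratio, mul_assoc, PowerSeries.inv_mul_cancel _ (constantCoeff_T_ne_zero q), mul_one]

theorem ratioInv_mul_S (q : ℂ⟦X⟧) : ratioInv q * S q = T q := by
  rw [ratioInv, mul_assoc, PowerSeries.inv_mul_cancel _ (constantCoeff_S_ne_zero q), mul_one]

theorem ratio_mul_ratioInv (q : ℂ⟦X⟧) : ratio q * ratioInv q = 1 := by
  have h1 := PowerSeries.inv_mul_cancel _ (constantCoeff_T_ne_zero q)
  have h2 := PowerSeries.mul_inv_cancel _ (constantCoeff_S_ne_zero q)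
  rw [ratio, ratioInv]
  linear_combination S q * (S q)⁻¹ * h1 + h2

theorem ratio_mul_theta (hq : constantCoeff q = 0) :
    ratio q * theta 4 3 (-q) = theta 4 1 (-q) := by
  have h1 := PowerSeries.inv_mul_cancel _ (constantCoeff_T_ne_zero q)
  rw [ratio]
  linear_combination (T q)⁻¹ * S_mul_theta hq + theta 4 1 (-q) * h1

theorem ratioInv_mul_theta (hq : constantCoeff q = 0) :
    ratioInv q * theta 4 1 (-q) = theta 4 3 (-q) := by
  rw [← ratio_mul_theta hq]
  linear_combination theta 4 3 (-q) * ratio_mul_ratioInv q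

/-- With R = A/B, the difference R - q/R is (A² - qB²)/(AB); numerator and denominator are
`theta_four_sq_add` and `theta_four_mul` at -q, which share the factor ψ(-q). -/
theorem psi_mul_ratio_sub (hq : constantCoeff q = 0) :
    psi (q ^ 4) * (ratio q - q * ratioInv q) = phi (q ^ 2) := by
  have hn := constantCoeff_neg_eq_zero hq
  have h1 := theta_four_sq_add hn
  have h2 := theta_four_mul hn
  rw [Even.neg_pow (by decide)] at h1 h2
  refine mul_left_cancel₀ (ne_zero_of_constantCoeff (constantCoeff_psi hn)) ?_
  linear_combination h1 - (ratio q - q * ratioInv q) * h2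
    + theta 4 1 (-q) * ratio_mul_theta hq - q * theta 4 3 (-q) * ratioInv_mul_theta hq

theorem psi_mul_ratio_add (hq : constantCoeff q = 0) :
    psi (q ^ 4) * (ratio q + q * ratioInv q) = phi q := by
  have hn := constantCoeff_neg_eq_zero hq
  have h1 := theta_four_sq_sub hn
  have h2 := theta_four_mul hn
  rw [neg_neg] at h1
  rw [Even.neg_pow (by decide)] at h2
  refine mul_left_cancel₀ (ne_zero_of_constantCoeff (constantCoeff_psi hn)) ?_
  linear_combination h1 - (ratio q + q * ratioInv q) * h2
    + theta 4 1 (-q) * ratio_mul_theta hq + q * theta 4 3 (-q) * ratioInv_mul_theta hq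

end Ratio

/-! ### Theta functions of powers of `X` -/

/-- The series `φ(X ^ k)`. -/
noncomputable def phiX (k : ℕ) : ℂ⟦X⟧ := phi (X ^ k)

/-- The series `ψ(X ^ k)`. -/
noncomputable def psiX (k : ℕ) : ℂ⟦X⟧ := psi (X ^ k)

/-- The series `φ(-X ^ k)`. -/
noncomputable def phiNegX (k : ℕ) : ℂ⟦X⟧ := phi (-X ^ k)

/-- The series `ψ(-X ^ k)`. -/
noncomputable def psiNegX (k : ℕ) : ℂ⟦X⟧ := psi (-X ^ k)

section PowersOfX

variable {k m : ℕ}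

theorem constantCoeff_X_pow (hk : k ≠ 0) : constantCoeff ((X : ℂ⟦X⟧) ^ k) = 0 :=
  constantCoeff_pow_eq_zero constantCoeff_X hk

theorem constantCoeff_neg_X_pow (hk : k ≠ 0) : constantCoeff (-(X : ℂ⟦X⟧) ^ k) = 0 :=
  constantCoeff_neg_eq_zero (constantCoeff_X_pow hk)

theorem constantCoeff_phiX (hk : k ≠ 0) : constantCoeff (phiX k) = 1 :=
  constantCoeff_phi (constantCoeff_X_pow hk)

theorem constantCoeff_psiX (hk : k ≠ 0) : constantCoeff (psiX k) = 1 :=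
  constantCoeff_psi (constantCoeff_X_pow hk)

theorem constantCoeff_phiNegX (hk : k ≠ 0) : constantCoeff (phiNegX k) = 1 :=
  constantCoeff_phi (constantCoeff_neg_X_pow hk)

theorem phiX_mem (hk : k ≠ 0) (h : m ∣ k) : phiX k ∈ multiplesSubring m :=
  theta_mem_multiplesSubring (constantCoeff_X_pow hk) (X_pow_mem h) (by norm_num) (by norm_num)

theorem psiX_mem (hk : k ≠ 0) (h : m ∣ k) : psiX k ∈ multiplesSubring m :=
  theta_mem_multiplesSubring (constantCoeff_X_pow hk) (X_pow_mem h) (by norm_num) (by norm_num)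

theorem phiNegX_mem (hk : k ≠ 0) (h : m ∣ k) : phiNegX k ∈ multiplesSubring m :=
  theta_mem_multiplesSubring (constantCoeff_neg_X_pow hk) (neg_mem (X_pow_mem h)) (by norm_num)
    (by norm_num)

theorem psiNegX_mem (hk : k ≠ 0) (h : m ∣ k) : psiNegX k ∈ multiplesSubring m :=
  theta_mem_multiplesSubring (constantCoeff_neg_X_pow hk) (neg_mem (X_pow_mem h)) (by norm_num)
    (by norm_num)

theorem phiX_split (hk : k ≠ 0) : phiX k = phiX (k * 4) + 2 * X ^ k * psiX (k * 8) := by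
  simpa only [phiX, psiX, phiNegX, ← pow_mul] using phi_split (constantCoeff_X_pow hk)

theorem phiNegX_split (hk : k ≠ 0) : phiNegX k = phiX (k * 4) - 2 * X ^ k * psiX (k * 8) := by
  simpa only [phiX, psiX, phiNegX, ← pow_mul] using phi_neg_split (constantCoeff_X_pow hk)

theorem phiX_sq (hk : k ≠ 0) :
    phiX k ^ 2 = phiX (k * 2) ^ 2 + 4 * X ^ k * psiX (k * 4) ^ 2 := by
  simpa only [phiX, psiX, phiNegX, ← pow_mul] using phi_sq (constantCoeff_X_pow hk)

theorem psiX_sq (hk : k ≠ 0) : psiX k ^ 2 = phiX k * psiX (k * 2) := by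
  simpa only [phiX, psiX, phiNegX, ← pow_mul] using psi_sq (constantCoeff_X_pow hk)

theorem psiX_mul_psiX_cube (hk : k ≠ 0) : psiX k * psiX (k * 3)
    = psiX (k * 4) * phiX (k * 6) + X ^ k * phiX (k * 2) * psiX (k * 12) := by
  simpa only [phiX, psiX, phiNegX, ← pow_mul] using psi_mul_psi_cube (constantCoeff_X_pow hk)

theorem two_mul_psiX_mul_ratio (hk : k ≠ 0) :
    2 * psiX (k * 4) * ratio (X ^ k) = phiX k + phiX (k * 2) := by
  have h1 := psi_mul_ratio_sub (constantCoeff_X_pow hk)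
  have h2 := psi_mul_ratio_add (constantCoeff_X_pow hk)
  simp only [← pow_mul] at h1 h2
  rw [psiX, phiX, phiX, ← h1, ← h2]
  ring

theorem two_mul_psiX_mul_ratioInv (hk : k ≠ 0) :
    2 * psiX (k * 4) * (X ^ k * ratioInv (X ^ k)) = phiX k - phiX (k * 2) := by
  have h1 := psi_mul_ratio_sub (constantCoeff_X_pow hk)
  have h2 := psi_mul_ratio_add (constantCoeff_X_pow hk)
  simp only [← pow_mul] at h1 h2
  rw [psiX, phiX, phiX, ← h1, ← h2]
  ring

theorem two_mul_psiX_mul_ratio_neg (hk : k ≠ 0) :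
    2 * psiX (k * 4) * ratio (-X ^ k) = phiX (k * 2) + phiNegX k := by
  have h1 := psi_mul_ratio_sub (constantCoeff_neg_X_pow hk)
  have h2 := psi_mul_ratio_add (constantCoeff_neg_X_pow hk)
  rw [Even.neg_pow (by decide), Even.neg_pow (by decide)] at h1
  rw [Even.neg_pow (by decide)] at h2
  simp only [← pow_mul] at h1 h2
  rw [psiX, phiX, phiNegX, ← h1, ← h2]
  ring

theorem two_mul_psiX_mul_ratioInv_neg (hk : k ≠ 0) :
    2 * psiX (k * 4) * (X ^ k * ratioInv (-X ^ k)) = phiX (k * 2) - phiNegX k := by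
  have h1 := psi_mul_ratio_sub (constantCoeff_neg_X_pow hk)
  have h2 := psi_mul_ratio_add (constantCoeff_neg_X_pow hk)
  rw [Even.neg_pow (by decide), Even.neg_pow (by decide)] at h1
  rw [Even.neg_pow (by decide)] at h2
  simp only [← pow_mul] at h1 h2
  rw [psiX, phiX, phiNegX, ← h1, ← h2]
  ring

/-- The part in the class 2 modulo 4 is a monomial times ψ(X⁴)ψ(X¹²), the factor that clears the
denominators in the cubic cases. This is the source of their exceptional monomials. -/
theorem phiX_two_mul_phiX_six :
    phiX 2 * phiX 6
      = phiX 8 * phiX 24 + 4 * X ^ 8 * psiX 16 * psiX 48 + 2 * X ^ 2 * (psiX 4 * psiX 12) := by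
  have h1 := phiX_split (k := 2) (by norm_num)
  have h2 := phiX_split (k := 6) (by norm_num)
  have h3 := psiX_mul_psiX_cube (k := 4) (by norm_num)
  norm_num at h1 h2 h3
  rw [h1, h2, h3]
  ring

end PowersOfX

/-! ### Vanishing coefficients of the quotients -/

theorem vanish_quot1_one_odd : Vanish 2 1 (ratio X - X ^ 1 * ratioInv X) := by
  have a := two_mul_psiX_mul_ratio (k := 1) (by norm_num)
  have b := two_mul_psiX_mul_ratioInv (k := 1) (by norm_num)
  simp only [Nat.reduceMul, pow_one] at a b
  have h : (2 * psiX 4) * (ratio X - X ^ 1 * ratioInv X)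
      = (2 * phiX 2) := by
    linear_combination a - b
  refine Vanish.of_mul_eq h ?_ ?_ (vanish_of_mem (d := 2) ?_ ?_ ?_)
  -- The first pass reduces the subring memberships to divisibilities of exponents; the second
  -- settles those, the residue conditions and the nonzero constant term.
  all_goals try apply_rules (maxDepth := 500) (transparency := .reducible) [add_mem, sub_mem,
    neg_mem, mul_mem, X_pow_mem, phiX_mem, psiX_mem, phiNegX_mem, psiNegX_mem,
      inv_mem_multiplesSubring, pow_mem, ofNat_mem]
  all_goals first | decide | norm_num [constantCoeff_psiX, constantCoeff_phiX,
    constantCoeff_phiNegX, map_ofNat]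

theorem vanish_quot1_one_two : Vanish 4 2 (ratio X + X ^ 1 * ratioInv X - C 0 * X ^ 0) := by
  have a := two_mul_psiX_mul_ratio (k := 1) (by norm_num)
  have b := two_mul_psiX_mul_ratioInv (k := 1) (by norm_num)
  have c := phiX_split (k := 1) (by norm_num)
  simp only [Nat.reduceMul, pow_one] at a b c
  have h : (2 * psiX 4) * (ratio X + X ^ 1 * ratioInv X - C 0 * X ^ 0)
      = (2 * phiX 4) + X ^ 1 * (4 * psiX 8) := by
    rw [map_zero]
    linear_combination a + b + 2 * c
  refine Vanish.of_mul_eq h ?_ ?_ ((vanish_of_mem (d := 4) ?_ ?_ ?_).add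
    (vanish_X_pow_mul (d := 4) ?_ ?_ ?_))
  all_goals try apply_rules (maxDepth := 500) (transparency := .reducible) [add_mem, sub_mem,
    neg_mem, mul_mem, X_pow_mem, phiX_mem, psiX_mem, phiNegX_mem, psiNegX_mem,
      inv_mem_multiplesSubring, pow_mem, ofNat_mem]
  all_goals first | decide | norm_num [constantCoeff_psiX, constantCoeff_phiX,
    constantCoeff_phiNegX, map_ofNat]

theorem vanish_quot1_two_odd : Vanish 2 1 (ratio X ^ 2 + X ^ 2 * ratioInv X ^ 2 - C 2 * X ^ 1) := by
  have a := two_mul_psiX_mul_ratio (k := 1) (by norm_num)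
  have b := two_mul_psiX_mul_ratioInv (k := 1) (by norm_num)
  simp only [Nat.reduceMul, pow_one] at a b
  have h : (4 * psiX 4 ^ 2) * (ratio X ^ 2 + X ^ 2 * ratioInv X ^ 2 - C 2 * X ^ 1)
      = (4 * phiX 2 ^ 2) := by
    have d := ratio_mul_ratioInv X
    rw [map_ofNat]
    linear_combination (2 * psiX 4 * ratio X - 2 * psiX 4 * (X * ratioInv X) + 2 * phiX 2) * (a - b)
      + 8 * X * psiX 4 ^ 2 * d
  refine Vanish.of_mul_eq h ?_ ?_ (vanish_of_mem (d := 2) ?_ ?_ ?_)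
  all_goals try apply_rules (maxDepth := 500) (transparency := .reducible) [add_mem, sub_mem,
    neg_mem, mul_mem, X_pow_mem, phiX_mem, psiX_mem, phiNegX_mem, psiNegX_mem,
      inv_mem_multiplesSubring, pow_mem, ofNat_mem]
  all_goals first | decide | norm_num [constantCoeff_psiX, constantCoeff_phiX,
    constantCoeff_phiNegX, map_ofNat]

/-- The product of R + X/R and R - X/R is φ(X)φ(X²)/ψ(X⁴)², and ψ(X⁴)² = φ(X⁴)ψ(X⁸). Dissecting φ(X)
and then φ(X²) leaves only the classes 0 and 2 modulo 8 among even exponents. -/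
theorem psiX_mul_ratio_sq_sub_sq : psiX 8 * (ratio X ^ 2 - X ^ 2 * ratioInv X ^ 2)
    = (phiX 8) + X ^ 2 * (2 * psiX 16) + X ^ 1 * (2 * psiX 8 * phiX 2 * (phiX 4)⁻¹) := by
  have a := two_mul_psiX_mul_ratio (k := 1) (by norm_num)
  have b := two_mul_psiX_mul_ratioInv (k := 1) (by norm_num)
  have c := phiX_split (k := 1) (by norm_num)
  have z := phiX_split (k := 2) (by norm_num)
  have w := psiX_sq (k := 4) (by norm_num)
  simp only [Nat.reduceMul, pow_one] at a b c z w
  have i := PowerSeries.mul_inv_cancel (phiX 4) (by norm_num [constantCoeff_phiX])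
  have h0 : phiX 4 * psiX 8 * (ratio X ^ 2 - X ^ 2 * ratioInv X ^ 2) = phiX 1 * phiX 2 := by
    have e : 4 * (phiX 4 * psiX 8 * (ratio X ^ 2 - X ^ 2 * ratioInv X ^ 2))
        = 4 * (phiX 1 * phiX 2) := by
      linear_combination (-4 * (ratio X ^ 2 - X ^ 2 * ratioInv X ^ 2)) * w
        + (2 * psiX 4 * ratio X + phiX 1 + phiX 2) * a
        - (2 * psiX 4 * (X * ratioInv X) + phiX 1 - phiX 2) * b
    exact mul_left_cancel₀ (by norm_num) e
  linear_combination (phiX 4)⁻¹ * h0 - (psiX 8 * (ratio X ^ 2 - X ^ 2 * ratioInv X ^ 2)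
    - phiX 2) * i + (phiX 4)⁻¹ * phiX 2 * c + z

theorem vanish_quot1_two_four : Vanish 8 4 (ratio X ^ 2 - X ^ 2 * ratioInv X ^ 2) := by
  refine Vanish.of_mul_eq psiX_mul_ratio_sq_sub_sq ?_ ?_
    (((vanish_of_mem (d := 8) ?_ ?_ ?_).add (vanish_X_pow_mul (d := 8) ?_ ?_ ?_)).add
      (vanish_X_pow_mul (d := 2) ?_ ?_ ?_))
  all_goals try apply_rules (maxDepth := 500) (transparency := .reducible) [add_mem, sub_mem,
    neg_mem, mul_mem, X_pow_mem, phiX_mem, psiX_mem, phiNegX_mem, psiNegX_mem,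
      inv_mem_multiplesSubring, pow_mem, ofNat_mem]
  all_goals first | decide | norm_num [constantCoeff_psiX, constantCoeff_phiX,
    constantCoeff_phiNegX, map_ofNat]

theorem vanish_quot1_two_six : Vanish 8 6 (ratio X ^ 2 - X ^ 2 * ratioInv X ^ 2) := by
  refine Vanish.of_mul_eq psiX_mul_ratio_sq_sub_sq ?_ ?_
    (((vanish_of_mem (d := 8) ?_ ?_ ?_).add (vanish_X_pow_mul (d := 8) ?_ ?_ ?_)).add
      (vanish_X_pow_mul (d := 2) ?_ ?_ ?_))
  all_goals try apply_rules (maxDepth := 500) (transparency := .reducible) [add_mem, sub_mem,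
    neg_mem, mul_mem, X_pow_mem, phiX_mem, psiX_mem, phiNegX_mem, psiNegX_mem,
      inv_mem_multiplesSubring, pow_mem, ofNat_mem]
  all_goals first | decide | norm_num [constantCoeff_psiX, constantCoeff_phiX,
    constantCoeff_phiNegX, map_ofNat]

theorem vanish_quot1_four : Vanish 4 2 (ratio X ^ 4 + X ^ 4 * ratioInv X ^ 4 - C 10 * X ^ 2) := by
  have a := two_mul_psiX_mul_ratio (k := 1) (by norm_num)
  have b := two_mul_psiX_mul_ratioInv (k := 1) (by norm_num)
  have z := phiX_split (k := 2) (by norm_num)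
  have w := psiX_sq (k := 4) (by norm_num)
  have w8 := psiX_sq (k := 8) (by norm_num)
  have y := phiX_sq (k := 4) (by norm_num)
  simp only [Nat.reduceMul, pow_one] at a b z w w8 y
  have h : psiX 4 ^ 4 * (ratio X ^ 4 + X ^ 4 * ratioInv X ^ 4 - C 10 * X ^ 2)
      = (phiX 8 ^ 4 + 24 * X ^ 4 * phiX 8 ^ 2 * psiX 16 ^ 2 + 16 * X ^ 8 * psiX 16 ^ 4)
        + X ^ 1 * (4 * phiX 2 ^ 2 * psiX 4 ^ 2) := by
    have d := ratio_mul_ratioInv X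
    have e : psiX 4 * (ratio X - X * ratioInv X) = phiX 2 :=
      mul_left_cancel₀ (two_ne_zero (α := ℂ⟦X⟧)) (by linear_combination a - b)
    -- The class 2 modulo 4 of φ(X²)⁴ is exactly 8 X² ψ(X⁴)⁴. Together with the 2 X² from expressing
    -- R⁴ + X⁴/R⁴ through R - X/R, it makes up the exceptional 10 X².
    have e2 : phiX 2 ^ 4 = phiX 8 ^ 4 + 24 * X ^ 4 * phiX 8 ^ 2 * psiX 16 ^ 2
        + 16 * X ^ 8 * psiX 16 ^ 4 + 8 * X ^ 2 * psiX 4 ^ 4 := by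
      have e3 : psiX 4 ^ 4 = phiX 8 * psiX 16 * (phiX 8 ^ 2 + 4 * X ^ 4 * psiX 16 ^ 2) := by
        rw [← w8, ← y]
        linear_combination (psiX 4 ^ 2 + phiX 4 * psiX 8) * w
      rw [e3, z]
      ring
    have e4 : ratio X ^ 4 + X ^ 4 * ratioInv X ^ 4
        = (ratio X - X * ratioInv X) ^ 4 + 4 * X * (ratio X - X * ratioInv X) ^ 2 + 2 * X ^ 2 := by
      linear_combination (4 * X * ratio X ^ 2 + 4 * X ^ 3 * ratioInv X ^ 2
        - 6 * X ^ 2 * (ratio X * ratioInv X + 1) + 8 * X ^ 2) * d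
    rw [map_ofNat, e4, ← e] at *
    linear_combination e2
  refine Vanish.of_mul_eq h ?_ ?_ ((vanish_of_mem (d := 4) ?_ ?_ ?_).add
    (vanish_X_pow_mul (d := 2) ?_ ?_ ?_))
  all_goals try apply_rules (maxDepth := 500) (transparency := .reducible) [add_mem, sub_mem,
    neg_mem, mul_mem, X_pow_mem, phiX_mem, psiX_mem, phiNegX_mem, psiNegX_mem,
      inv_mem_multiplesSubring, pow_mem, ofNat_mem]
  all_goals first | decide | norm_num [constantCoeff_psiX, constantCoeff_phiX,
    constantCoeff_phiNegX, map_ofNat]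

theorem phiX_mul_phiX_seven : phiX 4 * phiX 28 + 4 * X ^ 8 * psiX 8 * psiX 56
    = phiX 8 * phiX 56 + 4 * X ^ 16 * psiX 16 * psiX 112 + 2 * X ^ 4 * psiX 4 * psiX 28 := by
  simpa only [phiX, psiX, ← pow_mul, Nat.reduceMul] using
    phi_mul_phi_seven (constantCoeff_X_pow (k := 4) (by norm_num))

theorem vanish_quot2_three : Vanish 4 1 (ratioInv X * ratio (X ^ 3)
    + X ^ 2 * (ratio X * ratioInv (X ^ 3)) - C (-1) * X ^ 1) := by
  have a := two_mul_psiX_mul_ratio (k := 1) (by norm_num)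
  have b := two_mul_psiX_mul_ratioInv (k := 1) (by norm_num)
  have c := two_mul_psiX_mul_ratio (k := 3) (by norm_num)
  have d := two_mul_psiX_mul_ratioInv (k := 3) (by norm_num)
  have f := phiX_split (k := 1) (by norm_num)
  have g := phiX_split (k := 3) (by norm_num)
  simp only [Nat.reduceMul, pow_one] at a b c d f g
  have h : (4 * psiX 4 * psiX 12) * (X ^ 1 * (ratioInv X * ratio (X ^ 3)
      + X ^ 2 * (ratio X * ratioInv (X ^ 3)) - C (-1) * X ^ 1))
      = (2 * (phiX 4 * phiX 12 + 4 * X ^ 4 * psiX 8 * psiX 24)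
        - 2 * (phiX 8 * phiX 24 + 4 * X ^ 8 * psiX 16 * psiX 48)) + X ^ 1 * (4 * psiX 8 * phiX 12)
        + X ^ 3 * (4 * phiX 4 * psiX 24) := by
    rw [map_neg, map_one]
    linear_combination (2 * psiX 4 * (X ^ 1 * ratioInv X)) * c + (phiX 3 + phiX 6) * b
      + (2 * psiX 4 * ratio X) * d + (phiX 3 - phiX 6) * a + 2 * phiX 3 * f
      + 2 * (phiX 4 + 2 * X * psiX 8) * g - 2 * phiX_two_mul_phiX_six
  refine Vanish.of_mul_X_pow_mul_eq h ?_ ?_ (((vanish_of_mem (d := 4) ?_ ?_ ?_).add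
    (vanish_X_pow_mul (d := 4) ?_ ?_ ?_)).add (vanish_X_pow_mul (d := 4) ?_ ?_ ?_))
  all_goals try apply_rules (maxDepth := 500) (transparency := .reducible) [add_mem, sub_mem,
    neg_mem, mul_mem, X_pow_mem, phiX_mem, psiX_mem, phiNegX_mem, psiNegX_mem,
      inv_mem_multiplesSubring, pow_mem, ofNat_mem]
  all_goals first | decide | norm_num [constantCoeff_psiX, constantCoeff_phiX,
    constantCoeff_phiNegX, map_ofNat]

/-- No modular equation of degree 5 is needed: multiplication by X moves the class to 3 modulo 4,
and the product φ(X²)φ(X¹⁰) is even. The same parity argument serves `vanish_quot2_nine`,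
`vanish_quot3_five` and `vanish_quot3_nine`. -/
theorem vanish_quot2_five : Vanish 4 2 (ratioInv X * ratio (X ^ 5)
    + X ^ 4 * (ratio X * ratioInv (X ^ 5)) - C 0 * X ^ 0) := by
  have a := two_mul_psiX_mul_ratio (k := 1) (by norm_num)
  have b := two_mul_psiX_mul_ratioInv (k := 1) (by norm_num)
  have c := two_mul_psiX_mul_ratio (k := 5) (by norm_num)
  have d := two_mul_psiX_mul_ratioInv (k := 5) (by norm_num)
  have f := phiX_split (k := 1) (by norm_num)
  have g := phiX_split (k := 5) (by norm_num)
  simp only [Nat.reduceMul, pow_one] at a b c d f g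
  have h : (4 * psiX 4 * psiX 20) * (X ^ 1 * (ratioInv X * ratio (X ^ 5)
      + X ^ 4 * (ratio X * ratioInv (X ^ 5)) - C 0 * X ^ 0))
      = (2 * phiX 4 * phiX 20 + 8 * X ^ 6 * psiX 8 * psiX 40 - 2 * (phiX 2 * phiX 10))
        + X ^ 1 * (4 * psiX 8 * phiX 20 + 4 * X ^ 4 * phiX 4 * psiX 40) := by
    rw [map_zero]
    linear_combination (2 * psiX 4 * (X ^ 1 * ratioInv X)) * c + (phiX 5 + phiX 10) * b
      + (2 * psiX 4 * ratio X) * d + (phiX 5 - phiX 10) * a + 2 * phiX 5 * f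
      + 2 * (phiX 4 + 2 * X * psiX 8) * g
  refine Vanish.of_mul_X_pow_mul_eq h ?_ ?_ ((vanish_of_mem (d := 2) ?_ ?_ ?_).add
    (vanish_X_pow_mul (d := 4) ?_ ?_ ?_))
  all_goals try apply_rules (maxDepth := 500) (transparency := .reducible) [add_mem, sub_mem,
    neg_mem, mul_mem, X_pow_mem, phiX_mem, psiX_mem, phiNegX_mem, psiNegX_mem,
      inv_mem_multiplesSubring, pow_mem, ofNat_mem]
  all_goals first | decide | norm_num [constantCoeff_psiX, constantCoeff_phiX,
    constantCoeff_phiNegX, map_ofNat]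

theorem vanish_quot2_seven : Vanish 4 3 (ratioInv X * ratio (X ^ 7)
    + X ^ 6 * (ratio X * ratioInv (X ^ 7)) - C 1 * X ^ 3) := by
  have a := two_mul_psiX_mul_ratio (k := 1) (by norm_num)
  have b := two_mul_psiX_mul_ratioInv (k := 1) (by norm_num)
  have c := two_mul_psiX_mul_ratio (k := 7) (by norm_num)
  have d := two_mul_psiX_mul_ratioInv (k := 7) (by norm_num)
  have f := phiX_split (k := 1) (by norm_num)
  have g := phiX_split (k := 7) (by norm_num)
  have z := phiX_split (k := 2) (by norm_num)
  have w := phiX_split (k := 14) (by norm_num)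
  simp only [Nat.reduceMul, pow_one] at a b c d f g z w
  have h : (4 * psiX 4 * psiX 28) * (X ^ 1 * (ratioInv X * ratio (X ^ 7)
      + X ^ 6 * (ratio X * ratioInv (X ^ 7)) - C 1 * X ^ 3))
      = X ^ 1 * (4 * psiX 8 * phiX 28) + X ^ 3 * (4 * X ^ 4 * phiX 4 * psiX 56)
        + X ^ 2 * (-(4 * psiX 16 * phiX 56 + 4 * X ^ 12 * phiX 8 * psiX 112)) := by
    -- The part with exponents divisible by 4 is evaluated by the degree 7 identity as 4 X⁴ ψ(X⁴)
    -- ψ(X²⁸), which is the exceptional monomial X³ times the clearing factor and X.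
    rw [map_one]
    linear_combination (2 * psiX 4 * (X ^ 1 * ratioInv X)) * c + (phiX 7 + phiX 14) * b
      + (2 * psiX 4 * ratio X) * d + (phiX 7 - phiX 14) * a + 2 * phiX 7 * f
      + 2 * (phiX 4 + 2 * X * psiX 8) * g - 2 * phiX 14 * z - 2 * (phiX 8 + 2 * X ^ 2 * psiX 16) * w
      + 2 * phiX_mul_phiX_seven
  refine Vanish.of_mul_X_pow_mul_eq h ?_ ?_ (((vanish_X_pow_mul (d := 4) ?_ ?_ ?_).add
    (vanish_X_pow_mul (d := 4) ?_ ?_ ?_)).add (vanish_X_pow_mul (d := 4) ?_ ?_ ?_))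
  all_goals try apply_rules (maxDepth := 500) (transparency := .reducible) [add_mem, sub_mem,
    neg_mem, mul_mem, X_pow_mem, phiX_mem, psiX_mem, phiNegX_mem, psiNegX_mem,
      inv_mem_multiplesSubring, pow_mem, ofNat_mem]
  all_goals first | decide | norm_num [constantCoeff_psiX, constantCoeff_phiX,
    constantCoeff_phiNegX, map_ofNat]

theorem vanish_quot2_nine : Vanish 4 2 (ratioInv X * ratio (X ^ 9)
    + X ^ 8 * (ratio X * ratioInv (X ^ 9)) - C 0 * X ^ 0) := by
  have a := two_mul_psiX_mul_ratio (k := 1) (by norm_num)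
  have b := two_mul_psiX_mul_ratioInv (k := 1) (by norm_num)
  have c := two_mul_psiX_mul_ratio (k := 9) (by norm_num)
  have d := two_mul_psiX_mul_ratioInv (k := 9) (by norm_num)
  have f := phiX_split (k := 1) (by norm_num)
  have g := phiX_split (k := 9) (by norm_num)
  simp only [Nat.reduceMul, pow_one] at a b c d f g
  have h : (4 * psiX 4 * psiX 36) * (X ^ 1 * (ratioInv X * ratio (X ^ 9)
      + X ^ 8 * (ratio X * ratioInv (X ^ 9)) - C 0 * X ^ 0))
      = (2 * phiX 4 * phiX 36 + 8 * X ^ 10 * psiX 8 * psiX 72 - 2 * (phiX 2 * phiX 18))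
        + X ^ 1 * (4 * psiX 8 * phiX 36 + 4 * X ^ 8 * phiX 4 * psiX 72) := by
    rw [map_zero]
    linear_combination (2 * psiX 4 * (X ^ 1 * ratioInv X)) * c + (phiX 9 + phiX 18) * b
      + (2 * psiX 4 * ratio X) * d + (phiX 9 - phiX 18) * a + 2 * phiX 9 * f
      + 2 * (phiX 4 + 2 * X * psiX 8) * g
  refine Vanish.of_mul_X_pow_mul_eq h ?_ ?_ ((vanish_of_mem (d := 2) ?_ ?_ ?_).add
    (vanish_X_pow_mul (d := 4) ?_ ?_ ?_))
  all_goals try apply_rules (maxDepth := 500) (transparency := .reducible) [add_mem, sub_mem,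
    neg_mem, mul_mem, X_pow_mem, phiX_mem, psiX_mem, phiNegX_mem, psiNegX_mem,
      inv_mem_multiplesSubring, pow_mem, ofNat_mem]
  all_goals first | decide | norm_num [constantCoeff_psiX, constantCoeff_phiX,
    constantCoeff_phiNegX, map_ofNat]

theorem vanish_quot3_three : Vanish 4 2 (ratio X * ratio (X ^ 3)
    + X ^ 4 * (ratioInv X * ratioInv (X ^ 3)) - C 1 * X ^ 2) := by
  have a := two_mul_psiX_mul_ratio (k := 1) (by norm_num)
  have b := two_mul_psiX_mul_ratioInv (k := 1) (by norm_num)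
  have c := two_mul_psiX_mul_ratio (k := 3) (by norm_num)
  have d := two_mul_psiX_mul_ratioInv (k := 3) (by norm_num)
  have f := phiX_split (k := 1) (by norm_num)
  have g := phiX_split (k := 3) (by norm_num)
  simp only [Nat.reduceMul, pow_one] at a b c d f g
  have h : (4 * psiX 4 * psiX 12) * (ratio X * ratio (X ^ 3)
      + X ^ 4 * (ratioInv X * ratioInv (X ^ 3)) - C 1 * X ^ 2)
      = (2 * (phiX 4 * phiX 12 + 4 * X ^ 4 * psiX 8 * psiX 24)
        + 2 * (phiX 8 * phiX 24 + 4 * X ^ 8 * psiX 16 * psiX 48)) + X ^ 1 * (4 * psiX 8 * phiX 12)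
        + X ^ 3 * (4 * phiX 4 * psiX 24) := by
    rw [map_one]
    linear_combination (2 * psiX 4 * ratio X) * c + (phiX 3 + phiX 6) * a
      + (2 * psiX 4 * (X * ratioInv X)) * d + (phiX 3 - phiX 6) * b + 2 * phiX 3 * f
      + 2 * (phiX 4 + 2 * X * psiX 8) * g + 2 * phiX_two_mul_phiX_six
  refine Vanish.of_mul_eq h ?_ ?_ (((vanish_of_mem (d := 4) ?_ ?_ ?_).add
    (vanish_X_pow_mul (d := 4) ?_ ?_ ?_)).add (vanish_X_pow_mul (d := 4) ?_ ?_ ?_))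
  all_goals try apply_rules (maxDepth := 500) (transparency := .reducible) [add_mem, sub_mem,
    neg_mem, mul_mem, X_pow_mem, phiX_mem, psiX_mem, phiNegX_mem, psiNegX_mem,
      inv_mem_multiplesSubring, pow_mem, ofNat_mem]
  all_goals first | decide | norm_num [constantCoeff_psiX, constantCoeff_phiX,
    constantCoeff_phiNegX, map_ofNat]

theorem vanish_quot3_five : Vanish 4 3 (ratio X * ratio (X ^ 5)
    + X ^ 6 * (ratioInv X * ratioInv (X ^ 5)) - C 0 * X ^ 0) := by
  have a := two_mul_psiX_mul_ratio (k := 1) (by norm_num)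
  have b := two_mul_psiX_mul_ratioInv (k := 1) (by norm_num)
  have c := two_mul_psiX_mul_ratio (k := 5) (by norm_num)
  have d := two_mul_psiX_mul_ratioInv (k := 5) (by norm_num)
  have f := phiX_split (k := 1) (by norm_num)
  have g := phiX_split (k := 5) (by norm_num)
  simp only [Nat.reduceMul, pow_one] at a b c d f g
  have h : (4 * psiX 4 * psiX 20) * (ratio X * ratio (X ^ 5)
      + X ^ 6 * (ratioInv X * ratioInv (X ^ 5)) - C 0 * X ^ 0)
      = (2 * phiX 4 * phiX 20 + 8 * X ^ 6 * psiX 8 * psiX 40 + 2 * (phiX 2 * phiX 10))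
        + X ^ 1 * (4 * psiX 8 * phiX 20 + 4 * X ^ 4 * phiX 4 * psiX 40) := by
    rw [map_zero]
    linear_combination (2 * psiX 4 * ratio X) * c + (phiX 5 + phiX 10) * a
      + (2 * psiX 4 * (X * ratioInv X)) * d + (phiX 5 - phiX 10) * b + 2 * phiX 5 * f
      + 2 * (phiX 4 + 2 * X * psiX 8) * g
  refine Vanish.of_mul_eq h ?_ ?_ ((vanish_of_mem (d := 2) ?_ ?_ ?_).add
    (vanish_X_pow_mul (d := 4) ?_ ?_ ?_))
  all_goals try apply_rules (maxDepth := 500) (transparency := .reducible) [add_mem, sub_mem,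
    neg_mem, mul_mem, X_pow_mem, phiX_mem, psiX_mem, phiNegX_mem, psiNegX_mem,
      inv_mem_multiplesSubring, pow_mem, ofNat_mem]
  all_goals first | decide | norm_num [constantCoeff_psiX, constantCoeff_phiX,
    constantCoeff_phiNegX, map_ofNat]

theorem vanish_quot3_nine : Vanish 4 3 (ratio X * ratio (X ^ 9)
    + X ^ 10 * (ratioInv X * ratioInv (X ^ 9)) - C 0 * X ^ 0) := by
  have a := two_mul_psiX_mul_ratio (k := 1) (by norm_num)
  have b := two_mul_psiX_mul_ratioInv (k := 1) (by norm_num)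
  have c := two_mul_psiX_mul_ratio (k := 9) (by norm_num)
  have d := two_mul_psiX_mul_ratioInv (k := 9) (by norm_num)
  have f := phiX_split (k := 1) (by norm_num)
  have g := phiX_split (k := 9) (by norm_num)
  simp only [Nat.reduceMul, pow_one] at a b c d f g
  have h : (4 * psiX 4 * psiX 36) * (ratio X * ratio (X ^ 9)
      + X ^ 10 * (ratioInv X * ratioInv (X ^ 9)) - C 0 * X ^ 0)
      = (2 * phiX 4 * phiX 36 + 8 * X ^ 10 * psiX 8 * psiX 72 + 2 * (phiX 2 * phiX 18))
        + X ^ 1 * (4 * psiX 8 * phiX 36 + 4 * X ^ 8 * phiX 4 * psiX 72) := by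
    rw [map_zero]
    linear_combination (2 * psiX 4 * ratio X) * c + (phiX 9 + phiX 18) * a
      + (2 * psiX 4 * (X * ratioInv X)) * d + (phiX 9 - phiX 18) * b + 2 * phiX 9 * f
      + 2 * (phiX 4 + 2 * X * psiX 8) * g
  refine Vanish.of_mul_eq h ?_ ?_ ((vanish_of_mem (d := 2) ?_ ?_ ?_).add
    (vanish_X_pow_mul (d := 4) ?_ ?_ ?_))
  all_goals try apply_rules (maxDepth := 500) (transparency := .reducible) [add_mem, sub_mem,
    neg_mem, mul_mem, X_pow_mem, phiX_mem, psiX_mem, phiNegX_mem, psiNegX_mem,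
      inv_mem_multiplesSubring, pow_mem, ofNat_mem]
  all_goals first | decide | norm_num [constantCoeff_psiX, constantCoeff_phiX,
    constantCoeff_phiNegX, map_ofNat]

theorem vanish_quot4 : Vanish 4 2 (ratioInv (X ^ 2) * ratio (X ^ 4)
    + X ^ 2 * (ratio (X ^ 2) * ratioInv (X ^ 4)) - C 0 * X ^ 0) := by
  have a := two_mul_psiX_mul_ratio (k := 2) (by norm_num)
  have b := two_mul_psiX_mul_ratioInv (k := 2) (by norm_num)
  have c := two_mul_psiX_mul_ratio (k := 4) (by norm_num)
  have d := two_mul_psiX_mul_ratioInv (k := 4) (by norm_num)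
  have z := phiX_split (k := 2) (by norm_num)
  simp only [Nat.reduceMul] at a b c d z
  have h : (4 * psiX 8 * psiX 16) * (X ^ 2 * (ratioInv (X ^ 2) * ratio (X ^ 4)
      + X ^ 2 * (ratio (X ^ 2) * ratioInv (X ^ 4)) - C 0 * X ^ 0))
      = X ^ 2 * (4 * psiX 16 * phiX 4) := by
    rw [map_zero]
    linear_combination (2 * psiX 8 * (X ^ 2 * ratioInv (X ^ 2))) * c + (phiX 4 + phiX 8) * b
      + (2 * psiX 8 * ratio (X ^ 2)) * d + (phiX 4 - phiX 8) * a + 2 * phiX 4 * z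
  refine Vanish.of_mul_X_pow_mul_eq h ?_ ?_ (vanish_X_pow_mul (d := 4) ?_ ?_ ?_)
  all_goals try apply_rules (maxDepth := 500) (transparency := .reducible) [add_mem, sub_mem,
    neg_mem, mul_mem, X_pow_mem, phiX_mem, psiX_mem, phiNegX_mem, psiNegX_mem,
      inv_mem_multiplesSubring, pow_mem, ofNat_mem]
  all_goals first | decide | norm_num [constantCoeff_psiX, constantCoeff_phiX,
    constantCoeff_phiNegX, map_ofNat]

theorem quot5_sum : psiX 4 ^ 2 * psiX 16 * (ratio (-X) * ratioInv X * ratio (X ^ 4)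
    + X ^ 4 * (ratioInv (-X) * ratio X * ratioInv (X ^ 4)) - 2 * X ^ 2)
    = psiX 4 ^ 2 * phiX 8 - 2 * X * phiX 8 * psiX 8 ^ 2 := by
  have hFn1 := two_mul_psiX_mul_ratio_neg (k := 1) (by norm_num)
  have hG1 := two_mul_psiX_mul_ratioInv (k := 1) (by norm_num)
  have hF4 := two_mul_psiX_mul_ratio (k := 4) (by norm_num)
  have hGn1 := two_mul_psiX_mul_ratioInv_neg (k := 1) (by norm_num)
  have hF1 := two_mul_psiX_mul_ratio (k := 1) (by norm_num)
  have hG4 := two_mul_psiX_mul_ratioInv (k := 4) (by norm_num)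
  have f := phiX_split (k := 1) (by norm_num)
  have g := phiNegX_split (k := 1) (by norm_num)
  have y := phiX_sq (k := 2) (by norm_num)
  have w := psiX_sq (k := 4) (by norm_num)
  have z := phiX_split (k := 2) (by norm_num)
  simp only [Nat.reduceMul, pow_one] at hFn1 hG1 hF4 hGn1 hF1 hG4 f g y w z
  -- Each of the three half-sum formulas contributes a factor 2, and the one for 1/R(±X) a factor X.
  have h8 : (8 * X : ℂ⟦X⟧) ≠ 0 := mul_ne_zero (by norm_num) X_ne_zero
  refine mul_left_cancel₀ h8 ?_
  linear_combination (2 * psiX 4 * ratio (-X)) * (2 * psiX 4 * (X * ratioInv X)) * hF4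
    + (2 * psiX 4 * ratio (-X)) * (phiX 4 + phiX 8) * hG1
    + (phiX 1 - phiX 2) * (phiX 4 + phiX 8) * hFn1
    + (2 * psiX 4 * (X * ratioInv (-X))) * (2 * psiX 4 * ratio X) * hG4
    + (2 * psiX 4 * (X * ratioInv (-X))) * (phiX 4 - phiX 8) * hF1
    + (phiX 1 + phiX 2) * (phiX 4 - phiX 8) * hGn1
    + (2 * phiX 4 * phiX 2 + 2 * phiX 8 * phiNegX 1) * f
    + (-2 * phiX 4 * phiX 2 + 2 * phiX 8 * (phiX 4 + 2 * X * psiX 8)) * g - 2 * phiX 8 * y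
    - 8 * X * phiX 2 * w + 8 * X * psiX 4 ^ 2 * z

theorem quot5_diff : psiX 4 ^ 2 * psiX 16 * (ratio (-X) * ratioInv X * ratio (X ^ 4)
    - X ^ 4 * (ratioInv (-X) * ratio X * ratioInv (X ^ 4)))
    = phiX 8 ^ 2 * psiX 8 + 2 * X ^ 2 * phiX 8 * psiX 8 * psiX 16
      - 2 * X * phiX 4 * psiX 8 ^ 2 := by
  have hFn1 := two_mul_psiX_mul_ratio_neg (k := 1) (by norm_num)
  have hG1 := two_mul_psiX_mul_ratioInv (k := 1) (by norm_num)
  have hF4 := two_mul_psiX_mul_ratio (k := 4) (by norm_num)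
  have hGn1 := two_mul_psiX_mul_ratioInv_neg (k := 1) (by norm_num)
  have hF1 := two_mul_psiX_mul_ratio (k := 1) (by norm_num)
  have hG4 := two_mul_psiX_mul_ratioInv (k := 4) (by norm_num)
  have f := phiX_split (k := 1) (by norm_num)
  have g := phiNegX_split (k := 1) (by norm_num)
  have y := phiX_sq (k := 2) (by norm_num)
  have w := psiX_sq (k := 4) (by norm_num)
  have z := phiX_split (k := 2) (by norm_num)
  simp only [Nat.reduceMul, pow_one] at hFn1 hG1 hF4 hGn1 hF1 hG4 f g y w z
  have h8 : (8 * X : ℂ⟦X⟧) ≠ 0 := mul_ne_zero (by norm_num) X_ne_zero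
  refine mul_left_cancel₀ h8 ?_
  linear_combination (2 * psiX 4 * ratio (-X)) * (2 * psiX 4 * (X * ratioInv X)) * hF4
    + (2 * psiX 4 * ratio (-X)) * (phiX 4 + phiX 8) * hG1
    + (phiX 1 - phiX 2) * (phiX 4 + phiX 8) * hFn1
    - (2 * psiX 4 * (X * ratioInv (-X))) * (2 * psiX 4 * ratio X) * hG4
    - (2 * psiX 4 * (X * ratioInv (-X))) * (phiX 4 - phiX 8) * hF1
    - (phiX 1 + phiX 2) * (phiX 4 - phiX 8) * hGn1
    + (2 * phiX 8 * phiX 2 + 2 * phiX 4 * phiNegX 1) * f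
    + (-2 * phiX 8 * phiX 2 + 2 * phiX 4 * (phiX 4 + 2 * X * psiX 8)) * g - 2 * phiX 4 * y
    + 8 * X * phiX 8 * psiX 8 * z

theorem vanish_quot5_one_two : Vanish 4 2 (ratio (-X) * ratioInv X * ratio (X ^ 4)
    + X ^ 4 * (ratioInv (-X) * ratio X * ratioInv (X ^ 4)) - C 2 * X ^ 2) := by
  have h : (psiX 4 ^ 2 * psiX 16) * (ratio (-X) * ratioInv X * ratio (X ^ 4)
      + X ^ 4 * (ratioInv (-X) * ratio X * ratioInv (X ^ 4)) - C 2 * X ^ 2)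
      = (psiX 4 ^ 2 * phiX 8) + X ^ 1 * (-(2 * phiX 8 * psiX 8 ^ 2)) := by
    rw [map_ofNat]
    linear_combination quot5_sum
  refine Vanish.of_mul_eq h ?_ ?_ ((vanish_of_mem (d := 4) ?_ ?_ ?_).add
    (vanish_X_pow_mul (d := 4) ?_ ?_ ?_))
  all_goals try apply_rules (maxDepth := 500) (transparency := .reducible) [add_mem, sub_mem,
    neg_mem, mul_mem, X_pow_mem, phiX_mem, psiX_mem, phiNegX_mem, psiNegX_mem,
      inv_mem_multiplesSubring, pow_mem, ofNat_mem]
  all_goals first | decide | norm_num [constantCoeff_psiX, constantCoeff_phiX,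
    constantCoeff_phiNegX, map_ofNat]

theorem vanish_quot5_one_three : Vanish 4 3 (ratio (-X) * ratioInv X * ratio (X ^ 4)
    - X ^ 4 * (ratioInv (-X) * ratio X * ratioInv (X ^ 4))) := by
  have h : (psiX 4 ^ 2 * psiX 16) * (ratio (-X) * ratioInv X * ratio (X ^ 4)
      - X ^ 4 * (ratioInv (-X) * ratio X * ratioInv (X ^ 4)))
      = (phiX 8 ^ 2 * psiX 8) + X ^ 2 * (2 * phiX 8 * psiX 8 * psiX 16)
        + X ^ 1 * (-(2 * phiX 4 * psiX 8 ^ 2)) := by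
    linear_combination quot5_diff
  refine Vanish.of_mul_eq h ?_ ?_ (((vanish_of_mem (d := 4) ?_ ?_ ?_).add
    (vanish_X_pow_mul (d := 4) ?_ ?_ ?_)).add (vanish_X_pow_mul (d := 4) ?_ ?_ ?_))
  all_goals try apply_rules (maxDepth := 500) (transparency := .reducible) [add_mem, sub_mem,
    neg_mem, mul_mem, X_pow_mem, phiX_mem, psiX_mem, phiNegX_mem, psiNegX_mem,
      inv_mem_multiplesSubring, pow_mem, ofNat_mem]
  all_goals first | decide | norm_num [constantCoeff_psiX, constantCoeff_phiX,
    constantCoeff_phiNegX, map_ofNat]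

theorem vanish_quot5_one_four : Vanish 8 4 (ratio (-X) * ratioInv X * ratio (X ^ 4)
    + X ^ 4 * (ratioInv (-X) * ratio X * ratioInv (X ^ 4)) - C 2 * X ^ 2) := by
  have h : psiX 16 * (ratio (-X) * ratioInv X * ratio (X ^ 4)
      + X ^ 4 * (ratioInv (-X) * ratio X * ratioInv (X ^ 4)) - C 2 * X ^ 2)
      -- Dividing by ψ(X⁴)², which is not a series in X⁸, disturbs only the odd part; the even part
      -- is left as a series in X⁸.
      = (phiX 8) + X ^ 1 * (-(2 * phiX 8 * psiX 8 ^ 2 * (psiX 4 ^ 2)⁻¹)) := by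
    have i := PowerSeries.mul_inv_cancel (psiX 4 ^ 2) (by norm_num [constantCoeff_psiX])
    rw [map_ofNat]
    linear_combination (psiX 4 ^ 2)⁻¹ * quot5_sum
      - (psiX 16 * (ratio (-X) * ratioInv X * ratio (X ^ 4)
      + X ^ 4 * (ratioInv (-X) * ratio X * ratioInv (X ^ 4)) - 2 * X ^ 2) - phiX 8) * i
  refine Vanish.of_mul_eq h ?_ ?_ ((vanish_of_mem (d := 8) ?_ ?_ ?_).add
    (vanish_X_pow_mul (d := 2) ?_ ?_ ?_))
  all_goals try apply_rules (maxDepth := 500) (transparency := .reducible) [add_mem, sub_mem,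
    neg_mem, mul_mem, X_pow_mem, phiX_mem, psiX_mem, phiNegX_mem, psiNegX_mem,
      inv_mem_multiplesSubring, pow_mem, ofNat_mem]
  all_goals first | decide | norm_num [constantCoeff_psiX, constantCoeff_phiX,
    constantCoeff_phiNegX, map_ofNat]

theorem vanish_quot5_one_five : Vanish 8 5 (ratio (-X) * ratioInv X * ratio (X ^ 4)
    - X ^ 4 * (ratioInv (-X) * ratio X * ratioInv (X ^ 4))) := by
  have w := psiX_sq (k := 4) (by norm_num)
  simp only [Nat.reduceMul] at w
  have h : psiX 16 * (ratio (-X) * ratioInv X * ratio (X ^ 4)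
      - X ^ 4 * (ratioInv (-X) * ratio X * ratioInv (X ^ 4)))
      = ((phiX 8 ^ 2 * psiX 8 + 2 * X ^ 2 * phiX 8 * psiX 8 * psiX 16) * (psiX 4 ^ 2)⁻¹)
        + X ^ 1 * (-(2 * psiX 8)) := by
    have i := PowerSeries.mul_inv_cancel (psiX 4 ^ 2) (by norm_num [constantCoeff_psiX])
    linear_combination (psiX 4 ^ 2)⁻¹ * quot5_diff
      - (psiX 16 * (ratio (-X) * ratioInv X * ratio (X ^ 4)
      - X ^ 4 * (ratioInv (-X) * ratio X * ratioInv (X ^ 4))) + 2 * X * psiX 8) * i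
      + 2 * X * psiX 8 * (psiX 4 ^ 2)⁻¹ * w
  refine Vanish.of_mul_eq h ?_ ?_ ((vanish_of_mem (d := 2) ?_ ?_ ?_).add
    (vanish_X_pow_mul (d := 8) ?_ ?_ ?_))
  all_goals try apply_rules (maxDepth := 500) (transparency := .reducible) [add_mem, sub_mem,
    neg_mem, mul_mem, X_pow_mem, phiX_mem, psiX_mem, phiNegX_mem, psiNegX_mem,
      inv_mem_multiplesSubring, pow_mem, ofNat_mem]
  all_goals first | decide | norm_num [constantCoeff_psiX, constantCoeff_phiX,
    constantCoeff_phiNegX, map_ofNat]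

theorem vanish_quot5_two : Vanish 8 4 ((ratio (-X) * ratioInv X * ratio (X ^ 4)) ^ 2
    + X ^ 8 * (ratioInv (-X) * ratio X * ratioInv (X ^ 4)) ^ 2 - C 2 * X ^ 4) := by
  have z := phiX_split (k := 2) (by norm_num)
  have y := phiX_sq (k := 2) (by norm_num)
  have x := phiX_sq (k := 4) (by norm_num)
  simp only [Nat.reduceMul] at z y x
  have h : (psiX 16 ^ 2) * ((ratio (-X) * ratioInv X * ratio (X ^ 4)) ^ 2
      + X ^ 8 * (ratioInv (-X) * ratio X * ratioInv (X ^ 4)) ^ 2 - C 2 * X ^ 4)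
      = (phiX 8 ^ 2) + X ^ 2 * (4 * psiX 8 ^ 2 + 4 * (phiX 8 * psiX 8 ^ 2 * (psiX 4 ^ 2)⁻¹) ^ 2)
        + X ^ 1 * (-(4 * phiX 2 * (phiX 8 * psiX 8 ^ 2 * (psiX 4 ^ 2)⁻¹))) := by
    have i := PowerSeries.mul_inv_cancel (psiX 4 ^ 2) (by norm_num [constantCoeff_psiX])
    have d1 := ratio_mul_ratioInv (X : ℂ⟦X⟧)
    have d2 := ratio_mul_ratioInv (-X : ℂ⟦X⟧)
    have d3 := ratio_mul_ratioInv (X ^ 4 : ℂ⟦X⟧)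
    have d : (ratio (-X) * ratioInv X * ratio (X ^ 4))
        * (ratioInv (-X) * ratio X * ratioInv (X ^ 4)) = 1 := by
      linear_combination (ratio (-X) * ratioInv (-X) * ratio (X ^ 4) * ratioInv (X ^ 4)) * d1
        + (ratio (X ^ 4) * ratioInv (X ^ 4)) * d2 + d3
    -- The exceptional 2 X² of `quot5_sum` merges with φ(X⁸) into φ(X²). Squaring then gives P² + X⁸
    -- P⁻² with cross term 2 X⁴, and dissecting φ(X²)² contributes 4 X⁴ ψ(X¹⁶)²; the difference is
    -- the exceptional 2 X⁴.
    have e : psiX 16 * (ratio (-X) * ratioInv X * ratio (X ^ 4)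
        + X ^ 4 * (ratioInv (-X) * ratio X * ratioInv (X ^ 4)))
        = phiX 2 - 2 * X * (phiX 8 * psiX 8 ^ 2 * (psiX 4 ^ 2)⁻¹) := by
      linear_combination (psiX 4 ^ 2)⁻¹ * quot5_sum
        - (psiX 16 * (ratio (-X) * ratioInv X * ratio (X ^ 4)
        + X ^ 4 * (ratioInv (-X) * ratio X * ratioInv (X ^ 4)) - 2 * X ^ 2) - phiX 8) * i - z
    rw [map_ofNat]
    linear_combination (psiX 16 * (ratio (-X) * ratioInv X * ratio (X ^ 4)
      + X ^ 4 * (ratioInv (-X) * ratio X * ratioInv (X ^ 4))) + phiX 2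
      - 2 * X * (phiX 8 * psiX 8 ^ 2 * (psiX 4 ^ 2)⁻¹)) * e - 2 * X ^ 4 * psiX 16 ^ 2 * d + y + x
  refine Vanish.of_mul_eq h ?_ ?_ (((vanish_of_mem (d := 8) ?_ ?_ ?_).add
    (vanish_X_pow_mul (d := 4) ?_ ?_ ?_)).add (vanish_X_pow_mul (d := 2) ?_ ?_ ?_))
  all_goals try apply_rules (maxDepth := 500) (transparency := .reducible) [add_mem, sub_mem,
    neg_mem, mul_mem, X_pow_mem, phiX_mem, psiX_mem, phiNegX_mem, psiNegX_mem,
      inv_mem_multiplesSubring, pow_mem, ofNat_mem]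
  all_goals first | decide | norm_num [constantCoeff_psiX, constantCoeff_phiX,
    constantCoeff_phiNegX, map_ofNat]

theorem vanish_quot6 : Vanish 4 1 (ratio (-X) * ratioInv (X ^ 2) * ratio (X ^ 3)
    + X ^ 2 * (ratioInv (-X) * ratio (X ^ 2) * ratioInv (X ^ 3)) - C (-1) * X ^ 1) := by
  have hFn1 := two_mul_psiX_mul_ratio_neg (k := 1) (by norm_num)
  have hG2 := two_mul_psiX_mul_ratioInv (k := 2) (by norm_num)
  have hF3 := two_mul_psiX_mul_ratio (k := 3) (by norm_num)
  have hGn1 := two_mul_psiX_mul_ratioInv_neg (k := 1) (by norm_num)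
  have hF2 := two_mul_psiX_mul_ratio (k := 2) (by norm_num)
  have hG3 := two_mul_psiX_mul_ratioInv (k := 3) (by norm_num)
  have g := phiNegX_split (k := 1) (by norm_num)
  have y := phiX_sq (k := 2) (by norm_num)
  have f := phiX_split (k := 3) (by norm_num)
  simp only [Nat.reduceMul, pow_one] at hFn1 hG2 hF3 hGn1 hF2 hG3 g y f
  have h : (8 * psiX 4 * psiX 8 * psiX 12) * (X ^ 2 * (ratio (-X) * ratioInv (X ^ 2) * ratio (X ^ 3)
      + X ^ 2 * (ratioInv (-X) * ratio (X ^ 2) * ratioInv (X ^ 3)) - C (-1) * X ^ 1))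
      = (2 * (4 * X ^ 2 * psiX 8 ^ 2 * phiX 12
        + phiX 4 * (phiX 8 * phiX 24 + 4 * X ^ 8 * psiX 16 * psiX 48)
        + 2 * X ^ 2 * phiX 4 * (psiX 4 * psiX 12) - phiX 4 * phiX 2 * phiX 6
        + 4 * X ^ 4 * phiX 4 * psiX 8 * psiX 24))
        + X ^ 1 * (2 * (8 * X ^ 4 * psiX 8 ^ 2 * psiX 24
        - 2 * psiX 8 * (phiX 8 * phiX 24 + 4 * X ^ 8 * psiX 16 * psiX 48)
        + 2 * phiX 4 * psiX 8 * phiX 12)) := by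
    rw [map_neg, map_one]
    linear_combination (2 * psiX 4 * ratio (-X)) * (2 * psiX 8 * (X ^ 2 * ratioInv (X ^ 2))) * hF3
      + (2 * psiX 4 * ratio (-X)) * (phiX 3 + phiX 6) * hG2
      + (phiX 2 - phiX 4) * (phiX 3 + phiX 6) * hFn1
      + (2 * psiX 4 * (X * ratioInv (-X))) * (2 * psiX 8 * ratio (X ^ 2)) * hG3
      + (2 * psiX 4 * (X * ratioInv (-X))) * (phiX 3 - phiX 6) * hF2
      + (phiX 2 + phiX 4) * (phiX 3 - phiX 6) * hGn1 + 2 * phiX 3 * y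
      + 2 * (phiX 4 ^ 2 + 4 * X ^ 2 * psiX 8 ^ 2) * f + 2 * phiX 2 * phiX 6 * g
      + 2 * (phiX 4 - 2 * X * psiX 8) * phiX_two_mul_phiX_six - 2 * phiX 4 * phiX 3 * g
      - 2 * phiX 4 * (phiX 4 - 2 * X * psiX 8) * f
  refine Vanish.of_mul_X_pow_mul_eq h ?_ ?_ ((vanish_of_mem (d := 2) ?_ ?_ ?_).add
    (vanish_X_pow_mul (d := 4) ?_ ?_ ?_))
  all_goals try apply_rules (maxDepth := 500) (transparency := .reducible) [add_mem, sub_mem,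
    neg_mem, mul_mem, X_pow_mem, phiX_mem, psiX_mem, phiNegX_mem, psiNegX_mem,
      inv_mem_multiplesSubring, pow_mem, ofNat_mem]
  all_goals first | decide | norm_num [constantCoeff_psiX, constantCoeff_phiX,
    constantCoeff_phiNegX, map_ofNat]

/-- Isolates the terms with exponent divisible by 4: they are those of 1 +
φ(X⁴)²ψ(X²⁴)/(ψ(X⁴)ψ(X⁸)ψ(X¹²)). -/
theorem vanish_quot7_aux : Vanish 4 0 (psiX 4 * psiX 8 * psiX 12
    * (ratioInv (-X) * ratioInv (X ^ 2) * ratio (X ^ 3)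
      + X ^ 0 * (ratio (-X) * ratio (X ^ 2) * ratioInv (X ^ 3)) - 1) - phiX 4 ^ 2 * psiX 24) := by
  have hGn1 := two_mul_psiX_mul_ratioInv_neg (k := 1) (by norm_num)
  have hG2 := two_mul_psiX_mul_ratioInv (k := 2) (by norm_num)
  have hF3 := two_mul_psiX_mul_ratio (k := 3) (by norm_num)
  have hFn1 := two_mul_psiX_mul_ratio_neg (k := 1) (by norm_num)
  have hF2 := two_mul_psiX_mul_ratio (k := 2) (by norm_num)
  have hG3 := two_mul_psiX_mul_ratioInv (k := 3) (by norm_num)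
  have g := phiNegX_split (k := 1) (by norm_num)
  have y := phiX_sq (k := 2) (by norm_num)
  have f := phiX_split (k := 3) (by norm_num)
  simp only [Nat.reduceMul, pow_one] at hGn1 hG2 hF3 hFn1 hF2 hG3 g y f
  have h : 8 * (X ^ 3 * (psiX 4 * psiX 8 * psiX 12
      * (ratioInv (-X) * ratioInv (X ^ 2) * ratio (X ^ 3)
        + X ^ 0 * (ratio (-X) * ratio (X ^ 2) * ratioInv (X ^ 3)) - 1) - phiX 4 ^ 2 * psiX 24))
      = (2 * (phiX 4 ^ 2 * phiX 12 + 4 * X ^ 2 * psiX 8 ^ 2 * phiX 12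
        - phiX 4 * (phiX 8 * phiX 24 + 4 * X ^ 8 * psiX 16 * psiX 48)
        - 2 * X ^ 2 * phiX 4 * (psiX 4 * psiX 12) - phiX 4 * phiX 2 * phiX 6 + phiX 4 ^ 2 * phiX 12
        - 4 * X ^ 4 * phiX 4 * psiX 8 * psiX 24))
        + X ^ 1 * (2 * (8 * X ^ 4 * psiX 8 ^ 2 * psiX 24
        + 2 * psiX 8 * (phiX 8 * phiX 24 + 4 * X ^ 8 * psiX 16 * psiX 48)
        - 2 * phiX 4 * psiX 8 * phiX 12)) := by
    linear_combination (2 * psiX 4 * (X * ratioInv (-X)))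
      * (2 * psiX 8 * (X ^ 2 * ratioInv (X ^ 2))) * hF3
        + (2 * psiX 4 * (X * ratioInv (-X))) * (phiX 3 + phiX 6) * hG2
        + (phiX 2 - phiX 4) * (phiX 3 + phiX 6) * hGn1
        + (2 * psiX 4 * ratio (-X)) * (2 * psiX 8 * ratio (X ^ 2)) * hG3
        + (2 * psiX 4 * ratio (-X)) * (phiX 3 - phiX 6) * hF2
        + (phiX 2 + phiX 4) * (phiX 3 - phiX 6) * hFn1 + 2 * phiX 3 * y
        + 2 * (phiX 4 ^ 2 + 4 * X ^ 2 * psiX 8 ^ 2) * f - 2 * phiX 2 * phiX 6 * g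
        - 2 * (phiX 4 - 2 * X * psiX 8) * phiX_two_mul_phiX_six + 2 * phiX 4 * phiX 3 * g
        + 2 * phiX 4 * (phiX 4 - 2 * X * psiX 8) * f
  refine Vanish.of_mul_X_pow_mul_eq h ?_ ?_ ((vanish_of_mem (d := 2) ?_ ?_ ?_).add
    (vanish_X_pow_mul (d := 4) ?_ ?_ ?_))
  all_goals try apply_rules (maxDepth := 500) (transparency := .reducible) [add_mem, sub_mem,
    neg_mem, mul_mem, X_pow_mem, phiX_mem, psiX_mem, phiNegX_mem, psiNegX_mem,
      inv_mem_multiplesSubring, pow_mem, ofNat_mem]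
  all_goals first | decide | norm_num [constantCoeff_psiX, constantCoeff_phiX,
    constantCoeff_phiNegX, map_ofNat]

theorem phiX_sq_mul_psiX_dissection : phiX 4 ^ 2 * psiX 24 * (psiX 8 ^ 2 * phiNegX 24 ^ 2)
    = psiX 4 * psiX 8 * psiX 12 * ((psiX 8 ^ 2 * phiNegX 24 ^ 2)
      + X ^ 4 * (phiNegX 16 * phiNegX 48 * phiX 8 * psiX 48
      + 2 * (psiNegX 8 * psiNegX 24) * phiX 24 * psiX 16)) := by
  simpa only [phiX, psiX, phiNegX, psiNegX, ← pow_mul, Nat.reduceMul] using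
    psi_cube_div_dissection (constantCoeff_X_pow (k := 4) (by norm_num)) (pow_ne_zero 4 X_ne_zero)

/-- By the dissection of ψ(q)³/ψ(q³) at q = X⁴, the theta quotient left by `vanish_quot7_aux` is 1
plus terms in the class 4 modulo 8. The class 0 modulo 8 thus reduces to the constant 2. -/
theorem vanish_quot7 : Vanish 8 0 (ratioInv (-X) * ratioInv (X ^ 2) * ratio (X ^ 3)
    + X ^ 0 * (ratio (-X) * ratio (X ^ 2) * ratioInv (X ^ 3)) - C 2 * X ^ 0) := by
  have i := PowerSeries.mul_inv_cancel (psiX 4 * psiX 8 * psiX 12)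
      (by norm_num [constantCoeff_psiX])
  have h : (psiX 8 ^ 2 * phiNegX 24 ^ 2) * (ratioInv (-X) * ratioInv (X ^ 2) * ratio (X ^ 3)
      + X ^ 0 * (ratio (-X) * ratio (X ^ 2) * ratioInv (X ^ 3)) - C 2 * X ^ 0)
      = (psiX 4 * psiX 8 * psiX 12)⁻¹ * (psiX 8 ^ 2 * phiNegX 24 ^ 2)
        * (psiX 4 * psiX 8 * psiX 12 * (ratioInv (-X) * ratioInv (X ^ 2) * ratio (X ^ 3)
          + X ^ 0 * (ratio (-X) * ratio (X ^ 2) * ratioInv (X ^ 3)) - 1) - phiX 4 ^ 2 * psiX 24)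
        + X ^ 4 * ((phiNegX 16 * phiNegX 48 * phiX 8 * psiX 48
        + 2 * (psiNegX 8 * psiNegX 24) * phiX 24 * psiX 16)) := by
    rw [map_ofNat]
    linear_combination (psiX 4 * psiX 8 * psiX 12)⁻¹ * phiX_sq_mul_psiX_dissection
      + (((psiX 8 ^ 2 * phiNegX 24 ^ 2)) * (1 + 1
      - (ratioInv (-X) * ratioInv (X ^ 2) * ratio (X ^ 3)
      + X ^ 0 * (ratio (-X) * ratio (X ^ 2) * ratioInv (X ^ 3))))
      + X ^ 4 * (phiNegX 16 * phiNegX 48 * phiX 8 * psiX 48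
      + 2 * (psiNegX 8 * psiNegX 24) * phiX 24 * psiX 16)) * i
  refine Vanish.of_mul_eq h ?_ ?_
    (.add (Vanish.of_dvd (vanish_quot7_aux.mul ?_) (by norm_num))
      (vanish_X_pow_mul (d := 8) ?_ ?_ ?_))
  all_goals try apply_rules (maxDepth := 500) (transparency := .reducible) [add_mem, sub_mem,
    neg_mem, mul_mem, X_pow_mem, phiX_mem, psiX_mem, phiNegX_mem, psiNegX_mem,
      inv_mem_multiplesSubring, pow_mem, ofNat_mem]
  all_goals first | decide | norm_num [constantCoeff_psiX, constantCoeff_phiX,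
    constantCoeff_phiNegX, map_ofNat]

theorem vanish_quot8_aux : Vanish 4 1 (psiX 4 * psiX 12 * psiX 24
    * (ratio X * ratio (-X ^ 3) * ratio (X ^ 6)
      + X ^ 10 * (ratioInv X * ratioInv (-X ^ 3) * ratioInv (X ^ 6)) + X ^ 5)
      - X * phiX 12 ^ 2 * psiX 8) := by
  have hF1 := two_mul_psiX_mul_ratio (k := 1) (by norm_num)
  have hFn3 := two_mul_psiX_mul_ratio_neg (k := 3) (by norm_num)
  have hF6 := two_mul_psiX_mul_ratio (k := 6) (by norm_num)
  have hG1 := two_mul_psiX_mul_ratioInv (k := 1) (by norm_num)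
  have hGn3 := two_mul_psiX_mul_ratioInv_neg (k := 3) (by norm_num)
  have hG6 := two_mul_psiX_mul_ratioInv (k := 6) (by norm_num)
  have f := phiX_split (k := 1) (by norm_num)
  have y := phiX_sq (k := 6) (by norm_num)
  have g := phiNegX_split (k := 3) (by norm_num)
  simp only [Nat.reduceMul, pow_one] at hF1 hFn3 hF6 hG1 hGn3 hG6 f y g
  have h : 8 * (psiX 4 * psiX 12 * psiX 24 * (ratio X * ratio (-X ^ 3) * ratio (X ^ 6)
      + X ^ 10 * (ratioInv X * ratioInv (-X ^ 3) * ratioInv (X ^ 6)) + X ^ 5)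
      - X * phiX 12 ^ 2 * psiX 8)
      = (2 * (phiX 12 * phiX 2 * phiX 6 + phiX 12 * (phiX 4 * phiX 12
        - 4 * X ^ 4 * psiX 8 * psiX 24) + (phiX 12 ^ 2 + 4 * X ^ 6 * psiX 24 ^ 2) * phiX 4
        + ((phiX 8 * phiX 24 + 4 * X ^ 8 * psiX 16 * psiX 48)
        + 2 * X ^ 2 * (psiX 4 * psiX 12)) * phiX 12))
        + X ^ 3 * (2 * (8 * X ^ 4 * psiX 8 * psiX 24 ^ 2 - 2 * phiX 12 * phiX 4 * psiX 24
        - 2 * psiX 24 * (phiX 8 * phiX 24 + 4 * X ^ 8 * psiX 16 * psiX 48))) := by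
    linear_combination (2 * psiX 4 * ratio X) * (2 * psiX 12 * ratio (-X ^ 3)) * hF6
      + (2 * psiX 4 * ratio X) * (phiX 6 + phiX 12) * hFn3
      + (phiX 6 + phiNegX 3) * (phiX 6 + phiX 12) * hF1
      + (2 * psiX 4 * (X * ratioInv X)) * (2 * psiX 12 * (X ^ 3 * ratioInv (-X ^ 3))) * hG6
      + (2 * psiX 4 * (X * ratioInv X)) * (phiX 6 - phiX 12) * hGn3
      + (phiX 6 - phiNegX 3) * (phiX 6 - phiX 12) * hG1 + 2 * phiX 12 * phiNegX 3 * f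
      + 2 * phiX 12 * (phiX 4 + 2 * X * psiX 8) * g + 2 * phiX 1 * y
      + 2 * (phiX 12 ^ 2 + 4 * X ^ 6 * psiX 24 ^ 2) * f + 2 * phiNegX 3 * phiX_two_mul_phiX_six
      + 2 * ((phiX 8 * phiX 24 + 4 * X ^ 8 * psiX 16 * psiX 48)
      + 2 * X ^ 2 * (psiX 4 * psiX 12)) * g
  refine Vanish.of_mul_eq h ?_ ?_ ((vanish_of_mem (d := 2) ?_ ?_ ?_).add
    (vanish_X_pow_mul (d := 4) ?_ ?_ ?_))
  all_goals try apply_rules (maxDepth := 500) (transparency := .reducible) [add_mem, sub_mem,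
    neg_mem, mul_mem, X_pow_mem, phiX_mem, psiX_mem, phiNegX_mem, psiNegX_mem,
      inv_mem_multiplesSubring, pow_mem, ofNat_mem]
  all_goals first | decide | norm_num [constantCoeff_psiX, constantCoeff_phiX,
    constantCoeff_phiNegX, map_ofNat]

theorem phiX_sq_mul_psiX_dissection_dual : phiX 12 ^ 2 * psiX 8 * (psiX 24 ^ 2 * phiNegX 8 ^ 2)
    = psiX 4 * psiX 12 * psiX 24 * ((phiNegX 16 * phiNegX 48 * phiX 24 * psiX 16
      - 2 * X ^ 8 * (psiNegX 8 * psiNegX 24) * phiX 8 * psiX 48)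
      - X ^ 4 * (psiX 24 ^ 2 * phiNegX 8 ^ 2)) := by
  simpa only [phiX, psiX, phiNegX, psiNegX, ← pow_mul, Nat.reduceMul] using
    psi_cube_pow_div_dissection (constantCoeff_X_pow (k := 4)
      (by norm_num)) (pow_ne_zero 4 X_ne_zero)

/-- `vanish_quot8_aux` contributes -X⁵ and the odd part in the dissection of ψ(q³)³/ψ(q) at q = X⁴
contributes another -X⁵; what remains in the class 1 modulo 4 lies in the class 1 modulo 8. -/
theorem vanish_quot8 : Vanish 8 5 (ratio X * ratio (-X ^ 3) * ratio (X ^ 6)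
    + X ^ 10 * (ratioInv X * ratioInv (-X ^ 3) * ratioInv (X ^ 6)) - C (-2) * X ^ 5) := by
  have i := PowerSeries.mul_inv_cancel (psiX 4 * psiX 12 * psiX 24)
      (by norm_num [constantCoeff_psiX])
  have h : (psiX 24 ^ 2 * phiNegX 8 ^ 2) * (ratio X * ratio (-X ^ 3) * ratio (X ^ 6)
      + X ^ 10 * (ratioInv X * ratioInv (-X ^ 3) * ratioInv (X ^ 6)) - C (-2) * X ^ 5)
      = (psiX 4 * psiX 12 * psiX 24)⁻¹ * (psiX 24 ^ 2 * phiNegX 8 ^ 2)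
        * (psiX 4 * psiX 12 * psiX 24 * (ratio X * ratio (-X ^ 3) * ratio (X ^ 6)
          + X ^ 10 * (ratioInv X * ratioInv (-X ^ 3) * ratioInv (X ^ 6)) + X ^ 5)
          - X * phiX 12 ^ 2 * psiX 8)
        + X ^ 1 * ((phiNegX 16 * phiNegX 48 * phiX 24 * psiX 16
        - 2 * X ^ 8 * (psiNegX 8 * psiNegX 24) * phiX 8 * psiX 48)) := by
    rw [map_neg, map_ofNat]
    linear_combination X * (psiX 4 * psiX 12 * psiX 24)⁻¹ * phiX_sq_mul_psiX_dissection_dual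
      + ((psiX 24 ^ 2 * phiNegX 8 ^ 2) * (-(ratio X * ratio (-X ^ 3) * ratio (X ^ 6)
      + X ^ 10 * (ratioInv X * ratioInv (-X ^ 3) * ratioInv (X ^ 6))) - X ^ 5 - X ^ 5)
      + X * (phiNegX 16 * phiNegX 48 * phiX 24 * psiX 16
      - 2 * X ^ 8 * (psiNegX 8 * psiNegX 24) * phiX 8 * psiX 48)) * i
  refine Vanish.of_mul_eq h ?_ ?_
    (.add (Vanish.of_dvd (vanish_quot8_aux.mul ?_) (by norm_num))
      (vanish_X_pow_mul (d := 8) ?_ ?_ ?_))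
  all_goals try apply_rules (maxDepth := 500) (transparency := .reducible) [add_mem, sub_mem,
    neg_mem, mul_mem, X_pow_mem, phiX_mem, psiX_mem, phiNegX_mem, psiNegX_mem,
      inv_mem_multiplesSubring, pow_mem, ofNat_mem]
  all_goals first | decide | norm_num [constantCoeff_psiX, constantCoeff_phiX,
    constantCoeff_phiNegX, map_ofNat]

theorem vanish_quot9 : Vanish 4 2 (ratio X * ratioInv (-X ^ 3) * ratio (X ^ 6)
    + X ^ 4 * (ratioInv X * ratio (-X ^ 3) * ratioInv (X ^ 6)) - C 1 * X ^ 2) := by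
  have hF1 := two_mul_psiX_mul_ratio (k := 1) (by norm_num)
  have hGn3 := two_mul_psiX_mul_ratioInv_neg (k := 3) (by norm_num)
  have hF6 := two_mul_psiX_mul_ratio (k := 6) (by norm_num)
  have hG1 := two_mul_psiX_mul_ratioInv (k := 1) (by norm_num)
  have hFn3 := two_mul_psiX_mul_ratio_neg (k := 3) (by norm_num)
  have hG6 := two_mul_psiX_mul_ratioInv (k := 6) (by norm_num)
  have f := phiX_split (k := 1) (by norm_num)
  have y := phiX_sq (k := 6) (by norm_num)
  have g := phiNegX_split (k := 3) (by norm_num)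
  simp only [Nat.reduceMul, pow_one] at hF1 hGn3 hF6 hG1 hFn3 hG6 f y g
  have h : (8 * psiX 4 * psiX 12 * psiX 24) * (X ^ 3 * (ratio X * ratioInv (-X ^ 3) * ratio (X ^ 6)
      + X ^ 4 * (ratioInv X * ratio (-X ^ 3) * ratioInv (X ^ 6)) - C 1 * X ^ 2))
      = (2 * (phiX 12 * phiX 2 * phiX 6 - phiX 12 * (phiX 4 * phiX 12
        - 4 * X ^ 4 * psiX 8 * psiX 24) + (phiX 12 ^ 2 + 4 * X ^ 6 * psiX 24 ^ 2) * phiX 4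
        - ((phiX 8 * phiX 24 + 4 * X ^ 8 * psiX 16 * psiX 48)
        + 2 * X ^ 2 * (psiX 4 * psiX 12)) * phiX 12))
        + X ^ 3 * (2 * (8 * X ^ 4 * psiX 8 * psiX 24 ^ 2 + 2 * phiX 12 * phiX 4 * psiX 24
        + 2 * psiX 24 * (phiX 8 * phiX 24 + 4 * X ^ 8 * psiX 16 * psiX 48))) := by
    rw [map_one]
    linear_combination (2 * psiX 4 * ratio X) * (2 * psiX 12 * (X ^ 3 * ratioInv (-X ^ 3))) * hF6
      + (2 * psiX 4 * ratio X) * (phiX 6 + phiX 12) * hGn3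
      + (phiX 6 - phiNegX 3) * (phiX 6 + phiX 12) * hF1
      + (2 * psiX 4 * (X * ratioInv X)) * (2 * psiX 12 * ratio (-X ^ 3)) * hG6
      + (2 * psiX 4 * (X * ratioInv X)) * (phiX 6 - phiX 12) * hFn3
      + (phiX 6 + phiNegX 3) * (phiX 6 - phiX 12) * hG1 - 2 * phiX 12 * phiNegX 3 * f
      - 2 * phiX 12 * (phiX 4 + 2 * X * psiX 8) * g + 2 * phiX 1 * y
      + 2 * (phiX 12 ^ 2 + 4 * X ^ 6 * psiX 24 ^ 2) * f - 2 * phiNegX 3 * phiX_two_mul_phiX_six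
      - 2 * ((phiX 8 * phiX 24 + 4 * X ^ 8 * psiX 16 * psiX 48)
      + 2 * X ^ 2 * (psiX 4 * psiX 12)) * g
  refine Vanish.of_mul_X_pow_mul_eq h ?_ ?_ ((vanish_of_mem (d := 2) ?_ ?_ ?_).add
    (vanish_X_pow_mul (d := 4) ?_ ?_ ?_))
  all_goals try apply_rules (maxDepth := 500) (transparency := .reducible) [add_mem, sub_mem,
    neg_mem, mul_mem, X_pow_mem, phiX_mem, psiX_mem, phiNegX_mem, psiNegX_mem,
      inv_mem_multiplesSubring, pow_mem, ofNat_mem]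
  all_goals first | decide | norm_num [constantCoeff_psiX, constantCoeff_phiX,
    constantCoeff_phiNegX, map_ofNat]

/-! ### The quotients in terms of `ratio` -/

/-- Identifies a quotient and its reciprocal together, without simplifying nested inverses. -/
theorem mul_inv_eq_and_inv_eq {a b g g' : ℂ⟦X⟧} (hb : constantCoeff b ≠ 0) (h : g * b = a)
    (hg : g * g' = 1) : a * b⁻¹ = g ∧ (a * b⁻¹)⁻¹ = g' := by
  have h1 : a * b⁻¹ = g := ((PowerSeries.eq_mul_inv_iff_mul_eq hb).2 h).symm
  have h2 : constantCoeff g ≠ 0 := by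
    intro h0
    have := congrArg constantCoeff hg
    rw [map_mul, h0, zero_mul, map_one] at this
    exact zero_ne_one this
  refine ⟨h1, ?_⟩
  rw [h1]
  exact ((PowerSeries.eq_inv_iff_mul_eq_one h2).2 (by rw [mul_comm, hg])).symm

theorem quot1_eq (k : ℕ) : quot1 k = ratio X ^ k ∧ (quot1 k)⁻¹ = ratioInv X ^ k := by
  refine mul_inv_eq_and_inv_eq (by simp [constantCoeff_T]) ?_ ?_
  · rw [← mul_pow, ratio_mul_T]
  · rw [← mul_pow, ratio_mul_ratioInv, one_pow]

theorem quot2_eq (k : ℕ) : quot2 k = ratioInv X * ratio (X ^ k)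
    ∧ (quot2 k)⁻¹ = ratio X * ratioInv (X ^ k) := by
  refine mul_inv_eq_and_inv_eq (by simp [constantCoeff_S, constantCoeff_T]) ?_ ?_
  · rw [mul_mul_mul_comm, ratioInv_mul_S, ratio_mul_T]
  · rw [mul_mul_mul_comm, mul_comm (ratioInv X), ratio_mul_ratioInv, ratio_mul_ratioInv, mul_one]

theorem quot3_eq (k : ℕ) : quot3 k = ratio X * ratio (X ^ k)
    ∧ (quot3 k)⁻¹ = ratioInv X * ratioInv (X ^ k) := by
  refine mul_inv_eq_and_inv_eq (by simp [constantCoeff_T]) ?_ ?_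
  · rw [mul_mul_mul_comm, ratio_mul_T, ratio_mul_T]
  · rw [mul_mul_mul_comm, ratio_mul_ratioInv, ratio_mul_ratioInv, mul_one]

theorem quot4_eq : quot4 = ratioInv (X ^ 2) * ratio (X ^ 4)
    ∧ quot4⁻¹ = ratio (X ^ 2) * ratioInv (X ^ 4) := by
  refine mul_inv_eq_and_inv_eq (by simp [constantCoeff_S, constantCoeff_T]) ?_ ?_
  · rw [mul_mul_mul_comm, ratioInv_mul_S, ratio_mul_T]
  · rw [mul_mul_mul_comm, mul_comm (ratioInv _), ratio_mul_ratioInv, ratio_mul_ratioInv, mul_one]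

theorem mul_three_mul_mul_three {R : Type*} [CommRing R] {a b c x y z u v w : R}
    (h1 : a * x = u) (h2 : b * y = v) (h3 : c * z = w) :
    a * b * c * (x * y * z) = u * v * w := by
  rw [← h1, ← h2, ← h3]
  ring

theorem ratioInv_mul_ratio (q : ℂ⟦X⟧) : ratioInv q * ratio q = 1 := by
  rw [mul_comm, ratio_mul_ratioInv]

theorem quot5_eq (k : ℕ) : quot5 k = (ratio (-X) * ratioInv X * ratio (X ^ 4)) ^ k
    ∧ (quot5 k)⁻¹ = (ratioInv (-X) * ratio X * ratioInv (X ^ 4)) ^ k := by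
  refine mul_inv_eq_and_inv_eq (by simp [constantCoeff_S, constantCoeff_T]) ?_ ?_
  · rw [← mul_pow, ← mul_pow, ← mul_pow, ← mul_pow, ← mul_pow, mul_comm (S X),
      mul_three_mul_mul_three (ratio_mul_T _) (ratioInv_mul_S _) (ratio_mul_T _)]
  · rw [← mul_pow, mul_three_mul_mul_three (ratio_mul_ratioInv _) (ratioInv_mul_ratio _)
      (ratio_mul_ratioInv _), mul_one, mul_one, one_pow]

theorem quot6_eq : quot6 = ratio (-X) * ratioInv (X ^ 2) * ratio (X ^ 3)
    ∧ quot6⁻¹ = ratioInv (-X) * ratio (X ^ 2) * ratioInv (X ^ 3) := by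
  refine mul_inv_eq_and_inv_eq (by simp [constantCoeff_S, constantCoeff_T])
    (mul_three_mul_mul_three (ratio_mul_T _) (ratioInv_mul_S _) (ratio_mul_T _)) ?_
  rw [mul_three_mul_mul_three (ratio_mul_ratioInv _) (ratioInv_mul_ratio _)
    (ratio_mul_ratioInv _), mul_one, mul_one]

theorem quot7_eq : quot7 = ratioInv (-X) * ratioInv (X ^ 2) * ratio (X ^ 3)
    ∧ quot7⁻¹ = ratio (-X) * ratio (X ^ 2) * ratioInv (X ^ 3) := by
  refine mul_inv_eq_and_inv_eq (by simp [constantCoeff_S, constantCoeff_T])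
    (mul_three_mul_mul_three (ratioInv_mul_S _) (ratioInv_mul_S _) (ratio_mul_T _)) ?_
  rw [mul_three_mul_mul_three (ratioInv_mul_ratio _) (ratioInv_mul_ratio _)
    (ratio_mul_ratioInv _), mul_one, mul_one]

theorem quot8_eq : quot8 = ratio X * ratio (-X ^ 3) * ratio (X ^ 6)
    ∧ quot8⁻¹ = ratioInv X * ratioInv (-X ^ 3) * ratioInv (X ^ 6) := by
  refine mul_inv_eq_and_inv_eq (by simp [constantCoeff_T])
    (mul_three_mul_mul_three (ratio_mul_T _) (ratio_mul_T _) (ratio_mul_T _)) ?_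
  rw [mul_three_mul_mul_three (ratio_mul_ratioInv _) (ratio_mul_ratioInv _)
    (ratio_mul_ratioInv _), mul_one, mul_one]

theorem quot9_eq : quot9 = ratio X * ratioInv (-X ^ 3) * ratio (X ^ 6)
    ∧ quot9⁻¹ = ratioInv X * ratio (-X ^ 3) * ratioInv (X ^ 6) := by
  refine mul_inv_eq_and_inv_eq (by simp [constantCoeff_S, constantCoeff_T])
    (mul_three_mul_mul_three (ratio_mul_T _) (ratioInv_mul_S _) (ratio_mul_T _)) ?_
  rw [mul_three_mul_mul_three (ratio_mul_ratioInv _) (ratioInv_mul_ratio _)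
    (ratio_mul_ratioInv _), mul_one, mul_one]

end GollnitzGordon

/-! ### Reading off the coefficient identities -/

theorem theorem1p5 (n : ℕ) :
    GollnitzGordon.rho1 1 (2 * n + 1) = GollnitzGordon.rho1' 1 (2 * n) ∧
    GollnitzGordon.rho1 1 (4 * n + 2) = -GollnitzGordon.rho1' 1 (4 * n + 1) ∧
    GollnitzGordon.rho1 2 (2 * n + 3) = -GollnitzGordon.rho1' 2 (2 * n + 1) ∧
    GollnitzGordon.rho1 2 (8 * n + 4) = GollnitzGordon.rho1' 2 (8 * n + 2) ∧
    GollnitzGordon.rho1 2 (8 * n + 6) = GollnitzGordon.rho1' 2 (8 * n + 4) ∧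
    GollnitzGordon.rho1 4 (4 * n + 6) = -GollnitzGordon.rho1' 4 (4 * n + 2) ∧
    GollnitzGordon.rho2 3 (4 * n + 5) = -GollnitzGordon.rho2' 3 (4 * n + 3) ∧
    GollnitzGordon.rho2 5 (4 * n + 6) = -GollnitzGordon.rho2' 5 (4 * n + 2) ∧
    GollnitzGordon.rho2 7 (4 * n + 7) = -GollnitzGordon.rho2' 7 (4 * n + 1) ∧
    GollnitzGordon.rho2 9 (4 * n + 10) = -GollnitzGordon.rho2' 9 (4 * n + 2) ∧
    GollnitzGordon.rho3 3 (4 * n + 6) = -GollnitzGordon.rho3' 3 (4 * n + 2) ∧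
    GollnitzGordon.rho3 5 (4 * n + 7) = -GollnitzGordon.rho3' 5 (4 * n + 1) ∧
    GollnitzGordon.rho3 9 (4 * n + 11) = -GollnitzGordon.rho3' 9 (4 * n + 1) ∧
    GollnitzGordon.rho4 (4 * n + 2) = -GollnitzGordon.rho4' (4 * n) ∧
    GollnitzGordon.rho5 1 (4 * n + 6) = -GollnitzGordon.rho5' 1 (4 * n + 2) ∧
    GollnitzGordon.rho5 1 (4 * n + 7) = GollnitzGordon.rho5' 1 (4 * n + 3) ∧
    GollnitzGordon.rho5 1 (8 * n + 4) = -GollnitzGordon.rho5' 1 (8 * n) ∧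
    GollnitzGordon.rho5 1 (8 * n + 5) = GollnitzGordon.rho5' 1 (8 * n + 1) ∧
    GollnitzGordon.rho5 2 (8 * n + 12) = -GollnitzGordon.rho5' 2 (8 * n + 4) ∧
    GollnitzGordon.rho6 (4 * n + 5) = -GollnitzGordon.rho6' (4 * n + 3) ∧
    GollnitzGordon.rho7 (8 * n + 8) = -GollnitzGordon.rho7' (8 * n + 8) ∧
    GollnitzGordon.rho8 (8 * n + 13) = -GollnitzGordon.rho8' (8 * n + 3) ∧
    GollnitzGordon.rho9 (4 * n + 6) = -GollnitzGordon.rho9' (4 * n + 2) := by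
  refine ⟨?_, ?_, ?_, ?_, ?_, ?_, ?_, ?_, ?_, ?_, ?_, ?_, ?_, ?_,
    ?_, ?_, ?_, ?_, ?_, ?_, ?_, ?_, ?_⟩
  · change coeff (2 * n + 1) (GollnitzGordon.quot1 1) = coeff (2 * n) (GollnitzGordon.quot1 1)⁻¹
    rw [(GollnitzGordon.quot1_eq 1).2, (GollnitzGordon.quot1_eq 1).1, pow_one, pow_one]
    exact GollnitzGordon.coeff_eq_of_vanish GollnitzGordon.vanish_quot1_one_odd
      (by rw [Nat.ModEq]; omega)
  -- The larger index is displayed as N + a, with N the index of the reciprocal series and a the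
  -- exponent in the vanishing statement.
  · change coeff (4 * n + 1 + 1) (GollnitzGordon.quot1 1) =
      -coeff (4 * n + 1) (GollnitzGordon.quot1 1)⁻¹
    rw [(GollnitzGordon.quot1_eq 1).2, (GollnitzGordon.quot1_eq 1).1, pow_one, pow_one]
    exact GollnitzGordon.coeff_eq_neg_of_vanish GollnitzGordon.vanish_quot1_one_two
      (by rw [Nat.ModEq]; omega) (by omega)
  · change coeff (2 * n + 1 + 2) (GollnitzGordon.quot1 2) =
      -coeff (2 * n + 1) (GollnitzGordon.quot1 2)⁻¹
    rw [(GollnitzGordon.quot1_eq 2).2, (GollnitzGordon.quot1_eq 2).1]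
    exact GollnitzGordon.coeff_eq_neg_of_vanish GollnitzGordon.vanish_quot1_two_odd
      (by rw [Nat.ModEq]; omega) (by omega)
  · change coeff (8 * n + 2 + 2) (GollnitzGordon.quot1 2) =
      coeff (8 * n + 2) (GollnitzGordon.quot1 2)⁻¹
    rw [(GollnitzGordon.quot1_eq 2).2, (GollnitzGordon.quot1_eq 2).1]
    exact GollnitzGordon.coeff_eq_of_vanish GollnitzGordon.vanish_quot1_two_four
      (by rw [Nat.ModEq]; omega)
  · change coeff (8 * n + 4 + 2) (GollnitzGordon.quot1 2) =
      coeff (8 * n + 4) (GollnitzGordon.quot1 2)⁻¹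
    rw [(GollnitzGordon.quot1_eq 2).2, (GollnitzGordon.quot1_eq 2).1]
    exact GollnitzGordon.coeff_eq_of_vanish GollnitzGordon.vanish_quot1_two_six
      (by rw [Nat.ModEq]; omega)
  · change coeff (4 * n + 2 + 4) (GollnitzGordon.quot1 4) =
      -coeff (4 * n + 2) (GollnitzGordon.quot1 4)⁻¹
    rw [(GollnitzGordon.quot1_eq 4).2, (GollnitzGordon.quot1_eq 4).1]
    exact GollnitzGordon.coeff_eq_neg_of_vanish GollnitzGordon.vanish_quot1_four
      (by rw [Nat.ModEq]; omega) (by omega)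
  · change coeff (4 * n + 3 + 2) (GollnitzGordon.quot2 3) =
      -coeff (4 * n + 3) (GollnitzGordon.quot2 3)⁻¹
    rw [(GollnitzGordon.quot2_eq 3).2, (GollnitzGordon.quot2_eq 3).1]
    exact GollnitzGordon.coeff_eq_neg_of_vanish GollnitzGordon.vanish_quot2_three
      (by rw [Nat.ModEq]; omega) (by omega)
  · change coeff (4 * n + 2 + 4) (GollnitzGordon.quot2 5) =
      -coeff (4 * n + 2) (GollnitzGordon.quot2 5)⁻¹
    rw [(GollnitzGordon.quot2_eq 5).2, (GollnitzGordon.quot2_eq 5).1]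
    exact GollnitzGordon.coeff_eq_neg_of_vanish GollnitzGordon.vanish_quot2_five
      (by rw [Nat.ModEq]; omega) (by omega)
  · change coeff (4 * n + 1 + 6) (GollnitzGordon.quot2 7) =
      -coeff (4 * n + 1) (GollnitzGordon.quot2 7)⁻¹
    rw [(GollnitzGordon.quot2_eq 7).2, (GollnitzGordon.quot2_eq 7).1]
    exact GollnitzGordon.coeff_eq_neg_of_vanish GollnitzGordon.vanish_quot2_seven
      (by rw [Nat.ModEq]; omega) (by omega)
  · change coeff (4 * n + 2 + 8) (GollnitzGordon.quot2 9) =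
      -coeff (4 * n + 2) (GollnitzGordon.quot2 9)⁻¹
    rw [(GollnitzGordon.quot2_eq 9).2, (GollnitzGordon.quot2_eq 9).1]
    exact GollnitzGordon.coeff_eq_neg_of_vanish GollnitzGordon.vanish_quot2_nine
      (by rw [Nat.ModEq]; omega) (by omega)
  · change coeff (4 * n + 2 + 4) (GollnitzGordon.quot3 3) =
      -coeff (4 * n + 2) (GollnitzGordon.quot3 3)⁻¹
    rw [(GollnitzGordon.quot3_eq 3).2, (GollnitzGordon.quot3_eq 3).1]
    exact GollnitzGordon.coeff_eq_neg_of_vanish GollnitzGordon.vanish_quot3_three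
      (by rw [Nat.ModEq]; omega) (by omega)
  · change coeff (4 * n + 1 + 6) (GollnitzGordon.quot3 5) =
      -coeff (4 * n + 1) (GollnitzGordon.quot3 5)⁻¹
    rw [(GollnitzGordon.quot3_eq 5).2, (GollnitzGordon.quot3_eq 5).1]
    exact GollnitzGordon.coeff_eq_neg_of_vanish GollnitzGordon.vanish_quot3_five
      (by rw [Nat.ModEq]; omega) (by omega)
  · change coeff (4 * n + 1 + 10) (GollnitzGordon.quot3 9) =
      -coeff (4 * n + 1) (GollnitzGordon.quot3 9)⁻¹
    rw [(GollnitzGordon.quot3_eq 9).2, (GollnitzGordon.quot3_eq 9).1]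
    exact GollnitzGordon.coeff_eq_neg_of_vanish GollnitzGordon.vanish_quot3_nine
      (by rw [Nat.ModEq]; omega) (by omega)
  · change coeff (4 * n + 2) (GollnitzGordon.quot4) = -coeff (4 * n) (GollnitzGordon.quot4)⁻¹
    rw [GollnitzGordon.quot4_eq.2, GollnitzGordon.quot4_eq.1]
    exact GollnitzGordon.coeff_eq_neg_of_vanish GollnitzGordon.vanish_quot4
      (by rw [Nat.ModEq]; omega) (by omega)
  · change coeff (4 * n + 2 + 4) (GollnitzGordon.quot5 1) =
      -coeff (4 * n + 2) (GollnitzGordon.quot5 1)⁻¹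
    rw [(GollnitzGordon.quot5_eq 1).2, (GollnitzGordon.quot5_eq 1).1, pow_one, pow_one]
    exact GollnitzGordon.coeff_eq_neg_of_vanish GollnitzGordon.vanish_quot5_one_two
      (by rw [Nat.ModEq]; omega) (by omega)
  · change coeff (4 * n + 3 + 4) (GollnitzGordon.quot5 1) =
      coeff (4 * n + 3) (GollnitzGordon.quot5 1)⁻¹
    rw [(GollnitzGordon.quot5_eq 1).2, (GollnitzGordon.quot5_eq 1).1, pow_one, pow_one]
    exact GollnitzGordon.coeff_eq_of_vanish GollnitzGordon.vanish_quot5_one_three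
      (by rw [Nat.ModEq]; omega)
  · change coeff (8 * n + 4) (GollnitzGordon.quot5 1) = -coeff (8 * n) (GollnitzGordon.quot5 1)⁻¹
    rw [(GollnitzGordon.quot5_eq 1).2, (GollnitzGordon.quot5_eq 1).1, pow_one, pow_one]
    exact GollnitzGordon.coeff_eq_neg_of_vanish GollnitzGordon.vanish_quot5_one_four
      (by rw [Nat.ModEq]; omega) (by omega)
  · change coeff (8 * n + 1 + 4) (GollnitzGordon.quot5 1) =
      coeff (8 * n + 1) (GollnitzGordon.quot5 1)⁻¹
    rw [(GollnitzGordon.quot5_eq 1).2, (GollnitzGordon.quot5_eq 1).1, pow_one, pow_one]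
    exact GollnitzGordon.coeff_eq_of_vanish GollnitzGordon.vanish_quot5_one_five
      (by rw [Nat.ModEq]; omega)
  · change coeff (8 * n + 4 + 8) (GollnitzGordon.quot5 2) =
      -coeff (8 * n + 4) (GollnitzGordon.quot5 2)⁻¹
    rw [(GollnitzGordon.quot5_eq 2).2, (GollnitzGordon.quot5_eq 2).1]
    exact GollnitzGordon.coeff_eq_neg_of_vanish GollnitzGordon.vanish_quot5_two
      (by rw [Nat.ModEq]; omega) (by omega)
  · change coeff (4 * n + 3 + 2) (GollnitzGordon.quot6) =
      -coeff (4 * n + 3) (GollnitzGordon.quot6)⁻¹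
    rw [GollnitzGordon.quot6_eq.2, GollnitzGordon.quot6_eq.1]
    exact GollnitzGordon.coeff_eq_neg_of_vanish GollnitzGordon.vanish_quot6
      (by rw [Nat.ModEq]; omega) (by omega)
  -- Here a = 0, and the range starts at 8 because both constant terms are 1: index 0 is the
  -- exception recorded by the constant 2.
  · change coeff (8 * n + 8 + 0) (GollnitzGordon.quot7) =
      -coeff (8 * n + 8) (GollnitzGordon.quot7)⁻¹
    rw [GollnitzGordon.quot7_eq.2, GollnitzGordon.quot7_eq.1]
    exact GollnitzGordon.coeff_eq_neg_of_vanish GollnitzGordon.vanish_quot7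
      (by rw [Nat.ModEq]; omega) (by omega)
  · change coeff (8 * n + 3 + 10) (GollnitzGordon.quot8) =
      -coeff (8 * n + 3) (GollnitzGordon.quot8)⁻¹
    rw [GollnitzGordon.quot8_eq.2, GollnitzGordon.quot8_eq.1]
    exact GollnitzGordon.coeff_eq_neg_of_vanish GollnitzGordon.vanish_quot8
      (by rw [Nat.ModEq]; omega) (by omega)
  · change coeff (4 * n + 2 + 4) (GollnitzGordon.quot9) =
      -coeff (4 * n + 2) (GollnitzGordon.quot9)⁻¹
    rw [GollnitzGordon.quot9_eq.2, GollnitzGordon.quot9_eq.1]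
    exact GollnitzGordon.coeff_eq_neg_of_vanish GollnitzGordon.vanish_quot9
      (by rw [Nat.ModEq]; omega) (by omega)
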